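/- Let $n\ge 0$, let $M$ be a smooth (Hausdorff, second countable) manifold of dimension $2n+1$ without boundary, with a cooriented contact structure $\xi=\ker\alpha$ ($\alpha$ a contact form), and let $L$ be a compact smooth $n$-manifold without boundary. A Legendrian isotopy $\{L_t\}_{t\in[0,1]}$ is a path of Legendrian submanifolds $L_t=F_t(L)$, where all $F_t:L\to M$ are Legendrian embeddings and $(t,x)\mapsto F_t(x)$ is smooth on $[t_i,t_{i+1}]\times L$ for some subdivision $0=t_0<\dots<t_k=1$ (so that concatenations are allowed). Its homotopy class is taken among such isotopies with fixed endpoints $L_0$, $L_1$: a homotopy is a two-parameter family of Legendrian embeddings of $L$, continuous on $[0,1]^2\times L$ and smooth on the cells of a subdivision of $[0,1]^2$ into rectangles. A piece $\{L_t\}_{t\in[a,b]}$, $a<b$, is *embedded* if $[a,b]\times L\to M$, $(t,x)\mapsto F_t(x)$, is a smooth embedding. It is *positive* (*negative*) if it extends to a contact isotopy of $M$, starting at the identity, whose contact Hamiltonian $H_t$ is positive (negative) at every point of $L_t$ for all $t\in[a,b]$. The *discriminant length* of the homotopy class of $\{L_t\}$ is the minimal $N$ such that the class has a representative $\{E_t\}$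 and a subdivision $0=t_0<\dots<t_N=1$ for which every piece $\{E_t\}_{t\in[t_i,t_{i+1}]}$ is embedded. The *zigzag length* is the minimal $N$ when each piece is moreover required to be positive or negative (not necessarily with alternating signs). Both lengths are $0$ by definition for the class of a constant isotopy, and $\infty$ if there is no such $N$. **Proposition.** For every Legendrian isotopy $\{L_t\}_{t\in[0,1]}$ in $M$, $$\text{discriminant length of }[\{L_t\}]\;\le\;\text{zigzag length of }[\{L_t\}]\;\le\;2\cdot\text{discriminant length of }[\{L_t\}].$$ In particular the Legendrian discriminant and zigzag lengths are equivalent. -/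

import Mathlib

open Set
open scoped Manifold ContDiff

noncomputable section

namespace LegendrianLength

section Contact

variable {n : ℕ} {M : Type*} [TopologicalSpace M]
  [ChartedSpace (EuclideanSpace ℝ (Fin (2 * n + 1))) M]

/-- A field of linear forms on the tangent spaces of the `(2n+1)`-dimensional manifold `M`. -/
abbrev OneForm (n : ℕ) (M : Type*) [TopologicalSpace M]
    [ChartedSpace (EuclideanSpace ℝ (Fin (2 * n + 1))) M] : Type _ :=
  (x : M) → TangentSpace (𝓡 (2 * n + 1)) x →L[ℝ] ℝ

/-- The expression of a 1-form in the preferred chart at `x` (its pullback by the inverse of the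
chart), a 1-form on the model Euclidean space. -/
def localForm (α : OneForm n M) (x : M) (y : EuclideanSpace ℝ (Fin (2 * n + 1))) :
    EuclideanSpace ℝ (Fin (2 * n + 1)) →L[ℝ] ℝ :=
  (α ((extChartAt (𝓡 (2 * n + 1)) x).symm y)).comp
    (mfderiv 𝓘(ℝ, EuclideanSpace ℝ (Fin (2 * n + 1))) (𝓡 (2 * n + 1))
      (extChartAt (𝓡 (2 * n + 1)) x).symm y)

/-- The exterior derivative `dα` at `x`, computed in the preferred chart at `x`, which is also the
chart through which Mathlib identifies `TangentSpace _ x` with the model space: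
`dα(u, v) = D_u α(v) - D_v α(u)`. -/
def extD (α : OneForm n M) (x : M) (u v : TangentSpace (𝓡 (2 * n + 1)) x) : ℝ :=
  fderiv ℝ (localForm α x) (extChartAt (𝓡 (2 * n + 1)) x x) u v
    - fderiv ℝ (localForm α x) (extChartAt (𝓡 (2 * n + 1)) x x) v u

/-- `α` is a contact form: a smooth, nowhere vanishing 1-form such that `dα` is nondegenerate on
the hyperplane field `ξ = ker α`. -/
structure IsContactForm [IsManifold (𝓡 (2 * n + 1)) ∞ M] (α : OneForm n M) : Prop where
  smooth : ContMDiff (𝓡 (2 * n + 1)).tangent 𝓘(ℝ, ℝ) ∞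
    (fun v : TangentBundle (𝓡 (2 * n + 1)) M => α v.1 v.2)
  ne_zero : ∀ x, α x ≠ 0
  nondegenerate : ∀ (x : M) (u : TangentSpace (𝓡 (2 * n + 1)) x), α x u = 0 →
    (∀ v : TangentSpace (𝓡 (2 * n + 1)) x, α x v = 0 → extD α x u v = 0) → u = 0

/-- `φ` is a contactomorphism of `(M, ker α)` (preserving the coorientation): a diffeomorphism
with `φ^* α = e^g α` for some function `g`. -/
def IsContactomorphism (α : OneForm n M) (φ : M → M) : Prop :=
  (∃ e : M ≃ₘ⟮𝓡 (2 * n + 1), 𝓡 (2 * n + 1)⟯ M, ⇑e = φ) ∧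
  ∃ g : M → ℝ, ∀ (x : M) (v : TangentSpace (𝓡 (2 * n + 1)) x),
    α (φ x) (mfderiv (𝓡 (2 * n + 1)) (𝓡 (2 * n + 1)) φ x v) = Real.exp (g x) * α x v

/-- `Φ` is a contact isotopy, parametrized by `t ∈ [a, b]` and starting at the identity. -/
structure IsContactIsotopy (α : OneForm n M) (a b : ℝ) (Φ : ℝ → M → M) : Prop where
  smooth : ContMDiffOn (𝓘(ℝ, ℝ).prod (𝓡 (2 * n + 1))) (𝓡 (2 * n + 1)) ∞
    (fun p : ℝ × M => Φ p.1 p.2) (Icc a b ×ˢ univ)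
  start : Φ a = id
  contacto : ∀ t ∈ Icc a b, IsContactomorphism α (Φ t)

/-- `h` is the contact Hamiltonian of `Φ`: `α(dΦ_t(x)/dt) = h_t(Φ_t(x))` for `t ∈ [a, b]`. -/
def IsHamiltonianOf (α : OneForm n M) (a b : ℝ) (Φ : ℝ → M → M) (h : ℝ → M → ℝ) : Prop :=
  ∀ t ∈ Icc a b, ∀ x : M,
    α (Φ t x) (mfderivWithin 𝓘(ℝ, ℝ) (𝓡 (2 * n + 1)) (fun s => Φ s x) (Icc a b) t (1 : ℝ))
      = h t (Φ t x)

end Contact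

section Legendrian

variable {n : ℕ} {M : Type*} [TopologicalSpace M]
  [ChartedSpace (EuclideanSpace ℝ (Fin (2 * n + 1))) M]
  {L : Type*} [TopologicalSpace L] [ChartedSpace (EuclideanSpace ℝ (Fin n)) L]

/-- `f` is a Legendrian embedding of the `n`-dimensional manifold `L`: a smooth embedding
everywhere tangent to `ξ = ker α`. The Legendrian submanifold is `range f`. -/
structure IsLegendrianEmbedding (α : OneForm n M) (f : L → M) : Prop where
  smooth : ContMDiff (𝓡 n) (𝓡 (2 * n + 1)) ∞ f
  isEmbedding : Topology.IsEmbedding f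
  immersion : ∀ x, Function.Injective (mfderiv (𝓡 n) (𝓡 (2 * n + 1)) f x)
  tangent : ∀ (x : L) (v : TangentSpace (𝓡 n) x),
    α (f x) (mfderiv (𝓡 n) (𝓡 (2 * n + 1)) f x v) = 0

/-- `0 = t 0 < t 1 < ... < t N = 1` (the values of `t` beyond `N` are irrelevant). -/
def IsSubdivision (N : ℕ) (t : ℕ → ℝ) : Prop :=
  t 0 = 0 ∧ t N = 1 ∧ ∀ i < N, t i < t (i + 1)

/-- `F` is (a parametrization of) the Legendrian isotopy `L_t = range (F t)`, `t ∈ [0, 1]`.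
Concatenations of smooth Legendrian isotopies are allowed: `F` is smooth on `[t_i, t_{i+1}] × L`
for some subdivision of `[0, 1]`. Values of `F` outside `[0, 1]` are irrelevant. -/
def IsLegendrianIsotopy (α : OneForm n M) (F : ℝ → L → M) : Prop :=
  (∀ t ∈ Icc (0 : ℝ) 1, IsLegendrianEmbedding α (F t)) ∧
  ∃ (N : ℕ) (t : ℕ → ℝ), IsSubdivision N t ∧ ∀ i < N,
    ContMDiffOn (𝓘(ℝ, ℝ).prod (𝓡 n)) (𝓡 (2 * n + 1)) ∞
      (fun p : ℝ × L => F p.1 p.2) (Icc (t i) (t (i + 1)) ×ˢ univ)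

/-- `H s t`, `(s, t) ∈ [0, 1]²`, is a homotopy with fixed endpoints, `s` being the deformation
parameter: all `H s t` are Legendrian embeddings, `H` is smooth on the cells of a subdivision of
the square, and the Legendrian submanifolds at `t = 0` and at `t = 1` do not depend on `s`. -/
structure IsHomotopy (α : OneForm n M) (H : ℝ → ℝ → L → M) : Prop where
  legendrian : ∀ s ∈ Icc (0 : ℝ) 1, ∀ t ∈ Icc (0 : ℝ) 1, IsLegendrianEmbedding α (H s t)
  smooth : ∃ (K : ℕ) (σ : ℕ → ℝ) (N : ℕ) (τ : ℕ → ℝ), IsSubdivision K σ ∧ IsSubdivision N τ ∧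
    ∀ j < K, ∀ i < N,
      ContMDiffOn (𝓘(ℝ, ℝ).prod (𝓘(ℝ, ℝ).prod (𝓡 n))) (𝓡 (2 * n + 1)) ∞
        (fun p : ℝ × ℝ × L => H p.1 p.2.1 p.2.2)
        (Icc (σ j) (σ (j + 1)) ×ˢ (Icc (τ i) (τ (i + 1)) ×ˢ univ))
  start_fixed : ∀ s ∈ Icc (0 : ℝ) 1, range (H s 0) = range (H 0 0)
  end_fixed : ∀ s ∈ Icc (0 : ℝ) 1, range (H s 1) = range (H 0 1)

/-- The Legendrian isotopy `E` represents the homotopy class, with fixed endpoints, of the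
Legendrian isotopy `{range (F t)}`: there is a homotopy from the path of submanifolds
`range (F t)` to the path `range (E t)`, parametrized so that it ends at the given
parametrization `E`. -/
def Represents (α : OneForm n M) (F E : ℝ → L → M) : Prop :=
  ∃ H : ℝ → ℝ → L → M, IsHomotopy α H ∧
    (∀ t ∈ Icc (0 : ℝ) 1, range (H 0 t) = range (F t)) ∧
    (∀ t ∈ Icc (0 : ℝ) 1, H 1 t = E t)

/-- The piece `{L_t}_{t ∈ [a, b]}` is embedded, i.e. `[a, b] × L → M`, `(t, x) ↦ F t x`, is a
smooth embedding. -/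
structure IsEmbeddedPiece (F : ℝ → L → M) (a b : ℝ) : Prop where
  smooth : ContMDiffOn (𝓘(ℝ, ℝ).prod (𝓡 n)) (𝓡 (2 * n + 1)) ∞
    (fun p : ℝ × L => F p.1 p.2) (Icc a b ×ˢ univ)
  isEmbedding : Topology.IsEmbedding
    ((Icc a b ×ˢ (univ : Set L)).domRestrict (fun p : ℝ × L => F p.1 p.2))
  immersion : ∀ p ∈ Icc a b ×ˢ (univ : Set L), Function.Injective
    (mfderivWithin (𝓘(ℝ, ℝ).prod (𝓡 n)) (𝓡 (2 * n + 1))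
      (fun p : ℝ × L => F p.1 p.2) (Icc a b ×ˢ univ) p)

/-- The piece `{L_t}_{t ∈ [a, b]}` extends to a contact isotopy of `M` whose contact Hamiltonian
is positive along `L_t` for all `t ∈ [a, b]`. -/
def IsPositivePiece (α : OneForm n M) (F : ℝ → L → M) (a b : ℝ) : Prop :=
  ∃ (Φ : ℝ → M → M) (h : ℝ → M → ℝ), IsContactIsotopy α a b Φ ∧ IsHamiltonianOf α a b Φ h ∧
    (∀ t ∈ Icc a b, Φ t '' range (F a) = range (F t)) ∧
    ∀ t ∈ Icc a b, ∀ y ∈ range (F t), 0 < h t y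

/-- The piece `{L_t}_{t ∈ [a, b]}` extends to a contact isotopy of `M` whose contact Hamiltonian
is negative along `L_t` for all `t ∈ [a, b]`. -/
def IsNegativePiece (α : OneForm n M) (F : ℝ → L → M) (a b : ℝ) : Prop :=
  ∃ (Φ : ℝ → M → M) (h : ℝ → M → ℝ), IsContactIsotopy α a b Φ ∧ IsHamiltonianOf α a b Φ h ∧
    (∀ t ∈ Icc a b, Φ t '' range (F a) = range (F t)) ∧
    ∀ t ∈ Icc a b, ∀ y ∈ range (F t), h t y < 0

/-- The homotopy class of `F` is that of a constant Legendrian isotopy. -/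
def IsConstantClass (α : OneForm n M) (F : ℝ → L → M) : Prop :=
  ∃ E : ℝ → L → M, Represents α F E ∧ ∀ t ∈ Icc (0 : ℝ) 1, range (E t) = range (E 0)

/-- The homotopy class of `F` has a representative that is a concatenation of `N` pieces
`{L_t}_{t ∈ [t_i, t_{i+1}]}` each of which has the property `P`. Since `0 ≠ 1`, this forces
`N ≥ 1`. -/
def HasDecomposition (α : OneForm n M) (P : (ℝ → L → M) → ℝ → ℝ → Prop) (F : ℝ → L → M)
    (N : ℕ) : Prop :=
  ∃ (E : ℝ → L → M) (t : ℕ → ℝ), Represents α F E ∧ IsSubdivision N t ∧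
    ∀ i < N, P E (t i) (t (i + 1))

/-- The minimal number of pieces with property `P` in a representative of the homotopy class of
`F` (`⊤` if there is no such representative), and `0` for the class of a constant isotopy. -/
def pieceLength (α : OneForm n M) (P : (ℝ → L → M) → ℝ → ℝ → Prop) (F : ℝ → L → M) : ℕ∞ :=
  sInf {k : ℕ∞ | ∃ N : ℕ, k = N ∧
    (N = 0 ∧ IsConstantClass α F ∨ HasDecomposition α P F N)}

/-- The discriminant length of the homotopy class of `F`: all pieces are embedded. -/
def discriminantLength (α : OneForm n M) (F : ℝ → L → M) : ℕ∞ :=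
  pieceLength α (fun E a b => IsEmbeddedPiece (n := n) E a b) F

/-- The zigzag length of the homotopy class of `F`: all pieces are embedded, and each of them is
positive or negative. -/
def zigzagLength (α : OneForm n M) (F : ℝ → L → M) : ℕ∞ :=
  pieceLength α (fun E a b => IsEmbeddedPiece (n := n) E a b ∧
    (IsPositivePiece α E a b ∨ IsNegativePiece α E a b)) F

end Legendrian

end LegendrianLength

end

open Set
open scoped Manifold ContDiff Topology

noncomputable section

namespace LegendrianLength

/-! ### Inverse function theorem, and smoothness of postcomposition on spaces of continuous maps. -/

section Calculus

universe u

variable {E F : Type u} [NormedAddCommGroup E] [NormedSpace ℝ E]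
  [NormedAddCommGroup F] [NormedSpace ℝ F]

/-! That the discriminant length is at most the zigzag length is immediate: signed embedded pieces
are embedded pieces. For the factor 2 it suffices to deform a single embedded piece `E` over `[a,
b]`, relative to its endpoints, into a positive embedded piece followed by a negative one
(`exists_zigzag`), and to glue these deformations over all pieces.

Push `E a` off itself by a contact flow `ρ` that is positive along it (`exists_pushoff`). For small
`ε` the map `(s, x) ↦ ρ_s(E_a x)` on `[0, ε] × L` is an embedding; let `P` be the image of `E a`
under `ρ_ε`. Suppose that `Ω` is a contact isotopy carrying `E a` along the piece up to `E b`, and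
`A` a contact isotopy that fixes `E a` and agrees with `Ω` on `P`. Then `A₁ ρ_s(E_a)`, with `s`
increasing from `0` to `ε`, goes from `E a` to `A₁(P) = Ω₁(P)`, and `Ω₁ ρ_s(E_a)`, with `s`
decreasing from `ε` to `0`, goes from there to `E b`. Contactomorphisms preserve the coorientation
and embeddedness, so the first path is positive, the second negative, and both are embedded.
Replacing `A₁` and `Ω₁` by earlier stages and shrinking the pushoff gives the homotopy back to `E`.

The pair `Ω`, `A` exists exactly because the piece is embedded (`exists_sweep`). A short initial
part, from `E a` to `E c`, is disjoint from `P` and extends to a contact isotopy `χ` fixing `P`. The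
remaining part, from `E c` to `E b`, is disjoint from `E a` and extends to a contact isotopy `ψ`
fixing `E a`. Take `Ω` to be `χ` followed by `ψ`, and `A` to be `ψ` alone.

The main tool is the Legendrian isotopy extension theorem relative to a closed set
(`exists_isotopy_extension`). The velocity of a Legendrian path prescribes the 1-jet of a
Hamiltonian along its graph. The prescription is solvable locally, because the path is tangent to
the contact structure, and it is stable under interpolation by cutoffs, so local solutions can be
patched and then cut off away from the closed set. The resulting time-dependent contact field is
integrated as an autonomous field on `ℝ × M`; Cartan's formula shows that its flow consists of
contactomorphisms. Smoothness of flows comes from the inverse function theorem in a space of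
continuous curves. -/

/-- The inverse function theorem with a smooth local inverse on a neighbourhood. -/
theorem exists_contDiffOn_localInverse [CompleteSpace E] {f : E → F} {a : E} (A : E ≃L[ℝ] F)
    (hf : ∀ᶠ x in 𝓝 a, ContDiffAt ℝ ∞ f x) (hA : HasFDerivAt f (A : E →L[ℝ] F) a) :
    ∃ g : F → E, (∀ᶠ y in 𝓝 (f a), ContDiffAt ℝ ∞ g y) ∧ g (f a) = a ∧
      (∀ᶠ x in 𝓝 a, g (f x) = x) ∧ ∀ᶠ y in 𝓝 (f a), f (g y) = y := by
  have hfa := hf.self_of_nhds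
  let e := hfa.toOpenPartialHomeomorph f hA (by simp)
  have he : (e : E → F) = f := rfl
  have ha : a ∈ e.source := hfa.mem_toOpenPartialHomeomorph_source hA (by simp)
  have hfat : f a ∈ e.target := e.map_source ha
  have hinv : e.symm (f a) = a := e.left_inv ha
  have hcont : ContinuousAt e.symm (f a) := e.continuousAt_symm hfat
  refine ⟨e.symm, ?_, hinv, ?_, ?_⟩
  · have h1 : ∀ᶠ x in 𝓝 a, fderiv ℝ f x ∈ range ((↑) : (E ≃L[ℝ] F) → E →L[ℝ] F) := by
      have hc : ContinuousAt (fderiv ℝ f) a :=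
        (hfa.fderiv_right (m := 0) (by simp)).continuousAt
      exact hc (ContinuousLinearEquiv.isOpen.mem_nhds ⟨A, hA.fderiv.symm⟩)
    have h2 : ∀ᶠ y in 𝓝 (f a), fderiv ℝ f (e.symm y) ∈
        range ((↑) : (E ≃L[ℝ] F) → E →L[ℝ] F) ∧ ContDiffAt ℝ ∞ f (e.symm y) := by
      have := (h1.and hf)
      rw [← hinv] at this
      exact hcont.eventually this
    filter_upwards [h2, e.open_target.mem_nhds hfat] with y hy hyt
    obtain ⟨⟨B, hB⟩, hfy⟩ := hy
    refine e.contDiffAt_symm (f₀' := B) hyt ?_ hfy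
    rw [hB]
    exact (hfy.differentiableAt (by simp)).hasFDerivAt
  · filter_upwards [e.open_source.mem_nhds ha] with x hx using e.left_inv hx
  · filter_upwards [e.open_target.mem_nhds hfat] with x hx using e.right_inv hx

/-- A smooth map of finite-dimensional spaces with injective derivative has a smooth local left
inverse. -/
theorem exists_contDiffOn_leftInverse [FiniteDimensional ℝ E] [FiniteDimensional ℝ F]
    {f : E → F} {a : E} (hf : ∀ᶠ x in 𝓝 a, ContDiffAt ℝ ∞ f x)
    (hinj : Function.Injective (fderiv ℝ f a)) :
    ∃ g : F → E, (∀ᶠ y in 𝓝 (f a), ContDiffAt ℝ ∞ g y) ∧ (∀ᶠ x in 𝓝 a, g (f x) = x) := by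
  have : CompleteSpace E := FiniteDimensional.complete ℝ E
  obtain ⟨B, hB⟩ := (fderiv ℝ f a).toLinearMap.exists_leftInverse_of_injective
    (LinearMap.ker_eq_bot.mpr hinj)
  let B' : F →L[ℝ] E := LinearMap.toContinuousLinearMap B
  have hd : HasFDerivAt (fun x => B' (f x)) ((ContinuousLinearEquiv.refl ℝ E : E ≃L[ℝ] E) :
      E →L[ℝ] E) a := by
    have h := B'.hasFDerivAt.comp a (hf.self_of_nhds.differentiableAt (by simp)).hasFDerivAt
    refine h.congr_fderiv ?_
    ext v
    exact congrArg (fun l => l v) hB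
  obtain ⟨g, hg, hga, hgl, -⟩ := exists_contDiffOn_localInverse (f := fun x => B' (f x)) _
    (hf.mono fun x hx => B'.contDiff.contDiffAt.comp x hx) hd
  refine ⟨fun y => g (B' y), ?_, hgl⟩
  have := (B'.continuous.continuousAt (x := f a)).eventually hg
  filter_upwards [this] with y hy
  exact hy.comp y B'.contDiff.contDiffAt

variable {K : Type*} [TopologicalSpace K] [CompactSpace K]

/-- Pointwise application of a continuous family of linear maps to a continuous function. -/
def pointwiseApply : C(K, E →L[ℝ] F) →L[ℝ] C(K, E) →L[ℝ] C(K, F) :=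
  LinearMap.mkContinuous₂
    (LinearMap.mk₂ ℝ (fun (A : C(K, E →L[ℝ] F)) (h : C(K, E)) =>
        (⟨fun k => A k (h k), by fun_prop⟩ : C(K, F)))
      (fun _ _ _ => by ext; simp) (fun _ _ _ => by ext; simp)
      (fun _ _ _ => by ext; simp) (fun _ _ _ => by ext; simp)) 1 (by
    intro A h
    rw [ContinuousMap.norm_le _ (by positivity)]
    intro k
    simp only [LinearMap.mk₂_apply, ContinuousMap.coe_mk, one_mul]
    exact (A k).le_of_opNorm_le_of_le (A.norm_coe_le_norm k) (h.norm_coe_le_norm k))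

/-- Postcomposition with `fderiv ℝ f` is continuous for the sup norm, so the derivative of `f`
varies by at most `c` on all segments from `γ k` to a nearby `η k`, uniformly in `k`. The mean value
inequality on these segments then gives a remainder bound uniform in `k`. -/
theorem hasFDerivAt_postcomp {f : E → F} (hf : ContDiff ℝ 1 f) (γ : C(K, E)) :
    HasFDerivAt (fun γ : C(K, E) => (⟨f, hf.continuous⟩ : C(E, F)).comp γ)
      (pointwiseApply ((⟨fderiv ℝ f, hf.continuous_fderiv (by simp)⟩ : C(E, E →L[ℝ] F)).comp γ))
      γ := by
  set D : C(K, E) → C(K, E →L[ℝ] F) :=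
    fun γ => (⟨fderiv ℝ f, hf.continuous_fderiv (by simp)⟩ : C(E, E →L[ℝ] F)).comp γ
  have hD : Continuous D := ContinuousMap.continuous_postcomp _
  rw [hasFDerivAt_iff_isLittleO, Asymptotics.isLittleO_iff]
  intro c hc
  obtain ⟨δ, hδ, hball⟩ := Metric.eventually_nhds_iff_ball.mp
    ((hD.tendsto γ).eventually (Metric.ball_mem_nhds (D γ) hc))
  filter_upwards [Metric.ball_mem_nhds γ hδ] with η hη
  rw [ContinuousMap.norm_le _ (by positivity)]
  intro k
  have hseg : ∀ z ∈ segment ℝ (γ k) (η k), ‖fderiv ℝ f z - fderiv ℝ f (γ k)‖ ≤ c := by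
    intro z hz
    rw [segment_eq_image'] at hz
    obtain ⟨s, hs, rfl⟩ := hz
    have hd : dist (γ + s • (η - γ)) γ < δ := by
      rw [dist_eq_norm, add_sub_cancel_left, norm_smul, Real.norm_eq_abs, abs_of_nonneg hs.1]
      calc s * ‖η - γ‖ ≤ 1 * ‖η - γ‖ := by gcongr; exact hs.2
        _ < δ := by rw [one_mul, ← dist_eq_norm]; exact hη
    rw [← dist_eq_norm]
    exact (ContinuousMap.dist_apply_le_dist (f := D (γ + s • (η - γ))) (g := D γ) k).trans
      (hball _ hd).le
  have := (convex_segment (γ k) (η k)).norm_image_sub_le_of_norm_hasFDerivWithin_le'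
    (f := f) (f' := fderiv ℝ f) (φ := fderiv ℝ f (γ k)) (C := c)
    (fun z _ => ((hf.differentiable (by simp)) z).hasFDerivAt.hasFDerivWithinAt) hseg
    (left_mem_segment ℝ _ _) (right_mem_segment ℝ _ _)
  refine this.trans ?_
  gcongr
  exact (η - γ).norm_coe_le_norm k

/-- The derivative of postcomposition with `f` is postcomposition with `fderiv ℝ f`, followed by a
continuous linear map. Hence the induction on `n`, with the target space left general since it
changes at each step. -/
theorem contDiff_postcomp_nat (n : ℕ) : ∀ {F : Type u} [NormedAddCommGroup F] [NormedSpace ℝ F]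
    {f : E → F} (hf : ContDiff ℝ ∞ f),
    ContDiff ℝ n (fun γ : C(K, E) => (⟨f, hf.continuous⟩ : C(E, F)).comp γ) := by
  induction n with
  | zero =>
    intro F _ _ f hf
    exact contDiff_zero.mpr (ContinuousMap.continuous_postcomp _)
  | succ n ih =>
    intro F _ _ f hf
    have hf1 : ContDiff ℝ 1 f := hf.of_le (by exact_mod_cast le_top)
    have hdf : ContDiff ℝ ∞ (fderiv ℝ f) := hf.fderiv_right (by simp)
    have hlin : ContDiff ℝ n (fun A : C(K, E →L[ℝ] F) => pointwiseApply A) := by fun_prop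
    exact contDiff_succ_iff_hasFDerivAt.mpr ⟨fun γ => pointwiseApply
      ((⟨fderiv ℝ f, hdf.continuous⟩ : C(E, E →L[ℝ] F)).comp γ),
      hlin.comp (ih hdf), fun γ => hasFDerivAt_postcomp hf1 γ⟩

theorem contDiff_postcomp {f : E → F} (hf : ContDiff ℝ ∞ f) :
    ContDiff ℝ ∞ (fun γ : C(K, E) => (⟨f, hf.continuous⟩ : C(E, F)).comp γ) :=
  contDiff_infty.mpr fun n => contDiff_postcomp_nat n hf

end Calculus

/-! ### Local flows of vector fields on a Banach space. -/

section LocalFlow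

universe u

variable {E : Type u} [NormedAddCommGroup E] [NormedSpace ℝ E]

/-- A continuous function on `[-1, 1]`, extended to the line. -/
def extendIcc {E : Type*} [NormedAddCommGroup E] (f : C(Icc (-1 : ℝ) 1, E)) (τ : ℝ) : E := f (projIcc (-1) 1 (by norm_num) τ)

theorem continuous_extendIcc {E : Type*} [NormedAddCommGroup E] (f : C(Icc (-1 : ℝ) 1, E)) : Continuous (extendIcc f) :=
  f.continuous.comp continuous_projIcc

/-- The primitive vanishing at `0` as an operator on `C([-1, 1], E)`. -/
def primitiveOp : C(Icc (-1 : ℝ) 1, E) →L[ℝ] C(Icc (-1 : ℝ) 1, E) :=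
  LinearMap.mkContinuous
    { toFun := fun f => ⟨fun t => ∫ τ in (0 : ℝ)..t, extendIcc f τ,
        (intervalIntegral.continuous_primitive
          (fun a b => (continuous_extendIcc f).intervalIntegrable a b) 0).comp
          continuous_subtype_val⟩
      map_add' := fun f g => by
        ext t
        exact intervalIntegral.integral_add ((continuous_extendIcc f).intervalIntegrable _ _)
          ((continuous_extendIcc g).intervalIntegrable _ _)
      map_smul' := fun c f => by
        ext t
        exact intervalIntegral.integral_smul c _ } 1 (by
    intro f
    rw [ContinuousMap.norm_le _ (by positivity)]
    intro t
    have h : ‖∫ τ in (0 : ℝ)..t, extendIcc f τ‖ ≤ ‖f‖ * |(t : ℝ) - 0| :=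
      intervalIntegral.norm_integral_le_of_norm_le_const fun τ _ => f.norm_coe_le_norm _
    refine h.trans ?_
    rw [sub_zero, mul_comm]
    gcongr
    exact abs_le.mpr t.2)

/-- Solutions of the rescaled integral equation `γ(t) = x + s ∫₀ᵗ v(γ)` depend smoothly on
`(s, x)` near `s = 0`. -/
theorem exists_smooth_solution [CompleteSpace E] {v : E → E} (hv : ContDiff ℝ ∞ v) (x₀ : E) :
    ∃ S : ℝ × E → C(Icc (-1 : ℝ) 1, E), (∀ᶠ p in 𝓝 ((0 : ℝ), x₀), ContDiffAt ℝ ∞ S p) ∧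
      S (0, x₀) = ContinuousMap.const _ x₀ ∧
      ∀ᶠ p in 𝓝 ((0 : ℝ), x₀), ∀ t : Icc (-1 : ℝ) 1,
        S p t = p.2 + p.1 • ∫ τ in (0 : ℝ)..t, v (extendIcc (S p) τ) := by
  let X := C(Icc (-1 : ℝ) 1, E)
  let nem : X → X := fun γ => (⟨v, hv.continuous⟩ : C(E, E)).comp γ
  have hnem : ContDiff ℝ ∞ nem := contDiff_postcomp hv
  let cst : E →L[ℝ] X := ContinuousLinearMap.const ℝ _
  -- The curve component is the residual of the integral equation, so its zeros are the solutions.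
  -- At `s = 0` the nonlinear term contributes nothing to the derivative in `γ`, so the derivative
  -- there is a shear, inverted by changing the sign of `B`.
  let Ψ : (ℝ × E) × X → (ℝ × E) × X :=
    fun q => (q.1, q.2 - cst q.1.2 - q.1.1 • primitiveOp (nem q.2))
  have hΨ : ContDiff ℝ ∞ Ψ := by
    have h1 : ContDiff ℝ ∞ fun q : (ℝ × E) × X => primitiveOp (nem q.2) :=
      primitiveOp.contDiff.comp (hnem.comp contDiff_snd)
    have h2 : ContDiff ℝ ∞ fun q : (ℝ × E) × X => cst q.1.2 :=
      cst.contDiff.comp (contDiff_snd.comp contDiff_fst)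
    have h3 : ContDiff ℝ ∞ fun q : (ℝ × E) × X => q.1.1 := contDiff_fst.comp contDiff_fst
    exact contDiff_fst.prodMk ((contDiff_snd.sub h2).sub (h3.smul h1))
  let a : (ℝ × E) × X := ((0, x₀), cst x₀)
  let c : X := primitiveOp (nem (cst x₀))
  let B : (ℝ × E) →L[ℝ] X :=
    cst.comp (ContinuousLinearMap.snd ℝ ℝ E) + (ContinuousLinearMap.fst ℝ ℝ E).smulRight c
  let A : ((ℝ × E) × X) ≃L[ℝ] ((ℝ × E) × X) :=
    ContinuousLinearEquiv.equivOfInverse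
      ((ContinuousLinearMap.fst ℝ _ _).prod
        (ContinuousLinearMap.snd ℝ _ _ - B.comp (ContinuousLinearMap.fst ℝ _ _)))
      ((ContinuousLinearMap.fst ℝ _ _).prod
        (ContinuousLinearMap.snd ℝ _ _ + B.comp (ContinuousLinearMap.fst ℝ _ _)))
      (fun q => by ext1 <;> simp) (fun q => by ext1 <;> simp)
  have hA : HasFDerivAt Ψ (A : ((ℝ × E) × X) →L[ℝ] ((ℝ × E) × X)) a := by
    have h1 : HasFDerivAt (fun q : (ℝ × E) × X => q.1)
      (ContinuousLinearMap.fst ℝ (ℝ × E) X) a := hasFDerivAt_fst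
    have h2 : HasFDerivAt (fun q : (ℝ × E) × X => q.2)
      (ContinuousLinearMap.snd ℝ (ℝ × E) X) a := hasFDerivAt_snd
    have h3 : HasFDerivAt (fun q : (ℝ × E) × X => cst q.1.2) _ a :=
      (cst.comp ((ContinuousLinearMap.snd ℝ ℝ E).comp
        (ContinuousLinearMap.fst ℝ (ℝ × E) X))).hasFDerivAt
    have h4 : HasFDerivAt (fun q : (ℝ × E) × X => q.1.1) _ a :=
      ((ContinuousLinearMap.fst ℝ ℝ E).comp (ContinuousLinearMap.fst ℝ (ℝ × E) X)).hasFDerivAt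
    have h5 : HasFDerivAt (fun q : (ℝ × E) × X => primitiveOp (nem q.2)) _ a :=
      (ContDiff.differentiable (n := ∞) ((primitiveOp (E := E)).contDiff.comp (hnem.comp contDiff_snd))
        (by simp) a).hasFDerivAt
    have h6 := h1.prodMk ((h2.sub h3).sub (h4.smul h5))
    refine h6.congr_fderiv ?_
    refine ContinuousLinearMap.ext fun q => ?_
    refine Prod.ext rfl ?_
    simp [A, B, a, c]
    abel
  obtain ⟨g, hg, hga, -, hgr⟩ :=
    exists_contDiffOn_localInverse A (Filter.Eventually.of_forall fun _ => hΨ.contDiffAt) hA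
  have ha : Ψ a = ((0, x₀), 0) := by
    simp [Ψ, a]
  rw [ha] at hg hga hgr
  have hι : Filter.Tendsto (fun p : ℝ × E => (p, (0 : X))) (𝓝 (0, x₀)) (𝓝 ((0, x₀), 0)) :=
    (continuous_id.prodMk continuous_const).tendsto _
  refine ⟨fun p => (g (p, 0)).2, ?_, ?_, ?_⟩
  · filter_upwards [hι.eventually hg] with p hp
    exact contDiffAt_snd.comp p (hp.comp p (contDiff_id.prodMk contDiff_const).contDiffAt)
  · simp only [hga, a]; rfl
  · filter_upwards [hι.eventually hgr] with p hp t
    have h1 : (g (p, 0)).1 = p := congrArg Prod.fst hp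
    have h2 : (g (p, 0)).2 - cst (g (p, 0)).1.2 -
      (g (p, 0)).1.1 • primitiveOp (nem (g (p, 0)).2) = 0 := congrArg Prod.snd hp
    rw [h1, sub_sub, sub_eq_zero] at h2
    have h3 := congrArg (fun f : X => f t) h2
    exact h3

/-- The local flow of a smooth Lipschitz vector field is smooth. -/
theorem exists_smooth_local_flow [CompleteSpace E] {v : E → E} (hv : ContDiff ℝ ∞ v) {C : NNReal}
    (hL : LipschitzWith C v) (x₀ : E) :
    ∃ φ : ℝ × E → E, (∀ᶠ p in 𝓝 ((0 : ℝ), x₀), ContDiffAt ℝ ∞ φ p) ∧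
      ∀ᶠ p in 𝓝 ((0 : ℝ), x₀), φ (0, p.2) = p.2 ∧
        HasDerivAt (fun s => φ (s, p.2)) (v (φ p)) p.1 := by
  obtain ⟨S, hS, -, hSeq⟩ := exists_smooth_solution hv x₀
  have hone : (1 : ℝ) ∈ Icc (-1 : ℝ) 1 := by norm_num
  -- The time variable is rescaled by `s`, so the flow at time `s` is the value of the rescaled
  -- curve at time 1.
  let ev : C(Icc (-1 : ℝ) 1, E) →L[ℝ] E := ContinuousMap.evalCLM ℝ ⟨1, hone⟩
  refine ⟨fun p => ev (S p), ?_, ?_⟩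
  · filter_upwards [hS] with p hp using ev.contDiff.contDiffAt.comp p hp
  · obtain ⟨r, hr, hball⟩ := Metric.eventually_nhds_iff_ball.mp hSeq
    have hmem : ∀ s : ℝ, ∀ x : E, |s| < r → dist x x₀ < r →
        ((s, x) : ℝ × E) ∈ Metric.ball ((0 : ℝ), x₀) r := by
      intro s x hs hx
      rw [Metric.mem_ball, Prod.dist_eq]
      exact max_lt (by simpa using hs) hx
    let g : ℝ → E → ℝ → E := fun s x t => x + s • ∫ τ in (0 : ℝ)..t, v (extendIcc (S (s, x)) τ)
    have hgS : ∀ s x, |s| < r → dist x x₀ < r → ∀ t (ht : t ∈ Icc (-1 : ℝ) 1),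
        S (s, x) ⟨t, ht⟩ = g s x t := fun s x hs hx t ht => hball _ (hmem s x hs hx) ⟨t, ht⟩
    have hgd : ∀ s x, |s| < r → dist x x₀ < r → ∀ t ∈ Icc (-1 : ℝ) 1,
        HasDerivAt (g s x) (s • v (g s x t)) t := by
      intro s x hs hx t ht
      have h1 : HasDerivAt (g s x) (s • v (extendIcc (S (s, x)) t)) t := by
        have hc : Continuous fun τ => v (extendIcc (S (s, x)) τ) :=
          hv.continuous.comp (continuous_extendIcc _)
        exact ((hc.integral_hasStrictDerivAt 0 t).hasDerivAt.const_smul s).const_add x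
      rwa [extendIcc, projIcc_of_mem _ ht, hgS s x hs hx t ht] at h1
    -- Next, `t ↦ g s₀ x (t * (s / s₀))` solves the equation with parameter `s`, hence equals `g s
    -- x` by uniqueness. With `s₀ = r / 2` fixed, dependence on `s` becomes dependence on the time
    -- of one curve, whose derivative is known.
    have hg0 : ∀ s x, g s x 0 = x := by intro s x; simp [g]
    have hcomp : ∀ x s₀ s, 0 < s₀ → s₀ < r → dist x x₀ < r → |s| < s₀ →
        g s x 1 = g s₀ x (s / s₀) := by
      intro x s₀ s h0 h0r hx hs
      have hsr : |s| < r := hs.trans h0r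
      have h0r' : |s₀| < r := by rwa [abs_of_pos h0]
      have hmaps : ∀ t ∈ Icc (-1 : ℝ) 1, t * (s / s₀) ∈ Icc (-1 : ℝ) 1 := by
        intro t ht
        have ht' : |t| ≤ 1 := abs_le.mpr ht
        refine abs_le.mp ?_
        rw [abs_mul, abs_div, abs_of_pos h0]
        exact mul_le_one₀ ht' (by positivity) ((div_le_one h0).mpr hs.le)
      have key := ODE_solution_unique_of_mem_Icc (v := fun _ y => s • v y) (K := ‖s‖₊ * C)
        (s := fun _ => univ) (f := g s x) (g := fun t => g s₀ x (t * (s / s₀)))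
        (a := -1) (b := 1) (t₀ := 0)
        (fun t _ => ((lipschitzWith_smul s).comp hL).lipschitzOnWith) (by norm_num)
        (fun t ht => (hgd s x hsr hx t ht).continuousAt.continuousWithinAt)
        (fun t ht => hgd s x hsr hx t (Ioo_subset_Icc_self ht)) (fun _ _ => mem_univ _)
        (fun t ht => ?_) (fun t ht => ?_) (fun _ _ => mem_univ _)
        (by simp [hg0])
      · have := key (show (1 : ℝ) ∈ Icc (-1 : ℝ) 1 from hone)
        simpa using this
      · exact ((hgd s₀ x h0r' hx _ (hmaps t ht)).continuousAt.comp
          (f := fun t => t * (s / s₀)) (by fun_prop)).continuousWithinAt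
      · have h1 := hgd s₀ x h0r' hx _ (hmaps t (Ioo_subset_Icc_self ht))
        have h2 := h1.scomp t ((hasDerivAt_id t).mul_const (s / s₀))
        refine h2.congr_deriv ?_
        rw [one_mul, smul_smul, div_mul_cancel₀ _ h0.ne']
    have hr2 : 0 < r / 2 := by positivity
    filter_upwards [Metric.ball_mem_nhds ((0 : ℝ), x₀) hr2] with p hp
    obtain ⟨s, x⟩ := p
    rw [Metric.mem_ball, Prod.dist_eq, max_lt_iff] at hp
    have hs : |s| < r / 2 := by simpa using hp.1
    have hx : dist x x₀ < r := hp.2.trans (by linarith)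
    have hev : ∀ s, |s| < r / 2 → ev (S (s, x)) = g (r / 2) x (s / (r / 2)) := by
      intro s hs
      rw [← hcomp x (r / 2) s hr2 (by linarith) hx hs]
      exact hgS s x (by linarith) hx 1 hone
    refine ⟨?_, ?_⟩
    · change ev (S (0, x)) = x
      rw [hev 0 (by simpa using hr2), zero_div, hg0]
    · have hin : s / (r / 2) ∈ Icc (-1 : ℝ) 1 := by
        refine abs_le.mp ?_
        rw [abs_div, abs_of_pos hr2]
        exact (div_le_one hr2).mpr hs.le
      have h1 := hgd (r / 2) x (by rw [abs_of_pos hr2]; linarith) hx _ hin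
      have h2 := h1.scomp s ((hasDerivAt_id s).div_const (r / 2))
      have h3 : HasDerivAt (fun s => ev (S (s, x))) (v (g (r / 2) x (s / (r / 2)))) s := by
        refine (h2.congr_deriv ?_).congr_of_eventuallyEq ?_
        · rw [smul_smul, one_div, inv_mul_cancel₀ hr2.ne', one_smul]
        · have : ∀ᶠ s' in 𝓝 s, |s'| < r / 2 := continuous_abs.continuousAt.eventually_lt
            continuousAt_const hs
          filter_upwards [this] with s' hs' using hev s' hs'
      change HasDerivAt (fun s => ev (S (s, x))) (v (ev (S (s, x)))) s
      rw [hev s hs]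
      exact h3

end LocalFlow

/-! ### Local and global flows of vector fields on manifolds without boundary. -/

section ManifoldFlow

universe u

variable {E : Type u} [NormedAddCommGroup E] [NormedSpace ℝ E]
  {H : Type*} [TopologicalSpace H] {I : ModelWithCorners ℝ E H}
  {N : Type*} [TopologicalSpace N] [ChartedSpace H N]

/-- The expression of a vector field in the preferred chart at `x₀`, as a function on the
manifold. -/
def chartField (I : ModelWithCorners ℝ E H) (v : (x : N) → TangentSpace I x) (x₀ x : N) : E :=
  mfderiv I 𝓘(ℝ, E) (extChartAt I x₀) x (v x)

/-- This lets smoothness of a section of the tangent bundle be tested on its expression in a chart,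
in both directions. -/
theorem trivializationAt_eq_chartField [IsManifold I ∞ N] (v : (x : N) → TangentSpace I x)
    {x₀ x : N} (hx : x ∈ (chartAt H x₀).source) :
    (trivializationAt E (TangentSpace I) x₀ ⟨x, v x⟩).2 = chartField I v x₀ x := by
  have : IsManifold I 1 N := IsManifold.of_le (n := ∞) (by exact_mod_cast le_top)
  have h := TangentBundle.continuousLinearMapAt_trivializationAt (I := I) hx
  have h1 : (trivializationAt E (TangentSpace I) x₀).continuousLinearMapAt ℝ x (v x) =
      (trivializationAt E (TangentSpace I) x₀ ⟨x, v x⟩).2 := by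
    rw [Bundle.Trivialization.continuousLinearMapAt_apply,
      Bundle.Trivialization.coe_linearMapAt_of_mem _ hx]
  exact h1.symm.trans (congrArg (fun l : TangentSpace I x →L[ℝ] E => l (v x)) h)

theorem contMDiffOn_chartField [IsManifold I ∞ N] {v : (x : N) → TangentSpace I x}
    (hv : ContMDiff I I.tangent ∞ fun x => (⟨x, v x⟩ : TangentBundle I N)) (x₀ : N) :
    ContMDiffOn I 𝓘(ℝ, E) ∞ (chartField I v x₀) (chartAt H x₀).source := by
  have h := ((trivializationAt E (TangentSpace I) x₀).contMDiffOn_section_baseSet_iff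
    (IB := I) (n := ∞) (s := v)).mp hv.contMDiffOn
  exact h.congr fun x hx => (trivializationAt_eq_chartField v hx).symm

theorem contMDiff_section_of_chartField [IsManifold I ∞ N] {v : (x : N) → TangentSpace I x}
    (hv : ∀ x₀, ContMDiffAt I 𝓘(ℝ, E) ∞ (chartField I v x₀) x₀) :
    ContMDiff I I.tangent ∞ fun x => (⟨x, v x⟩ : TangentBundle I N) := by
  intro x₀
  refine (Bundle.contMDiffAt_section x₀).mpr ?_
  refine (hv x₀).congr_of_eventuallyEq ?_
  filter_upwards [(chartAt H x₀).open_source.mem_nhds (mem_chart_source H x₀)] with x hx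
  exact trivializationAt_eq_chartField v hx

variable [I.Boundaryless] [IsManifold I ∞ N]

theorem hasMFDerivAt_extChartAt_symm_chartField (v : (x : N) → TangentSpace I x) {x₀ : N} {y : E}
    (hy : y ∈ (extChartAt I x₀).target) :
    ∃ A : E →L[ℝ] TangentSpace I ((extChartAt I x₀).symm y),
      HasMFDerivAt 𝓘(ℝ, E) I (extChartAt I x₀).symm y A ∧
      A (chartField I v x₀ ((extChartAt I x₀).symm y)) = v ((extChartAt I x₀).symm y) := by
  have : IsManifold I 1 N := IsManifold.of_le (n := ∞) (by exact_mod_cast le_top)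
  have h1 := mdifferentiableWithinAt_extChartAt_symm (I := I) hy
  have h2 := mfderivWithin_extChartAt_symm_comp_mfderiv_extChartAt (I := I) hy
  rw [I.range_eq_univ] at h1 h2
  rw [mfderivWithin_univ] at h2
  rw [mdifferentiableWithinAt_univ] at h1
  exact ⟨_, h1.hasMFDerivAt, congrArg (fun l : TangentSpace I ((extChartAt I x₀).symm y) →L[ℝ]
    TangentSpace I ((extChartAt I x₀).symm y) => l (v ((extChartAt I x₀).symm y))) h2⟩

/-- The chart expression of the field is cut off to a globally Lipschitz field on the model space,
integrated there, and transported back where the cutoff equals 1. -/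
theorem exists_smooth_local_flow_manifold [FiniteDimensional ℝ E]
    {v : (x : N) → TangentSpace I x}
    (hv : ContMDiff I I.tangent ∞ fun x => (⟨x, v x⟩ : TangentBundle I N)) (x₀ : N) :
    ∃ φ : ℝ × N → N, ∀ᶠ p in 𝓝 ((0 : ℝ), x₀),
      ContMDiffAt (𝓘(ℝ, ℝ).prod I) I ∞ φ p ∧ φ (0, p.2) = p.2 ∧
      HasMFDerivAt 𝓘(ℝ, ℝ) I (fun s => φ (s, p.2)) p.1
        ((1 : ℝ →L[ℝ] ℝ).smulRight (v (φ p))) := by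
  have : CompleteSpace E := FiniteDimensional.complete ℝ E
  set e := extChartAt I x₀ with he
  set y₀ := e x₀ with hy₀
  have hto : IsOpen e.target := isOpen_extChartAt_target x₀
  have hy₀t : y₀ ∈ e.target := mem_extChartAt_target x₀
  let w : E → E := fun y => chartField I v x₀ (e.symm y)
  have hw : ContDiffOn ℝ ∞ w e.target := by
    refine contMDiffOn_iff_contDiffOn.mp ?_
    refine (contMDiffOn_chartField hv x₀).comp (contMDiffOn_extChartAt_symm x₀) ?_
    intro y hy
    rw [← extChartAt_source I x₀]
    exact e.map_target hy
  obtain ⟨r, hr, hrt⟩ := Metric.isOpen_iff.mp hto y₀ hy₀t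
  -- The bump is supported inside the chart target, so `u` is smooth on the whole space with compact
  -- support, hence Lipschitz. Near `(0, y₀)` the flow stays where the bump is 1 and `u = w`.
  let χ : ContDiffBump y₀ := ⟨r / 4, r / 2, by positivity, by linarith⟩
  have hχt : tsupport χ ⊆ e.target := by
    rw [χ.tsupport_eq]
    exact (Metric.closedBall_subset_ball (by change r / 2 < r; linarith)).trans hrt
  let u : E → E := fun y => χ y • w y
  have hu : ContDiff ℝ ∞ u := by
    refine contDiff_iff_contDiffAt.mpr fun y => ?_
    by_cases hy : y ∈ e.target
    · exact χ.contDiffAt.smul (hw.contDiffAt (hto.mem_nhds hy))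
    · have h0 : u =ᶠ[𝓝 y] fun _ => 0 := by
        filter_upwards [(isClosed_tsupport χ).isOpen_compl.mem_nhds fun h => hy (hχt h)] with z hz
        simp [u, image_eq_zero_of_notMem_tsupport hz]
      exact contDiffAt_const.congr_of_eventuallyEq h0
  have huc : HasCompactSupport u := χ.hasCompactSupport.smul_right
  obtain ⟨C, hC⟩ := ContDiff.lipschitzWith_of_hasCompactSupport huc hu (by simp)
  obtain ⟨ψ, hψs, hψ⟩ := exists_smooth_local_flow hu hC y₀
  have hψ0 : ψ (0, y₀) = y₀ := hψ.self_of_nhds.1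
  have hψc : ContinuousAt ψ (0, y₀) := hψs.self_of_nhds.continuousAt
  have hgood : ∀ᶠ p in 𝓝 ((0 : ℝ), y₀), ψ p ∈ e.target ∧ χ (ψ p) = 1 := by
    have h : ∀ᶠ y in 𝓝 (ψ (0, y₀)), y ∈ e.target ∧ χ y = 1 := by
      rw [hψ0]
      exact (hto.eventually_mem hy₀t).and χ.eventuallyEq_one
    exact hψc.eventually h
  have hι : Filter.Tendsto (fun p : ℝ × N => (p.1, e p.2)) (𝓝 (0, x₀)) (𝓝 (0, y₀)) := by
    have : ContinuousAt (fun p : ℝ × N => (p.1, e p.2)) (0, x₀) :=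
      continuousAt_fst.prodMk
        (ContinuousAt.comp (g := e) (continuousAt_extChartAt x₀) continuousAt_snd)
    exact this
  have hsrc : ∀ᶠ p in 𝓝 ((0 : ℝ), x₀), p.2 ∈ e.source :=
    continuousAt_snd.eventually ((isOpen_extChartAt_source x₀).mem_nhds (mem_extChartAt_source x₀))
  refine ⟨fun p => e.symm (ψ (p.1, e p.2)), ?_⟩
  filter_upwards [hι.eventually (hψs.and (hψ.and hgood)), hsrc] with p hp hps
  obtain ⟨hp1, ⟨hp2, hp3⟩, hp4, hp5⟩ := hp
  refine ⟨?_, ?_, ?_⟩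
  · have h1 : ContMDiffAt (𝓘(ℝ, ℝ).prod I) 𝓘(ℝ, ℝ × E) ∞ (fun p : ℝ × N => (p.1, e p.2)) p := by
      have hs : p.2 ∈ (chartAt H x₀).source := by rwa [← extChartAt_source I x₀]
      exact contMDiffAt_fst.prodMk_space ((contMDiffAt_extChartAt' hs).comp p contMDiffAt_snd)
    have h2 : ContMDiffAt (𝓘(ℝ, ℝ).prod I) 𝓘(ℝ, E) ∞ (fun p : ℝ × N => ψ (p.1, e p.2)) p :=
      ContMDiffAt.comp (g := ψ) p hp1.contMDiffAt h1
    exact ((contMDiffOn_extChartAt_symm x₀).contMDiffAt (hto.mem_nhds hp4)).comp p h2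
  · rw [hp2, e.left_inv hps]
  · obtain ⟨A, hA, hAv⟩ := hasMFDerivAt_extChartAt_symm_chartField v hp4
    have h3 := hp3.hasFDerivAt.hasMFDerivAt
    have h4 := HasMFDerivAt.comp p.1 hA h3
    have h5 : u (ψ (p.1, e p.2)) = w (ψ (p.1, e p.2)) := by simp [u, hp5]
    rw [h5] at h4
    refine h4.congr_mfderiv ?_
    refine ContinuousLinearMap.ext fun (a : ℝ) => ?_
    have h6 : A (a • w (ψ (p.1, e p.2))) = (a • v (e.symm (ψ (p.1, e p.2))) :
        TangentSpace I (e.symm (ψ (p.1, e p.2)))) := by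
      rw [← hAv]; exact map_smul A a _
    exact h6

/-- A smooth vector field on a manifold without boundary has a smooth global flow if its integral
curves starting outside some compact set exist and depend smoothly on the initial value for a
uniform time. -/
theorem exists_smooth_flow [FiniteDimensional ℝ E] [T2Space N]
    {v : (x : N) → TangentSpace I x}
    (hv : ContMDiff I I.tangent ∞ fun x => (⟨x, v x⟩ : TangentBundle I N))
    {K : Set N} (hK : IsCompact K) {G : ℝ × N → N} (hG : ContMDiff (𝓘(ℝ, ℝ).prod I) I ∞ G)
    {ε₀ : ℝ} (hε₀ : 0 < ε₀) (hG0 : ∀ x, G (0, x) = x)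
    (hGv : ∀ x ∉ K, IsMIntegralCurveOn (fun t => G (t, x)) v (Ioo (-ε₀) ε₀)) :
    ∃ F : ℝ × N → N, ContMDiff (𝓘(ℝ, ℝ).prod I) I ∞ F ∧ (∀ x, F (0, x) = x) ∧
      (∀ s t x, F (s + t, x) = F (s, F (t, x))) ∧
      ∀ x, IsMIntegralCurve (fun t => F (t, x)) v := by
  have : CompleteSpace E := FiniteDimensional.complete ℝ E
  have : IsManifold I 1 N := IsManifold.of_le (n := ∞) (by exact_mod_cast le_top)
  have hv1 : ContMDiff I I.tangent 1 fun x => (⟨x, v x⟩ : TangentBundle I N) :=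
    hv.of_le (by exact_mod_cast le_top)
  have hloc : ∀ x₀ : N, ∃ φ : ℝ × N → N, ∃ ε > 0, ∃ U ∈ 𝓝 x₀, ∀ t ∈ Ioo (-ε) ε, ∀ x ∈ U,
      ContMDiffAt (𝓘(ℝ, ℝ).prod I) I ∞ φ (t, x) ∧ φ (0, x) = x ∧
      HasMFDerivAt 𝓘(ℝ, ℝ) I (fun s => φ (s, x)) t
        ((1 : ℝ →L[ℝ] ℝ).smulRight (v (φ (t, x)))) := by
    intro x₀
    obtain ⟨φ, hφ⟩ := exists_smooth_local_flow_manifold hv x₀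
    rw [nhds_prod_eq, Filter.eventually_prod_iff] at hφ
    obtain ⟨p, hp, q, hq, h⟩ := hφ
    obtain ⟨ε, hε, hball⟩ := Metric.eventually_nhds_iff_ball.mp hp
    refine ⟨φ, ε, hε, {x | q x}, hq, fun t ht x hx => h (hball t ?_) hx⟩
    rw [Real.ball_eq_Ioo]
    simpa using ht
  have hcurve : ∃ ε > 0, ∀ x ∈ K, ∃ γ : ℝ → N, γ 0 = x ∧ IsMIntegralCurveOn γ v (Ioo (-ε) ε) := by
    refine hK.induction_on (p := fun S => ∃ ε > 0, ∀ x ∈ S, ∃ γ : ℝ → N, γ 0 = x ∧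
      IsMIntegralCurveOn γ v (Ioo (-ε) ε)) ⟨1, one_pos, by simp⟩ ?_ ?_ ?_
    · rintro s t hst ⟨ε, hε, h⟩
      exact ⟨ε, hε, fun x hx => h x (hst hx)⟩
    · rintro s t ⟨ε, hε, h⟩ ⟨δ, hδ, h'⟩
      refine ⟨min ε δ, lt_min hε hδ, ?_⟩
      rintro x (hx | hx)
      · obtain ⟨γ, h0, hγ⟩ := h x hx
        exact ⟨γ, h0, hγ.mono (Ioo_subset_Ioo (neg_le_neg (min_le_left _ _)) (min_le_left _ _))⟩
      · obtain ⟨γ, h0, hγ⟩ := h' x hx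
        exact ⟨γ, h0, hγ.mono (Ioo_subset_Ioo (neg_le_neg (min_le_right _ _)) (min_le_right _ _))⟩
    · intro x₀ _
      obtain ⟨φ, ε, hε, U, hU, h⟩ := hloc x₀
      refine ⟨U, mem_nhdsWithin_of_mem_nhds hU, ε, hε, fun x hx => ⟨fun s => φ (s, x), ?_, ?_⟩⟩
      · exact (h 0 (by simpa using hε) x hx).2.1
      · intro t ht
        exact (h t ht x hx).2.2.hasMFDerivWithinAt
  -- Curves starting in `K` live for a uniform time by compactness, the others for time `ε₀` by `G`.
  -- A uniform existence time makes all integral curves global.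
  have hglob : ∀ x, ∃ γ : ℝ → N, γ 0 = x ∧ IsMIntegralCurve γ v := by
    obtain ⟨ε, hε, h⟩ := hcurve
    refine exists_isMIntegralCurve_of_isMIntegralCurveOn hv1 (lt_min hε hε₀) fun x => ?_
    by_cases hx : x ∈ K
    · obtain ⟨γ, h0, hγ⟩ := h x hx
      exact ⟨γ, h0, hγ.mono (Ioo_subset_Ioo (neg_le_neg (min_le_left _ _)) (min_le_left _ _))⟩
    · exact ⟨fun t => G (t, x), hG0 x, (hGv x hx).mono
        (Ioo_subset_Ioo (neg_le_neg (min_le_right _ _)) (min_le_right _ _))⟩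
  choose γ hγ0 hγ using hglob
  let F : ℝ × N → N := fun p => γ p.2 p.1
  have hgroup : ∀ s t x, F (s + t, x) = F (s, F (t, x)) := by
    intro s t x
    have h1 : IsMIntegralCurve (γ x ∘ fun s => s + t) v := (hγ x).comp_add t
    have h2 := isMIntegralCurve_Ioo_eq_of_contMDiff_boundaryless (t₀ := 0) hv1 h1
      (hγ (γ x t)) (by simp [hγ0])
    exact congrFun h2 s
  have hFout : ∀ x ∉ K, ∀ t ∈ Ioo (-ε₀) ε₀, F (t, x) = G (t, x) := by
    intro x hx t ht
    exact isMIntegralCurveOn_Ioo_eqOn_of_contMDiff_boundaryless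
      (show (0 : ℝ) ∈ Ioo (-ε₀) ε₀ by simpa using hε₀) hv1 ((hγ x).isMIntegralCurveOn _)
      (hGv x hx) ((hγ0 x).trans (hG0 x).symm) ht
  have hFloc : ∀ x₀ : N, ∀ᶠ p in 𝓝 ((0 : ℝ), x₀), ContMDiffAt (𝓘(ℝ, ℝ).prod I) I ∞ F p := by
    intro x₀
    obtain ⟨φ, ε, hε, U, hU, h⟩ := hloc x₀
    have hset : Ioo (-ε) ε ×ˢ interior U ∈ 𝓝 ((0 : ℝ), x₀) :=
      prod_mem_nhds (Ioo_mem_nhds (by linarith) hε) (interior_mem_nhds.mpr hU)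
    have hEq : ∀ q ∈ Ioo (-ε) ε ×ˢ interior U, F q = φ q := by
      rintro ⟨t, x⟩ ⟨ht, hx⟩
      have hx := interior_subset hx
      have h0 : (0 : ℝ) ∈ Ioo (-ε) ε := by simpa using hε
      exact isMIntegralCurveOn_Ioo_eqOn_of_contMDiff_boundaryless h0 hv1
        ((hγ x).isMIntegralCurveOn _) (γ' := fun s => φ (s, x))
        (fun t ht => (h t ht x hx).2.2.hasMFDerivWithinAt)
        (by rw [hγ0, (h 0 h0 x hx).2.1]) ht
    filter_upwards [hset] with p hp
    refine (h p.1 hp.1 p.2 (interior_subset hp.2)).1.congr_of_eventuallyEq ?_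
    filter_upwards [(isOpen_Ioo.prod isOpen_interior).mem_nhds hp] with q hq using hEq q hq
  have hunif : ∃ ε > 0, ∀ t : ℝ, |t| < ε → ∀ x, ContMDiffAt (𝓘(ℝ, ℝ).prod I) I ∞ F (t, x) := by
    have h1 : ∃ ε > 0, ∀ x ∈ K, ∀ t : ℝ, |t| < ε →
        ContMDiffAt (𝓘(ℝ, ℝ).prod I) I ∞ F (t, x) := by
      refine hK.induction_on (p := fun S => ∃ ε > 0, ∀ x ∈ S, ∀ t : ℝ, |t| < ε →
        ContMDiffAt (𝓘(ℝ, ℝ).prod I) I ∞ F (t, x)) ⟨1, one_pos, by simp⟩ ?_ ?_ ?_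
      · rintro s t hst ⟨ε, hε, h⟩
        exact ⟨ε, hε, fun x hx => h x (hst hx)⟩
      · rintro s t ⟨ε, hε, h⟩ ⟨δ, hδ, h'⟩
        refine ⟨min ε δ, lt_min hε hδ, ?_⟩
        rintro x (hx | hx) t ht
        · exact h x hx t (ht.trans_le (min_le_left _ _))
        · exact h' x hx t (ht.trans_le (min_le_right _ _))
      · intro x₀ _
        have h := hFloc x₀
        rw [nhds_prod_eq, Filter.eventually_prod_iff] at h
        obtain ⟨p, hp, q, hq, h⟩ := h
        obtain ⟨ε, hε, hball⟩ := Metric.eventually_nhds_iff_ball.mp hp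
        refine ⟨{x | q x}, mem_nhdsWithin_of_mem_nhds hq, ε, hε, fun x hx t ht =>
          h (hball t ?_) hx⟩
        simpa using ht
    obtain ⟨ε, hε, h⟩ := h1
    refine ⟨min ε ε₀, lt_min hε hε₀, fun t ht x => ?_⟩
    by_cases hx : x ∈ K
    · exact h x hx t (ht.trans_le (min_le_left _ _))
    · refine (hG (t, x)).congr_of_eventuallyEq ?_
      have hset : Ioo (-ε₀) ε₀ ×ˢ Kᶜ ∈ 𝓝 (t, x) :=
        (isOpen_Ioo.prod hK.isClosed.isOpen_compl).mem_nhds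
          ⟨abs_lt.mp (ht.trans_le (min_le_right _ _)), hx⟩
      filter_upwards [hset] with p hp using hFout p.2 hp.2 p.1 hp.1
  obtain ⟨ε, hε, hsm⟩ := hunif
  -- The time-`t` map is smooth for `|t| < ε`. It is the square of the time-`t / 2` map, so
  -- smoothness spreads to all times by doubling.
  have hslice : ∀ n : ℕ, ∀ t : ℝ, |t| < 2 ^ n * ε → ContMDiff I I ∞ fun x => F (t, x) := by
    intro n
    induction n with
    | zero =>
      intro t ht x
      exact (hsm t (by simpa using ht) x).comp x
        (contMDiffAt_const.prodMk contMDiffAt_id : ContMDiffAt I (𝓘(ℝ, ℝ).prod I) ∞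
          (fun x : N => (t, x)) x)
    | succ n ih =>
      intro t ht
      have h2 : |t / 2| < 2 ^ n * ε := by
        rw [abs_div, abs_two, div_lt_iff₀ two_pos]
        calc |t| < 2 ^ (n + 1) * ε := ht
          _ = 2 ^ n * ε * 2 := by ring
      have h3 : (fun x => F (t, x)) = (fun x => F (t / 2, x)) ∘ fun x => F (t / 2, x) := by
        funext x
        rw [Function.comp_apply, ← hgroup, add_halves]
      rw [h3]
      exact (ih _ h2).comp (ih _ h2)
  refine ⟨F, ?_, fun x => hγ0 x, hgroup, hγ⟩
  rintro ⟨t₀, x₀⟩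
  obtain ⟨n, hn⟩ := pow_unbounded_of_one_lt (|t₀| / ε) one_lt_two
  have hs := hslice n t₀ ((div_lt_iff₀ hε).mp hn)
  -- Near time `t₀` the flow is a short-time flow, smooth in both variables, after the smooth
  -- time-`t₀` map.
  have h1 : F = fun p : ℝ × N => F (p.1 - t₀, F (t₀, p.2)) := by
    funext p
    rw [← hgroup, sub_add_cancel]
  rw [h1]
  refine ContMDiffAt.comp (g := F) (f := fun p : ℝ × N => (p.1 - t₀, F (t₀, p.2))) (t₀, x₀)
    (hsm (t₀ - t₀) (by simpa using hε) _) ?_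
  refine ContMDiffAt.prodMk ?_ ((hs x₀).comp (t₀, x₀) contMDiffAt_snd)
  exact contMDiffAt_fst.sub contMDiffAt_const

end ManifoldFlow

/-! ### The exterior derivative of a 1-form on a normed space. -/

section ExteriorDerivative

variable {P E : Type*} [NormedAddCommGroup P] [NormedSpace ℝ P]
  [NormedAddCommGroup E] [NormedSpace ℝ E]

/-- The exterior derivative of a 1-form on a normed space, as a bilinear map. -/
def extDeriv₁ (b : E → E →L[ℝ] ℝ) (y : E) : E →L[ℝ] E →L[ℝ] ℝ :=
  fderiv ℝ b y - (fderiv ℝ b y).flip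

theorem extDeriv₁_apply (b : E → E →L[ℝ] ℝ) (y u v : E) :
    extDeriv₁ b y u v = fderiv ℝ b y u v - fderiv ℝ b y v u := rfl

theorem extDeriv₁_swap (b : E → E →L[ℝ] ℝ) (y u v : E) :
    extDeriv₁ b y u v = - extDeriv₁ b y v u := by
  simp [extDeriv₁_apply]

/-- The exterior derivative commutes with pullback. -/
theorem extDeriv₁_pullback {b : E → E →L[ℝ] ℝ} {f : P → E} {p : P}
    (hf : ContDiffAt ℝ ∞ f p) (hb : ContDiffAt ℝ ∞ b (f p)) (u v : P) :
    extDeriv₁ (fun q => (b (f q)).comp (fderiv ℝ f q)) p u v =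
      extDeriv₁ b (f p) (fderiv ℝ f p u) (fderiv ℝ f p v) := by
  have hb' : HasFDerivAt (fun q => b (f q)) _ p :=
    (hb.differentiableAt (by simp)).hasFDerivAt.comp p
      (hf.differentiableAt (by simp)).hasFDerivAt
  have hf' : HasFDerivAt (fderiv ℝ f) (fderiv ℝ (fderiv ℝ f) p) p :=
    ((hf.fderiv_right (m := ∞) (by simp)).differentiableAt (by simp)).hasFDerivAt
  -- The terms with second derivatives of `f` cancel in the antisymmetrization.
  have hsymm : fderiv ℝ (fderiv ℝ f) p u v = fderiv ℝ (fderiv ℝ f) p v u :=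
    (hf.isSymmSndFDerivAt (by simpa using (show ((2 : ℕ∞) : WithTop ℕ∞) ≤ ∞ by exact_mod_cast le_top))) u v
  have h := hb'.clm_comp hf'
  simp only [extDeriv₁_apply, h.fderiv]
  simp [hsymm]

end ExteriorDerivative

/-! ### Linear algebra of a contact form at a point: Reeb and Hamiltonian vectors. -/

section ContactLinearAlgebra

variable {E : Type*} [NormedAddCommGroup E] [NormedSpace ℝ E]

/-- The pair `(b, Ω)` behaves like a contact form and its exterior derivative at a point. -/
structure IsContactPair (b : E →L[ℝ] ℝ) (Ω : E →L[ℝ] E →L[ℝ] ℝ) : Prop where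
  swap : ∀ u v, Ω u v = - Ω v u
  ne_zero : b ≠ 0
  nondegenerate : ∀ u, b u = 0 → (∀ v, b v = 0 → Ω u v = 0) → u = 0

/-- The isomorphism `u ↦ Ω(u, ·) + b(u) b` from vectors to covectors. -/
def contactMusical (b : E →L[ℝ] ℝ) (Ω : E →L[ℝ] E →L[ℝ] ℝ) : E →L[ℝ] E →L[ℝ] ℝ :=
  Ω + b.smulRight b

theorem contactMusical_apply (b : E →L[ℝ] ℝ) (Ω : E →L[ℝ] E →L[ℝ] ℝ) (u v : E) :
    contactMusical b Ω u v = Ω u v + b u * b v := rfl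

/-- The Reeb vector. -/
def reebVec (b : E →L[ℝ] ℝ) (Ω : E →L[ℝ] E →L[ℝ] ℝ) : E := (contactMusical b Ω).inverse b

/-- The value of the contact vector field of a Hamiltonian with value `c` and derivative `k`. -/
def hamVec (b : E →L[ℝ] ℝ) (Ω : E →L[ℝ] E →L[ℝ] ℝ) (c : ℝ) (k : E →L[ℝ] ℝ) : E :=
  (contactMusical b Ω).inverse ((k (reebVec b Ω) + c) • b - k)

namespace IsContactPair

variable {b : E →L[ℝ] ℝ} {Ω : E →L[ℝ] E →L[ℝ] ℝ}

theorem self_eq_zero (h : IsContactPair b Ω) (u : E) : Ω u u = 0 := by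
  have := h.swap u u
  linarith

/-- Contact pairs are natural under linear isomorphisms. -/
theorem map_equiv (h : IsContactPair b Ω) (A : E ≃L[ℝ] E) {b' : E →L[ℝ] ℝ}
    {Ω' : E →L[ℝ] E →L[ℝ] ℝ} (hb : ∀ u, b u = b' (A u)) (hΩ : ∀ u v, Ω u v = Ω' (A u) (A v)) :
    IsContactPair b' Ω' where
  swap u v := by
    have := h.swap (A.symm u) (A.symm v)
    simpa [hΩ] using this
  ne_zero h0 := h.ne_zero (ContinuousLinearMap.ext fun u => by simp [hb, h0])
  nondegenerate u hu huv := by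
    have := h.nondegenerate (A.symm u) (by simpa [hb] using hu) fun v hv => by
      rw [hΩ, A.apply_symm_apply]
      exact huv _ (by rw [← hb, hv])
    simpa using this

/-- If `Ω(u, ·) + b(u) b = 0`, evaluating at `u` gives `b(u)² = 0`, and nondegeneracy on `ker b`
then forces `u = 0`. Injectivity suffices by equality of dimensions. -/
theorem isInvertible_contactMusical [FiniteDimensional ℝ E] (h : IsContactPair b Ω) :
    (contactMusical b Ω).IsInvertible := by
  have : CompleteSpace E := FiniteDimensional.complete ℝ E
  have hinj : Function.Injective (contactMusical b Ω) := by
    rw [injective_iff_map_eq_zero]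
    intro u hu
    have hv : ∀ v, Ω u v + b u * b v = 0 := fun v => by
      rw [← contactMusical_apply, hu]; rfl
    have h1 := hv u
    rw [h.self_eq_zero, zero_add, mul_self_eq_zero] at h1
    refine h.nondegenerate u h1 fun v _ => ?_
    simpa [h1] using hv v
  have hdim : Module.finrank ℝ E = Module.finrank ℝ (E →L[ℝ] ℝ) := by
    rw [← LinearEquiv.finrank_eq (LinearMap.toContinuousLinearMap : (E →ₗ[ℝ] ℝ) ≃ₗ[ℝ] E →L[ℝ] ℝ)]
    exact (Subspace.dual_finrank_eq (K := ℝ) (V := E)).symm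
  let A : E ≃ₗ[ℝ] (E →L[ℝ] ℝ) :=
    LinearEquiv.ofInjectiveOfFinrankEq (contactMusical b Ω).toLinearMap hinj hdim
  exact ⟨A.toContinuousLinearEquiv, by ext u v; rfl⟩

variable [FiniteDimensional ℝ E]

theorem musical_reebVec (h : IsContactPair b Ω) (v : E) :
    Ω (reebVec b Ω) v + b (reebVec b Ω) * b v = b v := by
  rw [← contactMusical_apply, reebVec, h.isInvertible_contactMusical.self_apply_inverse]

/-- Evaluating the defining equation of the Reeb vector `R` at `R` gives `b(R)² = b(R)`. If `b(R)`
vanished, `R` would vanish by nondegeneracy, and then so would `b`. -/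
theorem apply_reebVec (h : IsContactPair b Ω) : b (reebVec b Ω) = 1 := by
  have h1 := h.musical_reebVec (reebVec b Ω)
  rw [h.self_eq_zero, zero_add] at h1
  have h2 : b (reebVec b Ω) ≠ 0 := by
    intro h0
    have h3 : reebVec b Ω = 0 := h.nondegenerate _ h0 fun v hv => by
      have := h.musical_reebVec v
      rwa [h0, zero_mul, add_zero, hv] at this
    refine h.ne_zero (ContinuousLinearMap.ext fun v => ?_)
    rw [← h.musical_reebVec v, h3]
    simp
  exact mul_right_cancel₀ h2 (by rw [h1, one_mul])

theorem omega_reebVec (h : IsContactPair b Ω) (v : E) : Ω (reebVec b Ω) v = 0 := by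
  have := h.musical_reebVec v
  rw [h.apply_reebVec, one_mul] at this
  linarith

theorem apply_hamVec (h : IsContactPair b Ω) (c : ℝ) (k : E →L[ℝ] ℝ) :
    b (hamVec b Ω c k) = c := by
  have h1 : contactMusical b Ω (hamVec b Ω c k) (reebVec b Ω) = c := by
    rw [hamVec, h.isInvertible_contactMusical.self_apply_inverse]
    simp [h.apply_reebVec]
  rw [contactMusical_apply, h.swap, h.omega_reebVec, h.apply_reebVec] at h1
  linarith

theorem omega_hamVec (h : IsContactPair b Ω) (c : ℝ) (k : E →L[ℝ] ℝ) (w : E) :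
    Ω (hamVec b Ω c k) w + k w = k (reebVec b Ω) * b w := by
  have h1 : contactMusical b Ω (hamVec b Ω c k) w = (k (reebVec b Ω) + c) * b w - k w := by
    rw [hamVec, h.isInvertible_contactMusical.self_apply_inverse]
    simp
  rw [contactMusical_apply, h.apply_hamVec] at h1
  linarith

/-- Two vectors satisfying these equations have a difference in `ker b` that is `Ω`-orthogonal to
`ker b`. The factor `g` may be arbitrary because only test vectors in `ker b` are used. -/
theorem eq_hamVec (h : IsContactPair b Ω) {c g : ℝ} {k : E →L[ℝ] ℝ} {u : E} (hu : b u = c)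
    (hw : ∀ w, Ω u w + k w = g * b w) : u = hamVec b Ω c k := by
  refine sub_eq_zero.mp (h.nondegenerate _ ?_ fun v hv => ?_)
  · rw [map_sub, hu, h.apply_hamVec, sub_self]
  · have h1 := hw v
    have h2 := h.omega_hamVec c k v
    rw [hv, mul_zero] at h1 h2
    rw [map_sub, sub_apply]
    linarith

theorem hamVec_zero (h : IsContactPair b Ω) : hamVec b Ω 0 0 = 0 :=
  (h.eq_hamVec (g := 0) (map_zero b) fun w => by simp).symm

/-- Hamiltonian vectors are natural under linear isomorphisms. -/
theorem map_hamVec (h : IsContactPair b Ω) (A : E ≃L[ℝ] E) {b' : E →L[ℝ] ℝ}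
    {Ω' : E →L[ℝ] E →L[ℝ] ℝ} (hb : ∀ u, b u = b' (A u)) (hΩ : ∀ u v, Ω u v = Ω' (A u) (A v))
    {c : ℝ} {k k' : E →L[ℝ] ℝ} (hk : ∀ u, k u = k' (A u)) :
    A (hamVec b Ω c k) = hamVec b' Ω' c k' := by
  refine (h.map_equiv A hb hΩ).eq_hamVec (g := k (reebVec b Ω)) ?_ fun w => ?_
  · rw [← hb, h.apply_hamVec]
  · have := h.omega_hamVec c k (A.symm w)
    rwa [hΩ, hk, hb, A.apply_symm_apply] at this

end IsContactPair

variable [FiniteDimensional ℝ E] {P : Type*} [NormedAddCommGroup P] [NormedSpace ℝ P]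

theorem contDiffAt_contactMusical_inverse {b : P → E →L[ℝ] ℝ} {Ω : P → E →L[ℝ] E →L[ℝ] ℝ} {p : P}
    (hb : ContDiffAt ℝ ∞ b p) (hΩ : ContDiffAt ℝ ∞ Ω p) (h : IsContactPair (b p) (Ω p)) :
    ContDiffAt ℝ ∞ (fun q => (contactMusical (b q) (Ω q)).inverse) p := by
  have : CompleteSpace E := FiniteDimensional.complete ℝ E
  have h1 : ContDiffAt ℝ ∞ (fun q => contactMusical (b q) (Ω q)) p :=
    hΩ.add (hb.smulRight hb)
  exact (h.isInvertible_contactMusical.contDiffAt_map_inverse).comp p h1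

theorem contDiffAt_reebVec {b : P → E →L[ℝ] ℝ} {Ω : P → E →L[ℝ] E →L[ℝ] ℝ} {p : P}
    (hb : ContDiffAt ℝ ∞ b p) (hΩ : ContDiffAt ℝ ∞ Ω p) (h : IsContactPair (b p) (Ω p)) :
    ContDiffAt ℝ ∞ (fun q => reebVec (b q) (Ω q)) p :=
  (contDiffAt_contactMusical_inverse hb hΩ h).clm_apply hb

theorem contDiffAt_hamVec {b : P → E →L[ℝ] ℝ} {Ω : P → E →L[ℝ] E →L[ℝ] ℝ} {c : P → ℝ}
    {k : P → E →L[ℝ] ℝ} {p : P} (hb : ContDiffAt ℝ ∞ b p) (hΩ : ContDiffAt ℝ ∞ Ω p)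
    (hc : ContDiffAt ℝ ∞ c p) (hk : ContDiffAt ℝ ∞ k p) (h : IsContactPair (b p) (Ω p)) :
    ContDiffAt ℝ ∞ (fun q => hamVec (b q) (Ω q) (c q) (k q)) p :=
  (contDiffAt_contactMusical_inverse hb hΩ h).clm_apply
    ((((hk.clm_apply (contDiffAt_reebVec hb hΩ h)).add hc).smul hb).sub hk)

end ContactLinearAlgebra

/-! ### Differential forms, functions and contact vector fields read in charts. -/

/-- The model space of a `(2n+1)`-dimensional manifold. -/
abbrev Model (n : ℕ) : Type := EuclideanSpace ℝ (Fin (2 * n + 1))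

section FormsInCharts

variable {n : ℕ} {M : Type*} [TopologicalSpace M] [ChartedSpace (Model n) M]

/-- The value of a 1-form at a point as a linear form on the model space. -/
def formAt (α : OneForm n M) (x : M) : Model n →L[ℝ] ℝ := α x

/-- The exterior derivative at a point as a bilinear form on the model space. -/
def extDAt (α : OneForm n M) (x : M) : Model n →L[ℝ] Model n →L[ℝ] ℝ :=
  extDeriv₁ (localForm α x) (extChartAt (𝓡 (2 * n + 1)) x x)

/-- The derivative at `x` of the preferred chart at `x₀`. -/
def chartDeriv (x₀ x : M) : Model n →L[ℝ] Model n :=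
  mfderiv (𝓡 (2 * n + 1)) 𝓘(ℝ, Model n) (extChartAt (𝓡 (2 * n + 1)) x₀) x

/-- The derivative at `y` of the inverse of the preferred chart at `x₀`. -/
def chartSymmDeriv (x₀ : M) (y : Model n) : Model n →L[ℝ] Model n :=
  mfderiv 𝓘(ℝ, Model n) (𝓡 (2 * n + 1)) (extChartAt (𝓡 (2 * n + 1)) x₀).symm y

theorem localForm_apply (α : OneForm n M) (x₀ : M) (y w : Model n) :
    localForm α x₀ y w =
      formAt α ((extChartAt (𝓡 (2 * n + 1)) x₀).symm y) (chartSymmDeriv x₀ y w) := rfl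

variable [IsManifold (𝓡 (2 * n + 1)) ∞ M]

theorem mdifferentiableAt_extChartAt' {x₀ x : M}
    (hx : x ∈ (extChartAt (𝓡 (2 * n + 1)) x₀).source) :
    MDifferentiableAt (𝓡 (2 * n + 1)) 𝓘(ℝ, Model n) (extChartAt (𝓡 (2 * n + 1)) x₀) x := by
  have : IsManifold (𝓡 (2 * n + 1)) 1 M := IsManifold.of_le (n := ∞) (by exact_mod_cast le_top)
  exact mdifferentiableAt_extChartAt (by rwa [← extChartAt_source (𝓡 (2 * n + 1)) x₀])

theorem mdifferentiableAt_extChartAt_symm' {x₀ : M} {y : Model n}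
    (hy : y ∈ (extChartAt (𝓡 (2 * n + 1)) x₀).target) :
    MDifferentiableAt 𝓘(ℝ, Model n) (𝓡 (2 * n + 1)) (extChartAt (𝓡 (2 * n + 1)) x₀).symm y := by
  have : IsManifold (𝓡 (2 * n + 1)) 1 M := IsManifold.of_le (n := ∞) (by exact_mod_cast le_top)
  have h := mdifferentiableWithinAt_extChartAt_symm (I := 𝓡 (2 * n + 1)) hy
  rwa [ModelWithCorners.range_eq_univ, mdifferentiableWithinAt_univ] at h

theorem chartSymmDeriv_chartDeriv {x₀ x : M}
    (hx : x ∈ (extChartAt (𝓡 (2 * n + 1)) x₀).source) (v : Model n) :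
    chartSymmDeriv x₀ (extChartAt (𝓡 (2 * n + 1)) x₀ x) (chartDeriv x₀ x v) = v := by
  have : IsManifold (𝓡 (2 * n + 1)) 1 M := IsManifold.of_le (n := ∞) (by exact_mod_cast le_top)
  have h := mfderivWithin_extChartAt_symm_comp_mfderiv_extChartAt' (I := 𝓡 (2 * n + 1)) hx
  rw [ModelWithCorners.range_eq_univ, mfderivWithin_univ] at h
  exact congrArg (fun l : Model n →L[ℝ] Model n => l v) h

theorem chartDeriv_chartSymmDeriv {x₀ x : M}
    (hx : x ∈ (extChartAt (𝓡 (2 * n + 1)) x₀).source) (v : Model n) :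
    chartDeriv x₀ x (chartSymmDeriv x₀ (extChartAt (𝓡 (2 * n + 1)) x₀ x) v) = v := by
  have : IsManifold (𝓡 (2 * n + 1)) 1 M := IsManifold.of_le (n := ∞) (by exact_mod_cast le_top)
  have h := mfderiv_extChartAt_comp_mfderivWithin_extChartAt_symm' (I := 𝓡 (2 * n + 1)) hx
  rw [ModelWithCorners.range_eq_univ, mfderivWithin_univ] at h
  exact congrArg (fun l : Model n →L[ℝ] Model n => l v) h

theorem chartSymmDeriv_self (x : M) (v : Model n) :
    chartSymmDeriv x (extChartAt (𝓡 (2 * n + 1)) x x) v = v := by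
  have : IsManifold (𝓡 (2 * n + 1)) 1 M := IsManifold.of_le (n := ∞) (by exact_mod_cast le_top)
  have h := mfderivWithin_range_extChartAt_symm (I := 𝓡 (2 * n + 1)) (x := x)
  rw [ModelWithCorners.range_eq_univ, mfderivWithin_univ] at h
  exact congrArg (fun l : Model n →L[ℝ] Model n => l v) h

/-- The derivative of a chart as a linear isomorphism. -/
def chartDerivEquiv (x₀ x : M) (hx : x ∈ (extChartAt (𝓡 (2 * n + 1)) x₀).source) :
    Model n ≃L[ℝ] Model n :=
  ContinuousLinearEquiv.equivOfInverse (chartDeriv x₀ x)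
    (chartSymmDeriv x₀ (extChartAt (𝓡 (2 * n + 1)) x₀ x))
    (chartSymmDeriv_chartDeriv hx) (chartDeriv_chartSymmDeriv hx)

theorem formAt_eq_localForm (α : OneForm n M) {x₀ x : M}
    (hx : x ∈ (extChartAt (𝓡 (2 * n + 1)) x₀).source) (v : Model n) :
    formAt α x v = localForm α x₀ (extChartAt (𝓡 (2 * n + 1)) x₀ x) (chartDeriv x₀ x v) := by
  rw [localForm_apply, chartSymmDeriv_chartDeriv hx, (extChartAt (𝓡 (2 * n + 1)) x₀).left_inv hx]

/-- Evaluated on a constant vector, the local form is `α` composed with the tangent map of the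
inverse chart along a constant section; smoothness in finite dimension is tested on such vectors. -/
theorem IsContactForm.contDiffOn_localForm {α : OneForm n M} (hα : IsContactForm α) (x₀ : M) :
    ContDiffOn ℝ ∞ (localForm α x₀) (extChartAt (𝓡 (2 * n + 1)) x₀).target := by
  set e := extChartAt (𝓡 (2 * n + 1)) x₀
  have hto : IsOpen e.target := isOpen_extChartAt_target x₀
  rw [contDiffOn_clm_apply]
  intro w
  have h1 : ContMDiffOn 𝓘(ℝ, Model n).tangent (𝓡 (2 * n + 1)).tangent ∞
      (tangentMapWithin 𝓘(ℝ, Model n) (𝓡 (2 * n + 1)) e.symm e.target)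
      (Bundle.TotalSpace.proj ⁻¹' e.target) :=
    (contMDiffOn_extChartAt_symm (n := ∞) x₀).contMDiffOn_tangentMapWithin (by simp)
      hto.uniqueMDiffOn
  have h2 : ContMDiff 𝓘(ℝ, Model n) 𝓘(ℝ, Model n).tangent ∞
      (fun y : Model n => (⟨y, w⟩ : TangentBundle 𝓘(ℝ, Model n) (Model n))) :=
    contMDiff_vectorSpace_iff_contDiff.mpr contDiff_const
  have h3 := (hα.smooth.comp_contMDiffOn h1).comp h2.contMDiffOn
    (fun y (hy : y ∈ e.target) => hy)
  refine contMDiffOn_iff_contDiffOn.mp (h3.congr fun y hy => ?_)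
  have h4 : mfderivWithin 𝓘(ℝ, Model n) (𝓡 (2 * n + 1)) e.symm e.target y =
      mfderiv 𝓘(ℝ, Model n) (𝓡 (2 * n + 1)) e.symm y :=
    mfderivWithin_of_isOpen hto hy
  change localForm α x₀ y w = α (e.symm y)
    (mfderivWithin 𝓘(ℝ, Model n) (𝓡 (2 * n + 1)) e.symm e.target y w)
  rw [h4]
  rfl

theorem contDiffAt_chartChange {x₀ x : M}
    (hx : x ∈ (extChartAt (𝓡 (2 * n + 1)) x₀).source) :
    ContDiffAt ℝ ∞ (extChartAt (𝓡 (2 * n + 1)) x₀ ∘ (extChartAt (𝓡 (2 * n + 1)) x).symm)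
      (extChartAt (𝓡 (2 * n + 1)) x x) := by
  refine contMDiffAt_iff_contDiffAt.mp ?_
  have h2 : ContMDiffAt 𝓘(ℝ, Model n) (𝓡 (2 * n + 1)) ∞ (extChartAt (𝓡 (2 * n + 1)) x).symm
      (extChartAt (𝓡 (2 * n + 1)) x x) :=
    (contMDiffOn_extChartAt_symm x).contMDiffAt
      ((isOpen_extChartAt_target x).mem_nhds (mem_extChartAt_target x))
  refine ContMDiffAt.comp _ ?_ h2
  rw [extChartAt_to_inv]
  exact contMDiffAt_extChartAt' (by rwa [← extChartAt_source (𝓡 (2 * n + 1)) x₀])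

theorem fderiv_chartChange {x₀ x z : M} (hx : z ∈ (extChartAt (𝓡 (2 * n + 1)) x₀).source)
    (hz : z ∈ (extChartAt (𝓡 (2 * n + 1)) x).source) (w : Model n) :
    fderiv ℝ (extChartAt (𝓡 (2 * n + 1)) x₀ ∘ (extChartAt (𝓡 (2 * n + 1)) x).symm)
      (extChartAt (𝓡 (2 * n + 1)) x z) w =
      chartDeriv x₀ z (chartSymmDeriv x (extChartAt (𝓡 (2 * n + 1)) x z) w) := by
  have hinv := (extChartAt (𝓡 (2 * n + 1)) x).left_inv hz
  have h1 : HasMFDerivAt 𝓘(ℝ, Model n) (𝓡 (2 * n + 1)) (extChartAt (𝓡 (2 * n + 1)) x).symm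
      (extChartAt (𝓡 (2 * n + 1)) x z) _ :=
    (mdifferentiableAt_extChartAt_symm'
      ((extChartAt (𝓡 (2 * n + 1)) x).map_source hz)).hasMFDerivAt
  have h2 : HasMFDerivAt (𝓡 (2 * n + 1)) 𝓘(ℝ, Model n) (extChartAt (𝓡 (2 * n + 1)) x₀)
      ((extChartAt (𝓡 (2 * n + 1)) x).symm (extChartAt (𝓡 (2 * n + 1)) x z)) (chartDeriv x₀ z) := by
    rw [hinv]
    exact (mdifferentiableAt_extChartAt' hx).hasMFDerivAt
  have h3 : HasFDerivAt (extChartAt (𝓡 (2 * n + 1)) x₀ ∘ (extChartAt (𝓡 (2 * n + 1)) x).symm)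
      ((chartDeriv x₀ z).comp (chartSymmDeriv x (extChartAt (𝓡 (2 * n + 1)) x z)))
      (extChartAt (𝓡 (2 * n + 1)) x z) :=
    hasMFDerivAt_iff_hasFDerivAt.mp (HasMFDerivAt.comp _ h2 h1)
  rw [h3.fderiv]
  rfl

/-- `extDAt` uses a different chart at every point, so its smoothness is not visible. Naturality of
the exterior derivative under the transition map expresses it in one fixed chart. -/
theorem IsContactForm.extDAt_eq {α : OneForm n M} (hα : IsContactForm α) {x₀ x : M}
    (hx : x ∈ (extChartAt (𝓡 (2 * n + 1)) x₀).source) (u v : Model n) :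
    extDAt α x u v = extDeriv₁ (localForm α x₀) (extChartAt (𝓡 (2 * n + 1)) x₀ x)
      (chartDeriv x₀ x u) (chartDeriv x₀ x v) := by
  set e := extChartAt (𝓡 (2 * n + 1)) x₀
  set e' := extChartAt (𝓡 (2 * n + 1)) x
  set τ := e ∘ e'.symm
  have hxs : x ∈ e'.source := mem_extChartAt_source x
  have hτ : ContDiffAt ℝ ∞ τ (e' x) := contDiffAt_chartChange hx
  have hτx : τ (e' x) = e x := by simp [τ, e']
  have hloc : localForm α x =ᶠ[𝓝 (e' x)]
      fun y => (localForm α x₀ (τ y)).comp (fderiv ℝ τ y) := by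
    have hc : ContinuousAt e'.symm (e' x) := continuousAt_extChartAt_symm x
    have hsrc : ∀ᶠ y in 𝓝 (e' x), e'.symm y ∈ e.source := by
      refine hc.eventually_mem ?_
      rw [e'.left_inv hxs]
      exact (isOpen_extChartAt_source x₀).mem_nhds hx
    filter_upwards [hsrc, (isOpen_extChartAt_target x).mem_nhds (mem_extChartAt_target x)]
      with y hy hyt
    refine ContinuousLinearMap.ext fun w => ?_
    have hy' : e' (e'.symm y) = y := e'.right_inv hyt
    have h1 := fderiv_chartChange hy (e'.map_target hyt) w
    rw [hy'] at h1
    rw [localForm_apply, formAt_eq_localForm α hy, ContinuousLinearMap.comp_apply, h1]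
    rfl
  have h1 : extDAt α x u v =
      extDeriv₁ (fun y => (localForm α x₀ (τ y)).comp (fderiv ℝ τ y)) (e' x) u v := by
    rw [extDAt, extDeriv₁, hloc.fderiv_eq, extDeriv₁]
  have hb : ContDiffAt ℝ ∞ (localForm α x₀) (τ (e' x)) := by
    rw [hτx]
    exact (hα.contDiffOn_localForm x₀).contDiffAt
      ((isOpen_extChartAt_target x₀).mem_nhds (e.map_source hx))
  have h2 : ∀ w, fderiv ℝ τ (e' x) w = chartDeriv x₀ x w := fun w => by
    rw [fderiv_chartChange hx hxs, chartSymmDeriv_self]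
  rw [h1, extDeriv₁_pullback hτ hb, hτx, h2, h2]

theorem IsContactForm.isContactPair {α : OneForm n M} (hα : IsContactForm α) (x : M) :
    IsContactPair (formAt α x) (extDAt α x) where
  swap := extDeriv₁_swap _ _
  ne_zero := hα.ne_zero x
  nondegenerate := hα.nondegenerate x

theorem IsContactForm.isContactPair_chart {α : OneForm n M} (hα : IsContactForm α) {x₀ x : M}
    (hx : x ∈ (extChartAt (𝓡 (2 * n + 1)) x₀).source) :
    IsContactPair (localForm α x₀ (extChartAt (𝓡 (2 * n + 1)) x₀ x))
      (extDeriv₁ (localForm α x₀) (extChartAt (𝓡 (2 * n + 1)) x₀ x)) :=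
  (hα.isContactPair x).map_equiv (chartDerivEquiv x₀ x hx) (formAt_eq_localForm α hx)
    (hα.extDAt_eq hx)

/-- The derivative at a point of a function, as a linear form on the model space. -/
def diffAt (k : M → ℝ) (x : M) : Model n →L[ℝ] ℝ := mfderiv (𝓡 (2 * n + 1)) 𝓘(ℝ, ℝ) k x

theorem diffAt_eq {k : M → ℝ} {x₀ x : M} (hk : MDifferentiableAt (𝓡 (2 * n + 1)) 𝓘(ℝ, ℝ) k x)
    (hx : x ∈ (extChartAt (𝓡 (2 * n + 1)) x₀).source) (v : Model n) :
    diffAt k x v = fderiv ℝ (k ∘ (extChartAt (𝓡 (2 * n + 1)) x₀).symm)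
      (extChartAt (𝓡 (2 * n + 1)) x₀ x) (chartDeriv x₀ x v) := by
  set e := extChartAt (𝓡 (2 * n + 1)) x₀
  have hinv := e.left_inv hx
  have h1 : HasMFDerivAt 𝓘(ℝ, Model n) (𝓡 (2 * n + 1)) e.symm (e x) (chartSymmDeriv x₀ (e x)) :=
    (mdifferentiableAt_extChartAt_symm' (e.map_source hx)).hasMFDerivAt
  have h2 : HasMFDerivAt (𝓡 (2 * n + 1)) 𝓘(ℝ, ℝ) k (e.symm (e x)) (diffAt k x) := by
    rw [hinv]
    exact hk.hasMFDerivAt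
  have h3 : HasFDerivAt (k ∘ e.symm) ((diffAt k x).comp (chartSymmDeriv x₀ (e x))) (e x) :=
    hasMFDerivAt_iff_hasFDerivAt.mp (HasMFDerivAt.comp _ h2 h1)
  rw [h3.fderiv]
  exact congrArg (diffAt k x) (chartSymmDeriv_chartDeriv hx v).symm

/-- The contact vector field of a Hamiltonian. -/
def hamField (α : OneForm n M) (k : M → ℝ) (x : M) : TangentSpace (𝓡 (2 * n + 1)) x :=
  hamVec (E := Model n) (formAt α x) (extDAt α x) (k x) (diffAt k x)

/-- The expression of the contact vector field of a Hamiltonian in a chart. -/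
def chartHam (α : OneForm n M) (k : M → ℝ) (x₀ : M) (y : Model n) : Model n :=
  hamVec (localForm α x₀ y) (extDeriv₁ (localForm α x₀) y)
    (k ((extChartAt (𝓡 (2 * n + 1)) x₀).symm y))
    (fderiv ℝ (k ∘ (extChartAt (𝓡 (2 * n + 1)) x₀).symm) y)

/-- Hamiltonian vectors are natural under linear isomorphisms, here the derivative of the chart. The
right-hand side is manifestly smooth in the point, which gives the smoothness of the contact vector
field. -/
theorem IsContactForm.chartDeriv_hamField {α : OneForm n M} (hα : IsContactForm α) {k : M → ℝ}
    {x₀ x : M} (hk : MDifferentiableAt (𝓡 (2 * n + 1)) 𝓘(ℝ, ℝ) k x)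
    (hx : x ∈ (extChartAt (𝓡 (2 * n + 1)) x₀).source) :
    chartDeriv x₀ x (hamField α k x) =
      chartHam α k x₀ (extChartAt (𝓡 (2 * n + 1)) x₀ x) := by
  have h := (hα.isContactPair x).map_hamVec (chartDerivEquiv x₀ x hx) (formAt_eq_localForm α hx)
    (hα.extDAt_eq hx) (c := k x) (diffAt_eq hk hx)
  rw [chartHam, (extChartAt (𝓡 (2 * n + 1)) x₀).left_inv hx]
  exact h

end FormsInCharts

/-! ### Time-dependent Hamiltonians and the suspended vector field on `ℝ × M`. -/

section HamiltonianFlow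

variable {n : ℕ} {M : Type*} [TopologicalSpace M] [ChartedSpace (Model n) M]

/-- The time-dependent contact vector field of a time-dependent Hamiltonian. -/
def hamVel (α : OneForm n M) (K : ℝ × M → ℝ) (p : ℝ × M) : Model n :=
  hamField α (fun y => K (p.1, y)) p.2

/-- The suspension of the contact vector field of a time-dependent Hamiltonian. -/
def suspension (α : OneForm n M) (K : ℝ × M → ℝ) (p : ℝ × M) :
    TangentSpace (𝓘(ℝ, ℝ).prod (𝓡 (2 * n + 1))) p :=
  (((1 : ℝ), hamVel α K p) : ℝ × Model n)

theorem mdifferentiableAt_slice {K : ℝ × M → ℝ}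
    (hK : ContMDiff (𝓘(ℝ, ℝ).prod (𝓡 (2 * n + 1))) 𝓘(ℝ, ℝ) ∞ K) (t : ℝ) (x : M) :
    MDifferentiableAt (𝓡 (2 * n + 1)) 𝓘(ℝ, ℝ) (fun y => K (t, y)) x := by
  have h : ContMDiff (𝓡 (2 * n + 1)) 𝓘(ℝ, ℝ) ∞ (fun y => K (t, y)) :=
    hK.comp (contMDiff_const.prodMk contMDiff_id)
  exact h.mdifferentiableAt (by simp)

variable [IsManifold (𝓡 (2 * n + 1)) ∞ M]

theorem IsContactForm.hamVel_eq_zero {α : OneForm n M} (hα : IsContactForm α) {K : ℝ × M → ℝ}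
    {p : ℝ × M} (hK : ∀ᶠ y in 𝓝 p.2, K (p.1, y) = 0) : hamVel α K p = 0 := by
  have h1 : diffAt (n := n) (fun y => K (p.1, y)) p.2 = 0 := by
    have h2 : (fun y => K (p.1, y)) =ᶠ[𝓝 p.2] fun _ => (0 : ℝ) := hK
    have h3 : HasMFDerivAt (𝓡 (2 * n + 1)) 𝓘(ℝ, ℝ) (fun y => K (p.1, y)) p.2 0 :=
      (hasMFDerivAt_const (0 : ℝ) p.2).congr_of_eventuallyEq h2
    exact h3.mfderiv
  change hamVec (formAt α p.2) (extDAt α p.2) (K (p.1, p.2))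
    (diffAt (fun y => K (p.1, y)) p.2) = 0
  rw [h1, hK.self_of_nhds]
  exact (hα.isContactPair p.2).hamVec_zero

/-- A time-dependent function in the preferred chart at `x₀`. -/
def chartFun (K : ℝ × M → ℝ) (x₀ : M) (q : ℝ × Model n) : ℝ :=
  K (q.1, (extChartAt (𝓡 (2 * n + 1)) x₀).symm q.2)

theorem contDiffAt_chartFun {K : ℝ × M → ℝ}
    (hK : ContMDiff (𝓘(ℝ, ℝ).prod (𝓡 (2 * n + 1))) 𝓘(ℝ, ℝ) ∞ K) {x₀ : M} {q : ℝ × Model n}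
    (hq : q.2 ∈ (extChartAt (𝓡 (2 * n + 1)) x₀).target) :
    ContDiffAt ℝ ∞ (chartFun K x₀) q := by
  refine contMDiffAt_iff_contDiffAt.mp ?_
  refine ContMDiffAt.comp (I' := 𝓘(ℝ, ℝ).prod (𝓡 (2 * n + 1))) q (hK _) ?_
  have h1 : ContMDiffAt 𝓘(ℝ, ℝ × Model n) 𝓘(ℝ, ℝ) ∞ (fun q : ℝ × Model n => q.1) q :=
    contDiffAt_fst.contMDiffAt
  have h2 : ContMDiffAt 𝓘(ℝ, ℝ × Model n) 𝓘(ℝ, Model n) ∞ (fun q : ℝ × Model n => q.2) q :=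
    contDiffAt_snd.contMDiffAt
  exact h1.prodMk (((contMDiffOn_extChartAt_symm x₀).contMDiffAt
    ((isOpen_extChartAt_target x₀).mem_nhds hq)).comp q h2)

theorem fderiv_chartFun_slice {K : ℝ × M → ℝ}
    (hK : ContMDiff (𝓘(ℝ, ℝ).prod (𝓡 (2 * n + 1))) 𝓘(ℝ, ℝ) ∞ K) {x₀ : M} {q : ℝ × Model n}
    (hq : q.2 ∈ (extChartAt (𝓡 (2 * n + 1)) x₀).target) :
    fderiv ℝ ((fun y => K (q.1, y)) ∘ (extChartAt (𝓡 (2 * n + 1)) x₀).symm) q.2 =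
      (fderiv ℝ (chartFun K x₀) q).comp (ContinuousLinearMap.inr ℝ ℝ (Model n)) := by
  have h := ((contDiffAt_chartFun hK hq).differentiableAt (by simp)).hasFDerivAt
  exact (HasFDerivAt.comp q.2 (f := fun y => (q.1, y)) h (hasFDerivAt_prodMk_right q.1 q.2)).fderiv

theorem IsContactForm.contDiffAt_localForm {α : OneForm n M} (hα : IsContactForm α) {x₀ : M}
    {y : Model n} (hy : y ∈ (extChartAt (𝓡 (2 * n + 1)) x₀).target) :
    ContDiffAt ℝ ∞ (localForm α x₀) y :=
  (hα.contDiffOn_localForm x₀).contDiffAt ((isOpen_extChartAt_target x₀).mem_nhds hy)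

theorem contDiffAt_extDeriv₁ {E : Type*} [NormedAddCommGroup E] [NormedSpace ℝ E]
    [FiniteDimensional ℝ E] {b : E → E →L[ℝ] ℝ} {y : E} (hb : ContDiffAt ℝ ∞ b y) : ContDiffAt ℝ ∞ (extDeriv₁ b) y := by
  have h : ContDiffAt ℝ ∞ (fderiv ℝ b) y := hb.fderiv_right (by simp)
  have h2 : ContDiffAt ℝ ∞ (fun z => (fderiv ℝ b z).flip) y := by
    have h3 : ContDiff ℝ ∞ fun l : E →L[ℝ] E →L[ℝ] ℝ => l.flip :=
      contDiff_clm_apply_iff.mpr fun w => contDiff_clm_apply_iff.mpr fun w' =>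
        (contDiff_id.clm_apply contDiff_const).clm_apply contDiff_const
    exact h3.contDiffAt.comp y h
  exact h.sub h2

theorem IsContactForm.isContactPair_target {α : OneForm n M} (hα : IsContactForm α) {x₀ : M}
    {y : Model n} (hy : y ∈ (extChartAt (𝓡 (2 * n + 1)) x₀).target) :
    IsContactPair (localForm α x₀ y) (extDeriv₁ (localForm α x₀) y) := by
  have h := hα.isContactPair_chart ((extChartAt (𝓡 (2 * n + 1)) x₀).map_target hy)
  rwa [(extChartAt (𝓡 (2 * n + 1)) x₀).right_inv hy] at h

/-- All ingredients (the form, its exterior derivative, the value and the spatial derivative of the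
Hamiltonian) are smooth jointly in time and space, and inversion of operators is smooth at
invertible ones. -/
theorem IsContactForm.contDiffAt_chartHam {α : OneForm n M} (hα : IsContactForm α)
    {K : ℝ × M → ℝ} (hK : ContMDiff (𝓘(ℝ, ℝ).prod (𝓡 (2 * n + 1))) 𝓘(ℝ, ℝ) ∞ K) {x₀ : M}
    {q : ℝ × Model n} (hq : q.2 ∈ (extChartAt (𝓡 (2 * n + 1)) x₀).target) :
    ContDiffAt ℝ ∞ (fun q : ℝ × Model n => chartHam α (fun y => K (q.1, y)) x₀ q.2) q := by
  have hb : ContDiffAt ℝ ∞ (fun q : ℝ × Model n => localForm α x₀ q.2) q :=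
    (hα.contDiffAt_localForm hq).comp q contDiffAt_snd
  have hω : ContDiffAt ℝ ∞ (fun q : ℝ × Model n => extDeriv₁ (localForm α x₀) q.2) q :=
    (contDiffAt_extDeriv₁ (hα.contDiffAt_localForm hq)).comp q contDiffAt_snd
  have hk := contDiffAt_chartFun hK hq
  have hdk : ContDiffAt ℝ ∞ (fun q => (fderiv ℝ (chartFun K x₀) q).comp
      (ContinuousLinearMap.inr ℝ ℝ (Model n))) q :=
    (hk.fderiv_right (m := ∞) (by simp)).clm_comp contDiffAt_const
  refine (contDiffAt_hamVec hb hω hk hdk (hα.isContactPair_target hq)).congr_of_eventuallyEq ?_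
  have hev : ∀ᶠ q' : ℝ × Model n in 𝓝 q, q'.2 ∈ (extChartAt (𝓡 (2 * n + 1)) x₀).target :=
    continuousAt_snd.eventually ((isOpen_extChartAt_target x₀).mem_nhds hq)
  filter_upwards [hev] with q' hq'
  rw [chartHam, fderiv_chartFun_slice hK hq']
  rfl

theorem chartField_suspension (α : OneForm n M) (K : ℝ × M → ℝ) {p₀ p : ℝ × M}
    (hp : p.2 ∈ (extChartAt (𝓡 (2 * n + 1)) p₀.2).source) :
    chartField (𝓘(ℝ, ℝ).prod (𝓡 (2 * n + 1))) (suspension α K) p₀ p =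
      ((1 : ℝ), chartDeriv p₀.2 p.2 (hamVel α K p)) := by
  have h1 : (extChartAt (𝓘(ℝ, ℝ).prod (𝓡 (2 * n + 1))) p₀ : ℝ × M → ℝ × Model n) =
      Prod.map id (extChartAt (𝓡 (2 * n + 1)) p₀.2) := by
    rw [extChartAt_prod, extChartAt_model_space_eq_id]
    rfl
  have h2 : HasMFDerivAt (𝓘(ℝ, ℝ).prod (𝓡 (2 * n + 1))) 𝓘(ℝ, ℝ × Model n)
      (Prod.map id (extChartAt (𝓡 (2 * n + 1)) p₀.2) : ℝ × M → ℝ × Model n) p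
      ((ContinuousLinearMap.fst ℝ ℝ (Model n)).prod
        ((chartDeriv p₀.2 p.2).comp (ContinuousLinearMap.snd ℝ ℝ (Model n)))) := by
    have h4 : HasMFDerivAt (𝓘(ℝ, ℝ).prod (𝓡 (2 * n + 1))) (𝓡 (2 * n + 1))
      (Prod.snd : ℝ × M → M) p (ContinuousLinearMap.snd ℝ ℝ (Model n)) := hasMFDerivAt_snd p
    have h5 : HasMFDerivAt (𝓡 (2 * n + 1)) 𝓘(ℝ, Model n) (extChartAt (𝓡 (2 * n + 1)) p₀.2) p.2
      (chartDeriv p₀.2 p.2) := (mdifferentiableAt_extChartAt' hp).hasMFDerivAt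
    have h6 : HasMFDerivAt (𝓘(ℝ, ℝ).prod (𝓡 (2 * n + 1))) 𝓘(ℝ, ℝ) (Prod.fst : ℝ × M → ℝ) p
      (ContinuousLinearMap.fst ℝ ℝ (Model n)) := hasMFDerivAt_fst p
    have h7 := h6.prodMk (h5.comp p h4)
    rw [← modelWithCornersSelf_prod, chartedSpaceSelf_prod] at h7
    rw [← modelWithCornersSelf_prod]
    exact h7
  have h3 := h2.mfderiv
  rw [chartField, h1]
  exact congrArg (fun l : ℝ × Model n →L[ℝ] ℝ × Model n => l ((1 : ℝ), hamVel α K p)) h3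

end HamiltonianFlow

/-! ### Velocities of curves and integral curves of the suspension. -/

section Velocity

variable {n : ℕ} {M : Type*} [TopologicalSpace M] [ChartedSpace (Model n) M]

/-- The curve `γ` has velocity `v` at time `t`. -/
def HasVelocity (γ : ℝ → M) (v : Model n) (t : ℝ) : Prop :=
  HasMFDerivAt 𝓘(ℝ, ℝ) (𝓡 (2 * n + 1)) γ t
    (((1 : ℝ →L[ℝ] ℝ).smulRight v : ℝ →L[ℝ] Model n) : ℝ →L[ℝ] Model n)

theorem hasVelocity_const (x : M) (t : ℝ) : HasVelocity (n := n) (fun _ => x) 0 t := by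
  refine (hasMFDerivAt_const (I := 𝓘(ℝ, ℝ)) x t).congr_mfderiv ?_
  exact (ContinuousLinearMap.ext fun s => by simp :
    (0 : ℝ →L[ℝ] Model n) = (1 : ℝ →L[ℝ] ℝ).smulRight (0 : Model n))

theorem HasVelocity.suspension {α : OneForm n M} {K : ℝ × M → ℝ} {γ : ℝ → M} {s t : ℝ}
    (h : HasVelocity γ (hamVel α K (s + t, γ t)) t) :
    HasMFDerivAt 𝓘(ℝ, ℝ) (𝓘(ℝ, ℝ).prod (𝓡 (2 * n + 1))) (fun r => (s + r, γ r)) t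
      ((1 : ℝ →L[ℝ] ℝ).smulRight (suspension α K (s + t, γ t))) := by
  have h1 : HasMFDerivAt 𝓘(ℝ, ℝ) 𝓘(ℝ, ℝ) (fun r : ℝ => s + r) t (1 : ℝ →L[ℝ] ℝ) :=
    hasMFDerivAt_iff_hasFDerivAt.mpr ((hasFDerivAt_id t).const_add s)
  refine (h1.prodMk h).congr_mfderiv ?_
  exact (ContinuousLinearMap.ext fun r => Prod.ext (by simp) rfl :
    ((1 : ℝ →L[ℝ] ℝ).prod ((1 : ℝ →L[ℝ] ℝ).smulRight (hamVel α K (s + t, γ t)))) =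
      (1 : ℝ →L[ℝ] ℝ).smulRight (((1 : ℝ), hamVel α K (s + t, γ t)) : ℝ × Model n))

theorem hasVelocity_of_suspension {α : OneForm n M} {K : ℝ × M → ℝ} {γ : ℝ → ℝ × M} {t : ℝ}
    (h : HasMFDerivAt 𝓘(ℝ, ℝ) (𝓘(ℝ, ℝ).prod (𝓡 (2 * n + 1))) γ t
      ((1 : ℝ →L[ℝ] ℝ).smulRight (suspension α K (γ t)))) :
    HasDerivAt (fun r => (γ r).1) 1 t ∧
      HasVelocity (fun r => (γ r).2) (hamVel α K (γ t)) t := by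
  constructor
  · have h1 : HasMFDerivAt (𝓘(ℝ, ℝ).prod (𝓡 (2 * n + 1))) 𝓘(ℝ, ℝ)
      (Prod.fst : ℝ × M → ℝ) (γ t) (ContinuousLinearMap.fst ℝ ℝ (Model n)) := hasMFDerivAt_fst _
    have h2 : HasFDerivAt (fun r => (γ r).1) ((ContinuousLinearMap.fst ℝ ℝ (Model n)).comp
      ((1 : ℝ →L[ℝ] ℝ).smulRight (((1 : ℝ), hamVel α K (γ t)) : ℝ × Model n))) t :=
      hasMFDerivAt_iff_hasFDerivAt.mp (HasMFDerivAt.comp t h1 h)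
    have h3 := h2.hasDerivAt
    simpa using h3
  · have h1 : HasMFDerivAt (𝓘(ℝ, ℝ).prod (𝓡 (2 * n + 1))) (𝓡 (2 * n + 1))
      (Prod.snd : ℝ × M → M) (γ t) (ContinuousLinearMap.snd ℝ ℝ (Model n)) := hasMFDerivAt_snd _
    exact HasMFDerivAt.comp t h1 h

variable [IsManifold (𝓡 (2 * n + 1)) ∞ M]

theorem HasVelocity.hasDerivAt_chart {γ : ℝ → M} {v : Model n} {t : ℝ} (h : HasVelocity γ v t)
    {x₀ : M} (hx : γ t ∈ (extChartAt (𝓡 (2 * n + 1)) x₀).source) :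
    HasDerivAt (fun s => extChartAt (𝓡 (2 * n + 1)) x₀ (γ s)) (chartDeriv x₀ (γ t) v) t := by
  have h5 : HasMFDerivAt (𝓡 (2 * n + 1)) 𝓘(ℝ, Model n) (extChartAt (𝓡 (2 * n + 1)) x₀) (γ t)
    (chartDeriv x₀ (γ t)) := (mdifferentiableAt_extChartAt' hx).hasMFDerivAt
  have h6 : HasFDerivAt (fun s => extChartAt (𝓡 (2 * n + 1)) x₀ (γ s))
      ((chartDeriv x₀ (γ t)).comp ((1 : ℝ →L[ℝ] ℝ).smulRight v)) t :=
    hasMFDerivAt_iff_hasFDerivAt.mp (HasMFDerivAt.comp t h5 h)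
  simpa using h6.hasDerivAt

end Velocity

/-! ### Flows of compactly supported Hamiltonians. -/

section HamiltonianFlow

variable {n : ℕ} {M : Type*} [TopologicalSpace M] [ChartedSpace (Model n) M]
  [IsManifold (𝓡 (2 * n + 1)) ∞ M]

theorem IsContactForm.contMDiff_suspension {α : OneForm n M} (hα : IsContactForm α)
    {K : ℝ × M → ℝ} (hK : ContMDiff (𝓘(ℝ, ℝ).prod (𝓡 (2 * n + 1))) 𝓘(ℝ, ℝ) ∞ K) :
    ContMDiff (𝓘(ℝ, ℝ).prod (𝓡 (2 * n + 1))) (𝓘(ℝ, ℝ).prod (𝓡 (2 * n + 1))).tangent ∞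
      fun p => (⟨p, suspension α K p⟩ : TangentBundle (𝓘(ℝ, ℝ).prod (𝓡 (2 * n + 1))) (ℝ × M)) := by
  refine contMDiff_section_of_chartField fun p₀ => ?_
  have hev : ∀ᶠ p : ℝ × M in 𝓝 p₀, p.2 ∈ (extChartAt (𝓡 (2 * n + 1)) p₀.2).source :=
    continuousAt_snd.eventually ((isOpen_extChartAt_source p₀.2).mem_nhds
      (mem_extChartAt_source p₀.2))
  have h1 : chartField (𝓘(ℝ, ℝ).prod (𝓡 (2 * n + 1))) (suspension α K) p₀ =ᶠ[𝓝 p₀]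
      fun p => ((1 : ℝ), chartHam α (fun y => K (p.1, y)) p₀.2
        (extChartAt (𝓡 (2 * n + 1)) p₀.2 p.2)) := by
    filter_upwards [hev] with p hp
    rw [chartField_suspension α K hp]
    exact congrArg (Prod.mk (1 : ℝ))
      (hα.chartDeriv_hamField (mdifferentiableAt_slice hK p.1 p.2) hp)
  refine ContMDiffAt.congr_of_eventuallyEq ?_ h1
  refine contMDiffAt_const.prodMk_space ?_
  have h2 : ContMDiffAt (𝓘(ℝ, ℝ).prod (𝓡 (2 * n + 1))) 𝓘(ℝ, ℝ × Model n) ∞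
      (fun p : ℝ × M => (p.1, extChartAt (𝓡 (2 * n + 1)) p₀.2 p.2)) p₀ :=
    contMDiffAt_fst.prodMk_space ((contMDiffAt_extChartAt (x := p₀.2)).comp p₀ contMDiffAt_snd)
  have h3 := (hα.contDiffAt_chartHam hK (x₀ := p₀.2)
    (q := (p₀.1, extChartAt (𝓡 (2 * n + 1)) p₀.2 p₀.2)) (mem_extChartAt_target p₀.2)).contMDiffAt
  exact ContMDiffAt.comp p₀ h3 h2

variable [T2Space M]

/-- Uniqueness of trajectories of a time-dependent Hamiltonian. -/
theorem IsContactForm.trajectory_unique {α : OneForm n M} (hα : IsContactForm α)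
    {K : ℝ × M → ℝ} (hK : ContMDiff (𝓘(ℝ, ℝ).prod (𝓡 (2 * n + 1))) 𝓘(ℝ, ℝ) ∞ K)
    {γ γ' : ℝ → M} (hγ : ∀ t, HasVelocity γ (hamVel α K (t, γ t)) t)
    (hγ' : ∀ t, HasVelocity γ' (hamVel α K (t, γ' t)) t) {t₀ : ℝ} (h : γ t₀ = γ' t₀) : γ = γ' := by
  have : IsManifold (𝓡 (2 * n + 1)) 1 M := IsManifold.of_le (n := ∞) (by exact_mod_cast le_top)
  have key : ∀ {γ : ℝ → M}, (∀ t, HasVelocity γ (hamVel α K (t, γ t)) t) →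
      IsMIntegralCurve (fun t => (0 + t, γ t)) (suspension α K) := fun {γ} hγ t =>
    HasVelocity.suspension (s := 0) (by rw [zero_add]; exact hγ t)
  have h1 := isMIntegralCurve_Ioo_eq_of_contMDiff_boundaryless (t₀ := t₀)
    ((hα.contMDiff_suspension hK).of_le (by exact_mod_cast le_top)) (key hγ) (key hγ') (by simp [h])
  exact funext fun t => congrArg Prod.snd (congrFun h1 t)

/-- A compactly supported time-dependent Hamiltonian has a flow. -/
theorem IsContactForm.exists_hamiltonian_flow {α : OneForm n M} (hα : IsContactForm α)
    {K : ℝ × M → ℝ} (hK : ContMDiff (𝓘(ℝ, ℝ).prod (𝓡 (2 * n + 1))) 𝓘(ℝ, ℝ) ∞ K)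
    {a b : ℝ} {C : Set M} (hC : IsCompact C) (hsupp : ∀ p, p ∉ Icc a b ×ˢ C → K p = 0) :
    ∃ Φ : ℝ × M → M, ContMDiff (𝓘(ℝ, ℝ).prod (𝓡 (2 * n + 1))) (𝓡 (2 * n + 1)) ∞ Φ ∧
      (∀ x, Φ (0, x) = x) ∧
      (∀ t, ∃ e : M ≃ₘ⟮𝓡 (2 * n + 1), 𝓡 (2 * n + 1)⟯ M, ⇑e = fun x => Φ (t, x)) ∧
      ∀ t x, HasVelocity (fun s => Φ (s, x)) (hamVel α K (t, Φ (t, x))) t := by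
  -- Where the Hamiltonian vanishes, the suspension is `∂/∂t` and its flow is translation in time.
  -- Starting outside `[a - 1, b + 1] × C`, a trajectory of duration less than 1 does not meet the
  -- support; this is the behaviour at infinity required by `exists_smooth_flow`.
  have hGs : ContMDiff (𝓘(ℝ, ℝ).prod (𝓘(ℝ, ℝ).prod (𝓡 (2 * n + 1))))
      (𝓘(ℝ, ℝ).prod (𝓡 (2 * n + 1))) ∞ (fun p : ℝ × ℝ × M => (p.2.1 + p.1, p.2.2)) := by
    refine ContMDiff.prodMk ?_ (contMDiff_snd.comp contMDiff_snd)
    exact (contMDiff_fst.comp contMDiff_snd).add contMDiff_fst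
  obtain ⟨F, hF, hF0, hFadd, hFv⟩ := exists_smooth_flow (hα.contMDiff_suspension hK)
    ((isCompact_Icc (a := a - 1) (b := b + 1)).prod hC) hGs one_pos
    (fun p => by simp) (fun p hp s hs => by
      refine HasMFDerivAt.hasMFDerivWithinAt ?_
      refine HasVelocity.suspension (γ := fun _ => p.2) (s := p.1) ?_
      have h0 : hamVel α K (p.1 + s, p.2) = 0 := by
        refine hα.hamVel_eq_zero ?_
        by_cases h1 : p.2 ∈ C
        · have h2 : p.1 ∉ Icc (a - 1) (b + 1) := fun h => hp ⟨h, h1⟩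
          refine Filter.Eventually.of_forall fun y => hsupp _ fun h => h2 ?_
          have h3 := h.1
          simp only [mem_Icc, mem_Ioo] at h3 hs ⊢
          constructor <;> linarith [h3.1, h3.2, hs.1, hs.2]
        · filter_upwards [hC.isClosed.isOpen_compl.mem_nhds h1] with y hy
          exact hsupp _ fun h => hy h.2
      rw [h0]
      exact hasVelocity_const _ _)
  have hvel := fun x t => hasVelocity_of_suspension (hFv x t)
  have hfst : ∀ t p, (F (t, p)).1 = p.1 + t := by
    intro t p
    have h1 : ∀ s, HasDerivAt (fun r => (F (r, p)).1 - r) 0 s := fun s => by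
      rw [← sub_self (1 : ℝ)]
      exact (hvel p s).1.sub (hasDerivAt_id s)
    have h2 := is_const_of_deriv_eq_zero (fun s => (h1 s).differentiableAt)
      (fun s => (h1 s).deriv) t 0
    simp only [hF0, sub_zero] at h2
    linarith
  have hFi : ∀ t x, F (t, ((0 : ℝ), x)) = (t, (F (t, ((0 : ℝ), x))).2) := fun t x =>
    Prod.ext (by rw [hfst]; simp) rfl
  have hslice : ∀ t s : ℝ, ContMDiff (𝓡 (2 * n + 1)) (𝓡 (2 * n + 1)) ∞
      (fun x => (F (t, (s, x))).2) := fun t s =>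
    contMDiff_snd.comp (hF.comp (contMDiff_const.prodMk (contMDiff_const.prodMk contMDiff_id)))
  refine ⟨fun p => (F (p.1, ((0 : ℝ), p.2))).2, ?_, fun x => by simp [hF0], fun t => ?_,
    fun t x => ?_⟩
  · exact contMDiff_snd.comp (hF.comp
      (contMDiff_fst.prodMk (contMDiff_const.prodMk contMDiff_snd)))
  -- The inverse of the time-`t` map runs the suspension backwards for time `t`, starting from the
  -- slice at time `t`.
  · refine ⟨⟨⟨fun x => (F (t, ((0 : ℝ), x))).2, fun x => (F (-t, (t, x))).2, fun x => ?_,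
      fun x => ?_⟩, hslice t 0, hslice (-t) t⟩, rfl⟩
    · change (F (-t, (t, (F (t, ((0 : ℝ), x))).2))).2 = x
      rw [← hFi, ← hFadd, neg_add_cancel, hF0]
    · have h1 : F (-t, (t, x)) = ((0 : ℝ), (F (-t, (t, x))).2) :=
        Prod.ext (by rw [hfst]; simp) rfl
      change (F (t, ((0 : ℝ), (F (-t, (t, x))).2))).2 = x
      rw [← h1, ← hFadd, add_neg_cancel, hF0]
  · have h1 := (hvel ((0 : ℝ), x) t).2
    rw [hFi t x] at h1
    exact h1

end HamiltonianFlow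

theorem IsContactPair.hamVec_one_zero {E : Type*} [NormedAddCommGroup E] [NormedSpace ℝ E]
    {b : E →L[ℝ] ℝ} {Ω : E →L[ℝ] E →L[ℝ] ℝ} :
    hamVec b Ω 1 0 = reebVec b Ω := by
  simp [hamVec, reebVec]

/-! ### Flows of contact vector fields preserve the contact structure. -/

section ContactFlow

variable {n : ℕ} {M : Type*} [TopologicalSpace M] [ChartedSpace (Model n) M]

/-- The derivative of a self-map of the manifold, on the model space. -/
def tangentAt (φ : M → M) (x : M) : Model n →L[ℝ] Model n :=
  mfderiv (𝓡 (2 * n + 1)) (𝓡 (2 * n + 1)) φ x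

/-- The derivative of a time-dependent function along the Reeb field. -/
def reebDeriv (α : OneForm n M) (K : ℝ × M → ℝ) (p : ℝ × M) : ℝ :=
  diffAt (fun y => K (p.1, y)) p.2 (hamVel α (fun _ => 1) p)

variable [IsManifold (𝓡 (2 * n + 1)) ∞ M]

theorem IsContactForm.reebDeriv_eq {α : OneForm n M} (hα : IsContactForm α) {K : ℝ × M → ℝ}
    (hK : ContMDiff (𝓘(ℝ, ℝ).prod (𝓡 (2 * n + 1))) 𝓘(ℝ, ℝ) ∞ K) {x₀ : M} {p : ℝ × M}
    (hp : p.2 ∈ (extChartAt (𝓡 (2 * n + 1)) x₀).source) :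
    reebDeriv α K p = fderiv ℝ (chartFun K x₀) (p.1, extChartAt (𝓡 (2 * n + 1)) x₀ p.2)
      ((0 : ℝ), chartHam α (fun _ => 1) x₀ (extChartAt (𝓡 (2 * n + 1)) x₀ p.2)) := by
  have hy := (extChartAt (𝓡 (2 * n + 1)) x₀).map_source hp
  have h1 := diffAt_eq (mdifferentiableAt_slice hK p.1 p.2) hp (hamVel α (fun _ => 1) p)
  have h2 := hα.chartDeriv_hamField (k := fun _ => (1 : ℝ))
    (mdifferentiableAt_const (I := 𝓡 (2 * n + 1))) hp
  rw [reebDeriv, h1,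
    fderiv_chartFun_slice hK (q := (p.1, extChartAt (𝓡 (2 * n + 1)) x₀ p.2)) hy]
  exact congrArg (fun w => fderiv ℝ (chartFun K x₀)
    (p.1, extChartAt (𝓡 (2 * n + 1)) x₀ p.2) ((0 : ℝ), w)) h2

theorem IsContactForm.continuous_reebDeriv {α : OneForm n M} (hα : IsContactForm α)
    {K : ℝ × M → ℝ} (hK : ContMDiff (𝓘(ℝ, ℝ).prod (𝓡 (2 * n + 1))) 𝓘(ℝ, ℝ) ∞ K) :
    Continuous (reebDeriv α K) := by
  refine continuous_iff_continuousAt.mpr fun p₀ => ?_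
  set e := extChartAt (𝓡 (2 * n + 1)) p₀.2
  have hp₀ : p₀.2 ∈ e.source := mem_extChartAt_source p₀.2
  have hev : ∀ᶠ p : ℝ × M in 𝓝 p₀, p.2 ∈ e.source :=
    continuousAt_snd.eventually ((isOpen_extChartAt_source p₀.2).mem_nhds hp₀)
  have h1 : reebDeriv α K =ᶠ[𝓝 p₀] fun p => fderiv ℝ (chartFun K p₀.2) (p.1, e p.2)
      ((0 : ℝ), chartHam α (fun _ => 1) p₀.2 (e p.2)) := by
    filter_upwards [hev] with p hp using hα.reebDeriv_eq hK hp
  refine ContinuousAt.congr ?_ h1.symm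
  have he : ContinuousAt (fun p : ℝ × M => (p.1, e p.2)) p₀ :=
    continuousAt_fst.prodMk ((continuousAt_extChartAt p₀.2).comp continuousAt_snd)
  have ht : e p₀.2 ∈ e.target := e.map_source hp₀
  have h2 : ContinuousAt (fderiv ℝ (chartFun K p₀.2)) (p₀.1, e p₀.2) :=
    ((contDiffAt_chartFun hK (q := (p₀.1, e p₀.2)) ht).fderiv_right (m := ∞)
      (by simp)).continuousAt
  have h3 : ContinuousAt (fun q : ℝ × Model n => chartHam α (fun _ => 1) p₀.2 q.2)
      (p₀.1, e p₀.2) :=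
    (hα.contDiffAt_chartHam (K := fun _ => 1) contMDiff_const
      (q := (p₀.1, e p₀.2)) ht).continuousAt
  have h5 : ContinuousAt (fun q : ℝ × Model n =>
      ((0 : ℝ), chartHam α (fun _ => 1) p₀.2 q.2)) (p₀.1, e p₀.2) :=
    ContinuousAt.prodMk continuousAt_const h3
  have h4 := ContinuousAt.clm_apply h2 h5
  exact ContinuousAt.comp (f := fun p : ℝ × M => (p.1, e p.2)) h4 he

/-- The variation of the contact form along the flow of a contact vector field. -/
theorem IsContactForm.hasDerivAt_formAt_flow {α : OneForm n M} (hα : IsContactForm α)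
    {K : ℝ × M → ℝ} (hK : ContMDiff (𝓘(ℝ, ℝ).prod (𝓡 (2 * n + 1))) 𝓘(ℝ, ℝ) ∞ K)
    {Φ : ℝ × M → M} (hΦ : ContMDiff (𝓘(ℝ, ℝ).prod (𝓡 (2 * n + 1))) (𝓡 (2 * n + 1)) ∞ Φ)
    (hv : ∀ t x, HasVelocity (fun s => Φ (s, x)) (hamVel α K (t, Φ (t, x))) t) (x : M)
    (w : Model n) (t : ℝ) :
    HasDerivAt (fun s => formAt α (Φ (s, x))
        (tangentAt (fun y => Φ (s, y)) x w))
      (reebDeriv α K (t, Φ (t, x)) * formAt α (Φ (t, x))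
        (tangentAt (fun y => Φ (t, y)) x w)) t := by
  set x₀ := Φ (t, x)
  set e := extChartAt (𝓡 (2 * n + 1)) x₀
  set e' := extChartAt (𝓡 (2 * n + 1)) x
  set β := localForm α x₀
  let Ψ : ℝ × Model n → Model n := fun q => e (Φ (q.1, e'.symm q.2))
  set p : ℝ × Model n := (t, e' x)
  have hx' : x ∈ e'.source := mem_extChartAt_source x
  have hsx : e'.symm (e' x) = x := e'.left_inv hx'
  -- points near `p` are mapped into the chart domains
  have hin : ∀ q : ℝ × Model n, q.2 ∈ e'.target → ContMDiffAt 𝓘(ℝ, ℝ × Model n) (𝓡 (2 * n + 1)) ∞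
      (fun q : ℝ × Model n => Φ (q.1, e'.symm q.2)) q := by
    intro q hq
    refine ContMDiffAt.comp (I' := 𝓘(ℝ, ℝ).prod (𝓡 (2 * n + 1))) q (hΦ _) ?_
    have h1 : ContMDiffAt 𝓘(ℝ, ℝ × Model n) 𝓘(ℝ, ℝ) ∞ (fun q : ℝ × Model n => q.1) q :=
      contDiffAt_fst.contMDiffAt
    have h2 : ContMDiffAt 𝓘(ℝ, ℝ × Model n) 𝓘(ℝ, Model n) ∞ (fun q : ℝ × Model n => q.2) q :=
      contDiffAt_snd.contMDiffAt
    exact h1.prodMk (((contMDiffOn_extChartAt_symm x).contMDiffAt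
      ((isOpen_extChartAt_target x).mem_nhds hq)).comp q h2)
  have hpx : Φ (p.1, e'.symm p.2) = x₀ := by simp only [p, hsx, x₀]
  have hev : ∀ᶠ q : ℝ × Model n in 𝓝 p, q.2 ∈ e'.target ∧ Φ (q.1, e'.symm q.2) ∈ e.source := by
    refine Filter.Eventually.and ?_ ?_
    · exact continuousAt_snd.eventually ((isOpen_extChartAt_target x).mem_nhds (e'.map_source hx'))
    · refine (hin p (e'.map_source hx')).continuousAt.eventually_mem ?_
      rw [hpx]
      exact (isOpen_extChartAt_source x₀).mem_nhds (mem_extChartAt_source x₀)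
  have hΨq : ∀ q : ℝ × Model n, q.2 ∈ e'.target → Φ (q.1, e'.symm q.2) ∈ e.source →
      ContDiffAt ℝ ∞ Ψ q := fun q hq1 hq2 =>
    contMDiffAt_iff_contDiffAt.mp (ContMDiffAt.comp q
      (contMDiffAt_extChartAt' (by rwa [← extChartAt_source (𝓡 (2 * n + 1)) x₀])) (hin q hq1))
  have hΨ : ContDiffAt ℝ ∞ Ψ p :=
    hΨq p (e'.map_source hx') (by rw [hpx]; exact mem_extChartAt_source x₀)
  have hΨev : ∀ᶠ q in 𝓝 p, ContDiffAt ℝ ∞ Ψ q := by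
    filter_upwards [hev] with q hq using hΨq q hq.1 hq.2
  have hΨp : Ψ p = e x₀ := congrArg e hpx
  have hβ : ContDiffAt ℝ ∞ β (Ψ p) := by
    rw [hΨp]
    exact hα.contDiffAt_localForm (mem_extChartAt_target x₀)
  -- `b'` is the pullback of `α` to `ℝ × Model n` by the flow in charts. The Lie derivative of `α`
  -- becomes the time derivative of the spatial part of `b'`, to be computed from its exterior
  -- derivative.
  let b' : ℝ × Model n → ℝ × Model n →L[ℝ] ℝ := fun q => (β (Ψ q)).comp (fderiv ℝ Ψ q)
  -- the derivative in the time direction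
  have htime : ∀ q : ℝ × Model n, q.2 ∈ e'.target → Φ (q.1, e'.symm q.2) ∈ e.source →
      ContDiffAt ℝ ∞ Ψ q →
      fderiv ℝ Ψ q ((1 : ℝ), 0) = chartHam α (fun y => K (q.1, y)) x₀ (Ψ q) := by
    intro q _ hq2 hq3
    have h1 := (hv q.1 (e'.symm q.2)).hasDerivAt_chart hq2
    have h2 : HasDerivAt (fun s => Ψ (s, q.2)) (fderiv ℝ Ψ q ((1 : ℝ), 0)) q.1 := by
      have h3 : HasDerivAt (fun s : ℝ => (s, q.2)) ((1 : ℝ), (0 : Model n)) q.1 :=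
        (hasDerivAt_id q.1).prodMk (hasDerivAt_const q.1 q.2)
      exact HasFDerivAt.comp_hasDerivAt (f := fun s : ℝ => (s, q.2)) q.1
        (hq3.differentiableAt (by simp)).hasFDerivAt h3
    rw [h2.unique h1]
    exact hα.chartDeriv_hamField (mdifferentiableAt_slice hK q.1 _) hq2
  -- the derivative in the space directions
  have hspace : ∀ s : ℝ, Φ (s, x) ∈ e.source → ContDiffAt ℝ ∞ Ψ (s, e' x) →
      fderiv ℝ Ψ (s, e' x) ((0 : ℝ), w) = chartDeriv x₀ (Φ (s, x))
        (tangentAt (fun y => Φ (s, y)) x w) := by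
    intro s hs1 hs2
    have hsm : ContMDiff (𝓡 (2 * n + 1)) (𝓡 (2 * n + 1)) ∞ (fun y => Φ (s, y)) :=
      hΦ.comp (contMDiff_const.prodMk contMDiff_id)
    have h1 : HasMFDerivAt 𝓘(ℝ, Model n) (𝓡 (2 * n + 1)) e'.symm (e' x)
        (chartSymmDeriv x (e' x)) :=
      (mdifferentiableAt_extChartAt_symm' (e'.map_source hx')).hasMFDerivAt
    have h2 : HasMFDerivAt (𝓡 (2 * n + 1)) (𝓡 (2 * n + 1)) (fun y => Φ (s, y)) (e'.symm (e' x))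
        (tangentAt (fun y => Φ (s, y)) x) := by
      rw [hsx]
      exact (hsm.mdifferentiableAt (by simp)).hasMFDerivAt
    have h3 : HasMFDerivAt (𝓡 (2 * n + 1)) 𝓘(ℝ, Model n) e (Φ (s, e'.symm (e' x)))
        (chartDeriv x₀ (Φ (s, x))) := by
      rw [hsx]
      exact (mdifferentiableAt_extChartAt' hs1).hasMFDerivAt
    have h4 : HasFDerivAt (fun z => Ψ (s, z)) ((chartDeriv x₀ (Φ (s, x))).comp
        ((tangentAt (fun y => Φ (s, y)) x).comp (chartSymmDeriv x (e' x)))) (e' x) := by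
      have h5 : HasMFDerivAt 𝓘(ℝ, Model n) (𝓡 (2 * n + 1)) (fun z => Φ (s, e'.symm z)) (e' x)
        ((tangentAt (fun y => Φ (s, y)) x).comp (chartSymmDeriv x (e' x))) :=
        HasMFDerivAt.comp (g := fun y => Φ (s, y)) (f := e'.symm) (e' x) h2 h1
      exact hasMFDerivAt_iff_hasFDerivAt.mp
        (HasMFDerivAt.comp (f := fun z => Φ (s, e'.symm z)) (e' x) h3 h5)
    have h5 : HasFDerivAt (fun z => Ψ (s, z)) ((fderiv ℝ Ψ (s, e' x)).comp
        (ContinuousLinearMap.inr ℝ ℝ (Model n))) (e' x) :=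
      HasFDerivAt.comp (f := fun z => (s, z)) (e' x)
        (hs2.differentiableAt (by simp)).hasFDerivAt (hasFDerivAt_prodMk_right s (e' x))
    have h6 := congrArg (fun l : Model n →L[ℝ] Model n => l w) (h5.unique h4)
    have h7 : chartSymmDeriv x (e' x) w = w := chartSymmDeriv_self x w
    simpa [h7] using h6
  have hcurve : Filter.Tendsto (fun s : ℝ => (s, e' x)) (𝓝 t) (𝓝 p) :=
    (continuous_id.prodMk continuous_const).continuousAt
  have hf : ∀ s : ℝ, Φ (s, x) ∈ e.source → ContDiffAt ℝ ∞ Ψ (s, e' x) →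
      b' (s, e' x) ((0 : ℝ), w) = formAt α (Φ (s, x))
        (tangentAt (fun y => Φ (s, y)) x w) := by
    intro s hs1 hs2
    rw [formAt_eq_localForm α hs1, ← hspace s hs1 hs2]
    simp only [b', Ψ, ContinuousLinearMap.comp_apply, hsx]
    rfl
  have hx₀ : Φ (t, x) ∈ e.source := mem_extChartAt_source x₀
  rw [← hf t hx₀ hΨ]
  have hfev : (fun s => b' (s, e' x) ((0 : ℝ), w)) =ᶠ[𝓝 t] fun s => formAt α (Φ (s, x))
        (tangentAt (fun y => Φ (s, y)) x w) := by
    filter_upwards [hcurve.eventually hev, hcurve.eventually hΨev] with s hs1 hs2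
    refine hf s ?_ hs2
    have := hs1.2
    rwa [hsx] at this
  refine HasDerivAt.congr_of_eventuallyEq ?_ hfev.symm
  have hb' : ContDiffAt ℝ ∞ b' p := (hβ.comp p hΨ).clm_comp (hΨ.fderiv_right (m := ∞) (by simp))
  have hb'd := (hb'.differentiableAt (by simp)).hasFDerivAt
  -- Cartan's formula
  have hpair : IsContactPair (β (Ψ p)) (extDeriv₁ β (Ψ p)) := by
    rw [hΨp]
    exact hα.isContactPair_target (mem_extChartAt_target x₀)
  set u : Model n := fderiv ℝ Ψ p ((0 : ℝ), w)
  have hpe := hev.self_of_nhds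
  have hcartan : fderiv ℝ b' p ((1 : ℝ), 0) ((0 : ℝ), w) =
      extDeriv₁ β (Ψ p) (fderiv ℝ Ψ p ((1 : ℝ), 0)) u +
        fderiv ℝ b' p ((0 : ℝ), w) ((1 : ℝ), 0) := by
    have := extDeriv₁_pullback hΨ hβ ((1 : ℝ), 0) ((0 : ℝ), w)
    rw [extDeriv₁_apply] at this
    linarith
  have hΨpt : Ψ p ∈ e.target := by rw [hΨp]; exact mem_extChartAt_target x₀
  have hq : ContDiffAt ℝ ∞ (chartFun K x₀) (p.1, Ψ p) := contDiffAt_chartFun hK hΨpt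
  -- The time component of `b'` is `α` of the velocity, that is, the Hamiltonian along the flow;
  -- this is the term `d(α(X))` of Cartan's formula.
  have hcontr : fderiv ℝ b' p ((0 : ℝ), w) ((1 : ℝ), 0) =
      fderiv ℝ (chartFun K x₀) (p.1, Ψ p) ((0 : ℝ), u) := by
    have h1 : (fun q => b' q ((1 : ℝ), 0)) =ᶠ[𝓝 p] fun q => chartFun K x₀ (q.1, Ψ q) := by
      filter_upwards [hev, hΨev] with q hq1 hq2
      have h2 : Ψ q ∈ e.target := e.map_source hq1.2
      simp only [b', ContinuousLinearMap.comp_apply]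
      rw [htime q hq1.1 hq1.2 hq2]
      exact (hα.isContactPair_target h2).apply_hamVec _ _
    have h2 : HasFDerivAt (fun q => b' q ((1 : ℝ), 0))
        ((fderiv ℝ b' p).flip ((1 : ℝ), 0)) p := by
      have := hb'd.clm_apply (hasFDerivAt_const (((1 : ℝ), 0) : ℝ × Model n) p)
      simpa using this
    have h3 : HasFDerivAt (fun q : ℝ × Model n => chartFun K x₀ (q.1, Ψ q))
        ((fderiv ℝ (chartFun K x₀) (p.1, Ψ p)).comp
          ((ContinuousLinearMap.fst ℝ ℝ (Model n)).prod (fderiv ℝ Ψ p))) p :=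
      HasFDerivAt.comp (f := fun q : ℝ × Model n => (q.1, Ψ q)) p
        (hq.differentiableAt (by simp)).hasFDerivAt
        (hasFDerivAt_fst.prodMk (hΨ.differentiableAt (by simp)).hasFDerivAt)
    have h4 := h2.unique (h3.congr_of_eventuallyEq h1)
    exact congrArg (fun l : ℝ × Model n →L[ℝ] ℝ => l ((0 : ℝ), w)) h4
  have hD : HasDerivAt (fun s => b' (s, e' x) ((0 : ℝ), w))
      (fderiv ℝ b' p ((1 : ℝ), 0) ((0 : ℝ), w)) t := by
    have h3 : HasDerivAt (fun s : ℝ => (s, e' x)) ((1 : ℝ), (0 : Model n)) t :=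
      (hasDerivAt_id t).prodMk (hasDerivAt_const t (e' x))
    have h4 := HasFDerivAt.comp_hasDerivAt (f := fun s : ℝ => (s, e' x)) t hb'd h3
    simpa using h4.clm_apply (hasDerivAt_const t (((0 : ℝ), w) : ℝ × Model n))
  suffices hval : reebDeriv α K (t, x₀) * b' (t, e' x) ((0 : ℝ), w) =
      fderiv ℝ b' p ((1 : ℝ), 0) ((0 : ℝ), w) by
    rw [hval]
    exact hD
  rw [hcartan, hcontr, htime p hpe.1 hpe.2 hΨ, hα.reebDeriv_eq hK hx₀]
  -- With both terms of Cartan's formula identified, the defining equation of the contact vector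
  -- field turns their sum into `dK(R) α`.
  have h5 := hpair.omega_hamVec (K (p.1, e.symm (Ψ p)))
    (fderiv ℝ ((fun y => K (p.1, y)) ∘ e.symm) (Ψ p)) u
  have h6 := fderiv_chartFun_slice hK (q := (p.1, Ψ p)) hΨpt
  have h7 : fderiv ℝ ((fun y => K (p.1, y)) ∘ e.symm) (Ψ p) =
      (fderiv ℝ (chartFun K x₀) (p.1, Ψ p)).comp (ContinuousLinearMap.inr ℝ ℝ (Model n)) := h6
  have h8 : chartHam α (fun _ => 1) x₀ (e x₀) = reebVec (β (Ψ p)) (extDeriv₁ β (Ψ p)) := by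
    have h9 : fderiv ℝ ((fun _ : M => (1 : ℝ)) ∘ e.symm) (e x₀) = 0 := by
      change fderiv ℝ (fun _ => (1 : ℝ)) (e x₀) = 0
      simp
    rw [chartHam, h9, hΨp]
    exact IsContactPair.hamVec_one_zero
  have h9 : chartHam α (fun y => K (p.1, y)) x₀ (Ψ p) = hamVec (β (Ψ p)) (extDeriv₁ β (Ψ p))
    (K (p.1, e.symm (Ψ p))) (fderiv ℝ ((fun y => K (p.1, y)) ∘ e.symm) (Ψ p)) := rfl
  have h10 : fderiv ℝ ((fun y => K (p.1, y)) ∘ e.symm) (Ψ p) u =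
      fderiv ℝ (chartFun K x₀) (p.1, Ψ p) ((0 : ℝ), u) := by rw [h7]; simp
  rw [h9, ← h10, h5, h7]
  change fderiv ℝ (chartFun K x₀) (t, e x₀) ((0 : ℝ), chartHam α (fun _ => 1) x₀ (e x₀)) * _ = _
  rw [h8, ← hΨp]
  rfl

/-- The flow of a contact vector field consists of contactomorphisms. -/
theorem IsContactForm.isContactomorphism_flow {α : OneForm n M} (hα : IsContactForm α)
    {K : ℝ × M → ℝ} (hK : ContMDiff (𝓘(ℝ, ℝ).prod (𝓡 (2 * n + 1))) 𝓘(ℝ, ℝ) ∞ K)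
    {Φ : ℝ × M → M} (hΦ : ContMDiff (𝓘(ℝ, ℝ).prod (𝓡 (2 * n + 1))) (𝓡 (2 * n + 1)) ∞ Φ)
    (hΦ0 : ∀ x, Φ (0, x) = x)
    (hΦd : ∀ t, ∃ e : M ≃ₘ⟮𝓡 (2 * n + 1), 𝓡 (2 * n + 1)⟯ M, ⇑e = fun x => Φ (t, x))
    (hv : ∀ t x, HasVelocity (fun s => Φ (s, x)) (hamVel α K (t, Φ (t, x))) t) (t : ℝ) :
    IsContactomorphism α (fun x => Φ (t, x)) := by
  refine ⟨hΦd t, fun x => ∫ s in (0 : ℝ)..t, reebDeriv α K (s, Φ (s, x)), fun x w => ?_⟩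
  set G : ℝ → ℝ := fun s => reebDeriv α K (s, Φ (s, x))
  have hG : Continuous G := (hα.continuous_reebDeriv hK).comp
    (continuous_id.prodMk (hΦ.continuous.comp (continuous_id.prodMk continuous_const)))
  set f : ℝ → ℝ := fun s => formAt α (Φ (s, x))
    (tangentAt (fun y => Φ (s, y)) x w)
  have hf : ∀ s, HasDerivAt f (G s * f s) s := hα.hasDerivAt_formAt_flow hK hΦ hv x w
  have hI : ∀ s, HasDerivAt (fun r => ∫ s in (0 : ℝ)..r, G s) (G s) s := fun s =>
    hG.integral_hasStrictDerivAt 0 s |>.hasDerivAt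
  -- The integrating factor for `f' = G f`: the pulled back form is `exp(∫ G)` times the initial
  -- one, which is the conformal factor.
  have hc : ∀ s, HasDerivAt (fun r => f r * Real.exp (-∫ s in (0 : ℝ)..r, G s)) 0 s := fun s => by
    have h := (hf s).mul (hI s).neg.exp
    have h0 : G s * f s * Real.exp (-∫ s in (0 : ℝ)..s, G s) +
        f s * (Real.exp (-∫ s in (0 : ℝ)..s, G s) * -G s) = 0 := by ring
    exact h.congr_deriv h0
  have h1 := is_const_of_deriv_eq_zero (fun s => (hc s).differentiableAt)
    (fun s => (hc s).deriv) t 0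
  simp only [intervalIntegral.integral_same, neg_zero, Real.exp_zero, mul_one] at h1
  have hid : (fun y => Φ ((0 : ℝ), y)) = id := funext hΦ0
  have h2 : f 0 = formAt α x w := by
    have h3 : tangentAt (n := n) id x = ContinuousLinearMap.id ℝ (Model n) := mfderiv_id
    simp only [f]
    rw [hid, hΦ0, h3]
    rfl
  change f t = Real.exp (∫ s in (0 : ℝ)..t, G s) * formAt α x w
  rw [← h2, ← h1, mul_comm, mul_assoc, ← Real.exp_add]
  simp

end ContactFlow

/-! ### Local Hamiltonians of a Legendrian path in Euclidean space. -/

section LocalHamiltonian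

variable {Z E : Type} [NormedAddCommGroup Z] [NormedSpace ℝ Z]
  [NormedAddCommGroup E] [NormedSpace ℝ E]

/-- If `f` is a path of maps tangent to `ker b`, the derivative of `b (∂ₜ f)` is given by `db`. -/
theorem fderiv_apply_velocity {b : E → E →L[ℝ] ℝ} {f : ℝ × Z → E} {q : ℝ × Z}
    (hf : ContDiffAt ℝ ∞ f q) (hb : ContDiffAt ℝ ∞ b (f q))
    (htan : ∀ᶠ q' in 𝓝 q, ∀ ζ, b (f q') (fderiv ℝ f q' ((0 : ℝ), ζ)) = 0) (ζ : Z) :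
    fderiv ℝ (fun q' => b (f q') (fderiv ℝ f q' ((1 : ℝ), 0))) q ((0 : ℝ), ζ) =
      - extDeriv₁ b (f q) (fderiv ℝ f q ((1 : ℝ), 0)) (fderiv ℝ f q ((0 : ℝ), ζ)) := by
  set b' : ℝ × Z → ℝ × Z →L[ℝ] ℝ := fun q' => (b (f q')).comp (fderiv ℝ f q')
  have hb' : ContDiffAt ℝ ∞ b' q := (hb.comp q hf).clm_comp (hf.fderiv_right (m := ∞) (by simp))
  have hb'd := (hb'.differentiableAt (by simp)).hasFDerivAt
  have happ : ∀ v u : ℝ × Z, fderiv ℝ (fun q' => b' q' v) q u = fderiv ℝ b' q u v := by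
    intro v u
    have h := hb'd.clm_apply (hasFDerivAt_const v q)
    rw [h.fderiv]
    simp
  -- The spatial part of the pulled back form vanishes identically near `q`, so its time derivative
  -- does too; only the derivative of the time component survives in the exterior derivative.
  have h1 : fderiv ℝ b' q ((1 : ℝ), 0) ((0 : ℝ), ζ) = 0 := by
    rw [← happ]
    have h2 : (fun q' => b' q' ((0 : ℝ), ζ)) =ᶠ[𝓝 q] fun _ => 0 := by
      filter_upwards [htan] with q' hq' using hq' ζ
    rw [h2.fderiv_eq]
    simp
  have h3 := extDeriv₁_pullback hf hb ((1 : ℝ), 0) ((0 : ℝ), ζ)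
  rw [extDeriv₁_apply] at h3
  change fderiv ℝ b' q _ _ - fderiv ℝ b' q _ _ = _ at h3
  rw [h1, ← happ] at h3
  rw [← h3, zero_sub, neg_neg]
  rfl

variable [FiniteDimensional ℝ Z] [FiniteDimensional ℝ E]

/-- A path of immersions tangent to `ker b` has locally a Hamiltonian: a function whose 1-jet along
the path is the one determined by the velocity. -/
theorem exists_local_hamiltonian {b : E → E →L[ℝ] ℝ} {f : ℝ × Z → E} {q₀ : ℝ × Z}
    (hf : ∀ᶠ q in 𝓝 q₀, ContDiffAt ℝ ∞ f q) (hb : ∀ᶠ y in 𝓝 (f q₀), ContDiffAt ℝ ∞ b y)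
    (htan : ∀ᶠ q in 𝓝 q₀, ∀ ζ, b (f q) (fderiv ℝ f q ((0 : ℝ), ζ)) = 0)
    (himm : ∀ ζ, fderiv ℝ f q₀ ((0 : ℝ), ζ) = 0 → ζ = 0) :
    ∃ k : ℝ × E → ℝ, (∀ᶠ p in 𝓝 (q₀.1, f q₀), ContDiffAt ℝ ∞ k p) ∧
      ∀ᶠ q in 𝓝 q₀, k (q.1, f q) = b (f q) (fderiv ℝ f q ((1 : ℝ), 0)) ∧
        ∀ w, fderiv ℝ k (q.1, f q) ((0 : ℝ), w) =
          - extDeriv₁ b (f q) (fderiv ℝ f q ((1 : ℝ), 0)) w := by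
  have hcf : ContinuousAt f q₀ := hf.self_of_nhds.continuousAt
  have hG : ∀ q, ContDiffAt ℝ ∞ f q → ContDiffAt ℝ ∞ (fun q : ℝ × Z => (q.1, f q)) q :=
    fun q hq => contDiffAt_fst.prodMk hq
  have hGd : ∀ q, ContDiffAt ℝ ∞ f q → HasFDerivAt (fun q : ℝ × Z => (q.1, f q))
      ((ContinuousLinearMap.fst ℝ ℝ Z).prod (fderiv ℝ f q)) q := fun q hq =>
    hasFDerivAt_fst.prodMk (hq.differentiableAt (by simp)).hasFDerivAt
  have hinj : Function.Injective (fderiv ℝ (fun q : ℝ × Z => (q.1, f q)) q₀) := by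
    rw [(hGd q₀ hf.self_of_nhds).fderiv, injective_iff_map_eq_zero]
    rintro ⟨s, ζ⟩ h
    have h1 : s = 0 := congrArg Prod.fst h
    subst h1
    have h2 : fderiv ℝ f q₀ ((0 : ℝ), ζ) = 0 := congrArg Prod.snd h
    rw [himm ζ h2]
    rfl
  obtain ⟨g₀, hg₀s, hg₀⟩ := exists_contDiffOn_leftInverse (hf.mono hG) hinj
  -- The time component of the left inverse is replaced by the actual time, so `g` maps spatial
  -- directions to spatial directions.
  let g : ℝ × E → ℝ × Z := fun p => (p.1, (g₀ p).2)
  have hgs : ∀ᶠ p in 𝓝 (q₀.1, f q₀), ContDiffAt ℝ ∞ g p :=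
    hg₀s.mono fun p hp => contDiffAt_fst.prodMk (contDiffAt_snd.comp p hp)
  have hg : ∀ᶠ q in 𝓝 q₀, g (q.1, f q) = q :=
    hg₀.mono fun q hq => Prod.ext rfl (by have h := congrArg Prod.snd hq; exact h)
  let h : ℝ × Z → ℝ := fun q => b (f q) (fderiv ℝ f q ((1 : ℝ), 0))
  let η : ℝ × Z → E →L[ℝ] ℝ := fun q => - extDeriv₁ b (f q) (fderiv ℝ f q ((1 : ℝ), 0))
  have hgood : ∀ᶠ q in 𝓝 q₀, ContDiffAt ℝ ∞ f q ∧ ContDiffAt ℝ ∞ b (f q) :=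
    hf.and (hcf.eventually hb)
  have hvel : ∀ q, ContDiffAt ℝ ∞ f q →
      ContDiffAt ℝ ∞ (fun q => fderiv ℝ f q ((1 : ℝ), (0 : Z))) q := fun q hq =>
    (hq.fderiv_right (m := ∞) (by simp)).clm_apply contDiffAt_const
  have hhs : ∀ q, ContDiffAt ℝ ∞ f q → ContDiffAt ℝ ∞ b (f q) → ContDiffAt ℝ ∞ h q :=
    fun q hq1 hq2 => (hq2.comp q hq1).clm_apply (hvel q hq1)
  have hηs : ∀ q, ContDiffAt ℝ ∞ f q → ContDiffAt ℝ ∞ b (f q) → ContDiffAt ℝ ∞ η q :=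
    fun q hq1 hq2 => (((contDiffAt_extDeriv₁ hq2).comp q hq1).clm_apply (hvel q hq1)).neg
  -- The first-order Taylor formula about the path: value `h` and differential `η` at the nearest
  -- parameter `g p`. The two prescriptions are compatible along the path, since `dh = η ∘ df` in
  -- spatial directions by `fderiv_apply_velocity`.
  let k : ℝ × E → ℝ := fun p => h (g p) + η (g p) (p.2 - f (g p))
  have hg0 : g (q₀.1, f q₀) = q₀ := hg.self_of_nhds
  have hks : ∀ p, ContDiffAt ℝ ∞ g p → ContDiffAt ℝ ∞ f (g p) → ContDiffAt ℝ ∞ b (f (g p)) →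
      ContDiffAt ℝ ∞ k p := fun p hp1 hp2 hp3 =>
    ((hhs _ hp2 hp3).comp p hp1).add (((hηs _ hp2 hp3).comp p hp1).clm_apply
      (contDiffAt_snd.sub (hp2.comp p hp1)))
  have hcG : Filter.Tendsto (fun q : ℝ × Z => (q.1, f q)) (𝓝 q₀) (𝓝 (q₀.1, f q₀)) :=
    (hG q₀ hf.self_of_nhds).continuousAt
  refine ⟨k, ?_, ?_⟩
  · have hgc : Filter.Tendsto g (𝓝 (q₀.1, f q₀)) (𝓝 q₀) := by
      have := hgs.self_of_nhds.continuousAt.tendsto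
      rwa [hg0] at this
    filter_upwards [hgs, hgc.eventually hgood] with p hp1 hp2 using hks p hp1 hp2.1 hp2.2
  · filter_upwards [hg, hgood, hcG.eventually hgs, htan.eventually_nhds]
      with q hq1 hq2 hq3 hq4
    refine ⟨by simp [k, hq1, h], fun w => ?_⟩
    set p : ℝ × E := (q.1, f q)
    have hgd : HasFDerivAt g (fderiv ℝ g p) p := (hq3.differentiableAt (by simp)).hasFDerivAt
    have hg1 : (fderiv ℝ g p ((0 : ℝ), w)).1 = 0 := by
      have h1 : HasFDerivAt (fun p => (g p).1)
        ((ContinuousLinearMap.fst ℝ ℝ Z).comp (fderiv ℝ g p)) p := hasFDerivAt_fst.comp p hgd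
      have h2 : HasFDerivAt (fun p => (g p).1) (ContinuousLinearMap.fst ℝ ℝ E) p :=
        hasFDerivAt_fst
      exact congrArg (fun l : ℝ × E →L[ℝ] ℝ => l ((0 : ℝ), w)) (h1.unique h2)
    set ζ := (fderiv ℝ g p ((0 : ℝ), w)).2
    have hζ : fderiv ℝ g p ((0 : ℝ), w) = ((0 : ℝ), ζ) := Prod.ext hg1 rfl
    have hd1 : HasFDerivAt h (fderiv ℝ h q) (g p) := by
      rw [hq1]
      exact ((hhs q hq2.1 hq2.2).differentiableAt (by simp)).hasFDerivAt
    have hd2 : HasFDerivAt η (fderiv ℝ η q) (g p) := by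
      rw [hq1]
      exact ((hηs q hq2.1 hq2.2).differentiableAt (by simp)).hasFDerivAt
    have hd3 : HasFDerivAt f (fderiv ℝ f q) (g p) := by
      rw [hq1]
      exact (hq2.1.differentiableAt (by simp)).hasFDerivAt
    have hd4 : HasFDerivAt k _ p := (hd1.comp p hgd).add
      ((hd2.comp p hgd).clm_apply (hasFDerivAt_snd.sub (hd3.comp p hgd)))
    rw [hd4.fderiv]
    have h5 := fderiv_apply_velocity hq2.1 hq2.2 hq4 ζ
    have h6 : p.2 - f q = 0 := sub_self _
    have h7 : fderiv ℝ h q ((0 : ℝ), ζ) = η q (fderiv ℝ f q ((0 : ℝ), ζ)) := h5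
    simp [hζ, h6, h7, hq1, η]

end LocalHamiltonian

/-! ### Extension of germs of smooth functions. -/

section Cutoff

variable {E H N : Type*} [NormedAddCommGroup E] [NormedSpace ℝ E] [FiniteDimensional ℝ E]
  [TopologicalSpace H] {I : ModelWithCorners ℝ E H} [TopologicalSpace N] [ChartedSpace H N]
  [IsManifold I ∞ N] [T2Space N] [NormalSpace N] [SigmaCompactSpace N]

/-- A smooth function on an open set agrees near a given point with a global smooth function. -/
theorem exists_contMDiff_eventuallyEq {g : N → ℝ} {W : Set N} (hW : IsOpen W) {p : N}
    (hp : p ∈ W) (hg : ∀ q ∈ W, ContMDiffAt I 𝓘(ℝ, ℝ) ∞ g q) :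
    ∃ K : N → ℝ, ContMDiff I 𝓘(ℝ, ℝ) ∞ K ∧ K =ᶠ[𝓝 p] g := by
  obtain ⟨χ, hχ0, hχ1, -⟩ := exists_contMDiffMap_zero_one_nhds_of_isClosed (n := ⊤) I
    hW.isClosed_compl (isClosed_singleton (x := p))
    (by rw [disjoint_singleton_right]; exact fun h => h hp)
  rw [nhdsSet_singleton] at hχ1
  refine ⟨fun q => χ q * g q, fun q => ?_, ?_⟩
  · by_cases hq : q ∈ W
    · exact (χ.contMDiff q).mul (hg q hq)
    · have h0 : (fun q => χ q * g q) =ᶠ[𝓝 q] fun _ => 0 := by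
        filter_upwards [Filter.Eventually.filter_mono (nhds_le_nhdsSet (s := Wᶜ) hq) hχ0] with z hz
        rw [hz, zero_mul]
      exact contMDiffAt_const.congr_of_eventuallyEq h0
  · filter_upwards [hχ1] with q hq
    rw [hq, one_mul]

end Cutoff

/-! ### Jets of Hamiltonians generating a path. -/

section Jets

variable {n : ℕ} {M : Type*} [TopologicalSpace M] [ChartedSpace (Model n) M]
  {L : Type*}

/-- The velocity of a path of maps. -/
def curveVel (f : ℝ × L → M) (q : ℝ × L) : Model n :=
  (mfderiv 𝓘(ℝ, ℝ) (𝓡 (2 * n + 1)) (fun s => f (s, q.2)) q.1 : ℝ →L[ℝ] Model n) 1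

/-- The 1-jet of `K` at a point of the path `f` is the one of a Hamiltonian generating `f`. -/
def IsHamiltonianJet (α : OneForm n M) (f : ℝ × L → M) (K : ℝ × M → ℝ) (q : ℝ × L) : Prop :=
  K (q.1, f q) = formAt α (f q) (curveVel f q) ∧
    ∀ w, diffAt (fun y => K (q.1, y)) (f q) w = - extDAt α (f q) (curveVel f q) w

/-- The velocity satisfies the equations that characterize the Hamiltonian vector, with conformal
factor `g = 0`: the prescribed differential kills the Reeb direction. -/
theorem IsHamiltonianJet.hamVel_eq [IsManifold (𝓡 (2 * n + 1)) ∞ M] {α : OneForm n M} (hα : IsContactForm α) {f : ℝ × L → M}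
    {K : ℝ × M → ℝ} {q : ℝ × L} (h : IsHamiltonianJet α f K q) :
    hamVel α K (q.1, f q) = curveVel f q :=
  ((hα.isContactPair (f q)).eq_hamVec (g := 0) h.1.symm fun w => by
    rw [h.2 w, add_neg_cancel, zero_mul]).symm

theorem IsHamiltonianJet.congr {α : OneForm n M} {f : ℝ × L → M} {K K' : ℝ × M → ℝ} {q : ℝ × L}
    (h : IsHamiltonianJet α f K q) (hK : K' =ᶠ[𝓝 (q.1, f q)] K) : IsHamiltonianJet α f K' q := by
  have h1 : (fun y => K' (q.1, y)) =ᶠ[𝓝 (f q)] fun y => K (q.1, y) :=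
    (continuous_const.prodMk continuous_id).continuousAt.eventually hK
  have h2 : diffAt (n := n) (fun y => K' (q.1, y)) (f q) = diffAt (fun y => K (q.1, y)) (f q) :=
    h1.mfderiv_eq
  refine ⟨hK.self_of_nhds.trans h.1, ?_⟩
  rw [h2]
  exact h.2

/-- At a point where both functions have the prescribed jet, `K - K'` vanishes to first order in
space, so its product with any `χ` does too. This is what allows patching by cutoffs. -/
theorem IsHamiltonianJet.interpolate {α : OneForm n M} {f : ℝ × L → M} {K K' χ : ℝ × M → ℝ}
    {q : ℝ × L} (hK : ContMDiff (𝓘(ℝ, ℝ).prod (𝓡 (2 * n + 1))) 𝓘(ℝ, ℝ) ∞ K)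
    (hK' : ContMDiff (𝓘(ℝ, ℝ).prod (𝓡 (2 * n + 1))) 𝓘(ℝ, ℝ) ∞ K')
    (hχ : ContMDiff (𝓘(ℝ, ℝ).prod (𝓡 (2 * n + 1))) 𝓘(ℝ, ℝ) ∞ χ)
    (h : IsHamiltonianJet α f K q) (h' : IsHamiltonianJet α f K' q) :
    IsHamiltonianJet α f (fun p => K' p + χ p * (K p - K' p)) q := by
  have hv : K (q.1, f q) = K' (q.1, f q) := h.1.trans h'.1.symm
  refine ⟨by simp only [hv, sub_self, mul_zero, add_zero, h'.1], fun w => ?_⟩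
  have d : ∀ {K : ℝ × M → ℝ}, ContMDiff (𝓘(ℝ, ℝ).prod (𝓡 (2 * n + 1))) 𝓘(ℝ, ℝ) ∞ K →
      HasMFDerivAt (𝓡 (2 * n + 1)) 𝓘(ℝ, ℝ) (fun y => K (q.1, y)) (f q)
        (diffAt (fun y => K (q.1, y)) (f q)) := fun hK =>
    (mdifferentiableAt_slice hK q.1 (f q)).hasMFDerivAt
  have h1 := (d hK').add ((d hχ).mul ((d hK).sub (d hK')))
  have h2 : diffAt (n := n) (fun y => K' (q.1, y) + χ (q.1, y) * (K (q.1, y) - K' (q.1, y))) (f q)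
      = diffAt (fun y => K' (q.1, y)) (f q) +
        (χ (q.1, f q) • (diffAt (fun y => K (q.1, y)) (f q) - diffAt (fun y => K' (q.1, y)) (f q)) +
        (K (q.1, f q) - K' (q.1, f q)) • diffAt (fun y => χ (q.1, y)) (f q)) := h1.mfderiv
  rw [h2]
  have h3 : diffAt (fun y => K (q.1, y)) (f q) w = diffAt (fun y => K' (q.1, y)) (f q) w :=
    (h.2 w).trans (h'.2 w).symm
  simp [hv, h3, h'.2 w]

theorem hasVelocity_curveVel [TopologicalSpace L] [ChartedSpace (EuclideanSpace ℝ (Fin n)) L]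
    {f : ℝ × L → M}
    (hf : ContMDiff (𝓘(ℝ, ℝ).prod (𝓡 n)) (𝓡 (2 * n + 1)) ∞ f) (q : ℝ × L) :
    HasVelocity (n := n) (fun s => f (s, q.2)) (curveVel f q) q.1 := by
  have h : ContMDiff 𝓘(ℝ, ℝ) (𝓡 (2 * n + 1)) ∞ (fun s => f (s, q.2)) :=
    hf.comp (contMDiff_id.prodMk contMDiff_const)
  refine ((h.mdifferentiableAt (by simp)).hasMFDerivAt).congr_mfderiv ?_
  have h2 : ∀ l : ℝ →L[ℝ] Model n, l = (1 : ℝ →L[ℝ] ℝ).smulRight (l 1) := fun l =>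
    ContinuousLinearMap.ext_ring (by simp)
  exact h2 _

end Jets

/-! ### Paths of maps `L → M` in charts: time and space derivatives. -/

section PathInCharts

variable {n : ℕ} {M : Type*} [TopologicalSpace M] [ChartedSpace (Model n) M]
  {L : Type*} [TopologicalSpace L] [ChartedSpace (EuclideanSpace ℝ (Fin n)) L]

/-- A path of maps in charts of the source and the target. -/
def chartPath (f : ℝ × L → M) (y₀ : M) (x₀ : L) (q : ℝ × EuclideanSpace ℝ (Fin n)) : Model n :=
  extChartAt (𝓡 (2 * n + 1)) y₀ (f (q.1, (extChartAt (𝓡 n) x₀).symm q.2))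

theorem eventually_chartPath_domain {f : ℝ × L → M} (hf : Continuous f) {y₀ : M} {x₀ : L}
    {q : ℝ × EuclideanSpace ℝ (Fin n)} (hq : q.2 ∈ (extChartAt (𝓡 n) x₀).target)
    (hfq : f (q.1, (extChartAt (𝓡 n) x₀).symm q.2) ∈ (extChartAt (𝓡 (2 * n + 1)) y₀).source) :
    ∀ᶠ q' : ℝ × EuclideanSpace ℝ (Fin n) in 𝓝 q, q'.2 ∈ (extChartAt (𝓡 n) x₀).target ∧
      f (q'.1, (extChartAt (𝓡 n) x₀).symm q'.2) ∈ (extChartAt (𝓡 (2 * n + 1)) y₀).source := by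
  have hto := (isOpen_extChartAt_target (I := 𝓡 n) x₀).mem_nhds hq
  refine (continuousAt_snd.eventually hto).and ?_
  have h1 : ContinuousAt (fun q : ℝ × EuclideanSpace ℝ (Fin n) =>
      f (q.1, (extChartAt (𝓡 n) x₀).symm q.2)) q := by
    refine hf.continuousAt.comp (f := fun q : ℝ × EuclideanSpace ℝ (Fin n) =>
      (q.1, (extChartAt (𝓡 n) x₀).symm q.2)) (continuousAt_fst.prodMk ?_)
    exact ((continuousOn_extChartAt_symm x₀).continuousAt hto).comp continuousAt_snd
  exact h1.eventually_mem ((isOpen_extChartAt_source y₀).mem_nhds hfq)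

variable [IsManifold (𝓡 (2 * n + 1)) ∞ M] [IsManifold (𝓡 n) ∞ L]

theorem contDiffAt_chartPath {f : ℝ × L → M}
    (hf : ContMDiff (𝓘(ℝ, ℝ).prod (𝓡 n)) (𝓡 (2 * n + 1)) ∞ f) {y₀ : M} {x₀ : L}
    {q : ℝ × EuclideanSpace ℝ (Fin n)} (hq : q.2 ∈ (extChartAt (𝓡 n) x₀).target)
    (hfq : f (q.1, (extChartAt (𝓡 n) x₀).symm q.2) ∈ (extChartAt (𝓡 (2 * n + 1)) y₀).source) :
    ContDiffAt ℝ ∞ (chartPath f y₀ x₀) q := by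
  refine contMDiffAt_iff_contDiffAt.mp ?_
  have hin : ContMDiffAt 𝓘(ℝ, ℝ × EuclideanSpace ℝ (Fin n)) (𝓡 (2 * n + 1)) ∞
      (fun q : ℝ × EuclideanSpace ℝ (Fin n) => f (q.1, (extChartAt (𝓡 n) x₀).symm q.2)) q := by
    refine ContMDiffAt.comp (I' := 𝓘(ℝ, ℝ).prod (𝓡 n)) q (hf _) ?_
    have h1 : ContMDiffAt 𝓘(ℝ, ℝ × EuclideanSpace ℝ (Fin n)) 𝓘(ℝ, ℝ) ∞
        (fun q : ℝ × EuclideanSpace ℝ (Fin n) => q.1) q := contDiffAt_fst.contMDiffAt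
    have h2 : ContMDiffAt 𝓘(ℝ, ℝ × EuclideanSpace ℝ (Fin n)) 𝓘(ℝ, EuclideanSpace ℝ (Fin n)) ∞
        (fun q : ℝ × EuclideanSpace ℝ (Fin n) => q.2) q := contDiffAt_snd.contMDiffAt
    exact h1.prodMk (((contMDiffOn_extChartAt_symm x₀).contMDiffAt
      ((isOpen_extChartAt_target x₀).mem_nhds hq)).comp q h2)
  exact ContMDiffAt.comp q
    (contMDiffAt_extChartAt' (by rwa [← extChartAt_source (𝓡 (2 * n + 1)) y₀])) hin

theorem fderiv_chartPath_time {f : ℝ × L → M}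
    (hf : ContMDiff (𝓘(ℝ, ℝ).prod (𝓡 n)) (𝓡 (2 * n + 1)) ∞ f) {y₀ : M} {x₀ : L}
    {q : ℝ × EuclideanSpace ℝ (Fin n)} (hq : q.2 ∈ (extChartAt (𝓡 n) x₀).target)
    (hfq : f (q.1, (extChartAt (𝓡 n) x₀).symm q.2) ∈ (extChartAt (𝓡 (2 * n + 1)) y₀).source) :
    fderiv ℝ (chartPath f y₀ x₀) q ((1 : ℝ), 0) =
      chartDeriv y₀ (f (q.1, (extChartAt (𝓡 n) x₀).symm q.2))
        (curveVel f (q.1, (extChartAt (𝓡 n) x₀).symm q.2)) := by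
  have h1 := (hasVelocity_curveVel hf (q.1, (extChartAt (𝓡 n) x₀).symm q.2)).hasDerivAt_chart hfq
  have h3 : HasDerivAt (fun s : ℝ => (s, q.2)) ((1 : ℝ), (0 : EuclideanSpace ℝ (Fin n))) q.1 :=
    (hasDerivAt_id q.1).prodMk (hasDerivAt_const q.1 q.2)
  have h2 := HasFDerivAt.comp_hasDerivAt (f := fun s : ℝ => (s, q.2)) q.1
    ((contDiffAt_chartPath hf hq hfq).differentiableAt (by simp)).hasFDerivAt h3
  exact h2.unique h1

/-- The derivative of a map from `L` to `M`, on the model spaces. -/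
def sourceDeriv (f : L → M) (x : L) : EuclideanSpace ℝ (Fin n) →L[ℝ] Model n :=
  mfderiv (𝓡 n) (𝓡 (2 * n + 1)) f x

/-- The derivative of the inverse of the preferred chart at `x₀` of the source. -/
def sourceSymmDeriv (x₀ : L) (z : EuclideanSpace ℝ (Fin n)) :
    EuclideanSpace ℝ (Fin n) →L[ℝ] EuclideanSpace ℝ (Fin n) :=
  mfderiv 𝓘(ℝ, EuclideanSpace ℝ (Fin n)) (𝓡 n) (extChartAt (𝓡 n) x₀).symm z

theorem sourceSymmDeriv_self (x : L) (v : EuclideanSpace ℝ (Fin n)) :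
    sourceSymmDeriv x (extChartAt (𝓡 n) x x) v = v := by
  have : IsManifold (𝓡 n) 1 L := IsManifold.of_le (n := ∞) (by exact_mod_cast le_top)
  have h := mfderivWithin_range_extChartAt_symm (I := 𝓡 n) (x := x)
  rw [ModelWithCorners.range_eq_univ, mfderivWithin_univ] at h
  exact congrArg (fun l : EuclideanSpace ℝ (Fin n) →L[ℝ] EuclideanSpace ℝ (Fin n) => l v) h

theorem fderiv_chartPath_space {f : ℝ × L → M}
    (hf : ContMDiff (𝓘(ℝ, ℝ).prod (𝓡 n)) (𝓡 (2 * n + 1)) ∞ f) {y₀ : M} {x₀ : L}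
    {q : ℝ × EuclideanSpace ℝ (Fin n)} (hq : q.2 ∈ (extChartAt (𝓡 n) x₀).target)
    (hfq : f (q.1, (extChartAt (𝓡 n) x₀).symm q.2) ∈ (extChartAt (𝓡 (2 * n + 1)) y₀).source)
    (ζ : EuclideanSpace ℝ (Fin n)) :
    fderiv ℝ (chartPath f y₀ x₀) q ((0 : ℝ), ζ) =
      chartDeriv y₀ (f (q.1, (extChartAt (𝓡 n) x₀).symm q.2))
        (sourceDeriv (fun x => f (q.1, x)) ((extChartAt (𝓡 n) x₀).symm q.2)
          (sourceSymmDeriv x₀ q.2 ζ)) := by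
  have hsm : ContMDiff (𝓡 n) (𝓡 (2 * n + 1)) ∞ (fun y => f (q.1, y)) :=
    hf.comp (contMDiff_const.prodMk contMDiff_id)
  set c := extChartAt (𝓡 n) x₀
  have h1 : HasMFDerivAt 𝓘(ℝ, EuclideanSpace ℝ (Fin n)) (𝓡 n) c.symm q.2
      (sourceSymmDeriv x₀ q.2) :=
    (((contMDiffOn_extChartAt_symm (n := ∞) x₀).contMDiffAt
      ((isOpen_extChartAt_target x₀).mem_nhds hq)).mdifferentiableAt (by simp)).hasMFDerivAt
  have h2 : HasMFDerivAt (𝓡 n) (𝓡 (2 * n + 1)) (fun y => f (q.1, y)) (c.symm q.2)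
      (sourceDeriv (fun y => f (q.1, y)) (c.symm q.2)) :=
    (hsm.mdifferentiableAt (by simp)).hasMFDerivAt
  have h3 : HasMFDerivAt (𝓡 (2 * n + 1)) 𝓘(ℝ, Model n) (extChartAt (𝓡 (2 * n + 1)) y₀)
      (f (q.1, c.symm q.2)) (chartDeriv y₀ (f (q.1, c.symm q.2))) :=
    (mdifferentiableAt_extChartAt' hfq).hasMFDerivAt
  have h4 : HasMFDerivAt 𝓘(ℝ, EuclideanSpace ℝ (Fin n)) (𝓡 (2 * n + 1))
      (fun z => f (q.1, c.symm z)) q.2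
      ((sourceDeriv (fun y => f (q.1, y)) (c.symm q.2)).comp (sourceSymmDeriv x₀ q.2)) :=
    HasMFDerivAt.comp (g := fun y => f (q.1, y)) (f := c.symm) q.2 h2 h1
  have h5 : HasFDerivAt (fun z => chartPath f y₀ x₀ (q.1, z))
      ((chartDeriv y₀ (f (q.1, c.symm q.2))).comp
        ((sourceDeriv (fun y => f (q.1, y)) (c.symm q.2)).comp (sourceSymmDeriv x₀ q.2))) q.2 :=
    hasMFDerivAt_iff_hasFDerivAt.mp
      (HasMFDerivAt.comp (f := fun z => f (q.1, c.symm z)) q.2 h3 h4)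
  have h6 : HasFDerivAt (fun z => chartPath f y₀ x₀ (q.1, z))
      ((fderiv ℝ (chartPath f y₀ x₀) q).comp
        (ContinuousLinearMap.inr ℝ ℝ (EuclideanSpace ℝ (Fin n)))) q.2 :=
    HasFDerivAt.comp (f := fun z => (q.1, z)) q.2
      ((contDiffAt_chartPath hf hq hfq).differentiableAt (by simp)).hasFDerivAt
      (hasFDerivAt_prodMk_right q.1 q.2)
  have h7 := congrArg (fun l : EuclideanSpace ℝ (Fin n) →L[ℝ] Model n => l ζ) (h6.unique h5)
  simpa using h7

theorem chartDeriv_injective {x₀ x : M} (hx : x ∈ (extChartAt (𝓡 (2 * n + 1)) x₀).source) :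
    Function.Injective (chartDeriv (n := n) x₀ x) :=
  Function.LeftInverse.injective (chartSymmDeriv_chartDeriv hx)

end PathInCharts

/-! ### Hamiltonians near a point of a Legendrian path. -/

section HamiltonianOfPath

/-- The graph of a path of embeddings of a compact space is an embedding, locally in time. -/
theorem eventually_of_graph {M L : Type*} [TopologicalSpace M] [T2Space M]
    [TopologicalSpace L] [CompactSpace L] {f : ℝ × L → M} (hf : Continuous f)
    (hinj : ∀ t, Function.Injective fun x => f (t, x)) {q₀ : ℝ × L} {P : ℝ × L → Prop}
    (hP : ∀ᶠ q in 𝓝 q₀, P q) :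
    ∃ U : Set (ℝ × M), IsOpen U ∧ (q₀.1, f q₀) ∈ U ∧ ∀ q, (q.1, f q) ∈ U → P q := by
  obtain ⟨W, hWP, hW, hqW⟩ := eventually_nhds_iff.mp hP
  -- The graph of the bad parameters at times close to `q₀.1` is compact, hence closed. It misses
  -- the graph point of `q₀` by injectivity of the map at that time; `U` is the complement over a
  -- time window.
  set C : Set (ℝ × L) := (Icc (q₀.1 - 1) (q₀.1 + 1) ×ˢ univ) \ W
  have hC : IsCompact C := (isCompact_Icc.prod isCompact_univ).diff hW
  have hG : Continuous fun q : ℝ × L => (q.1, f q) := continuous_fst.prodMk hf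
  have hCi := (hC.image hG).isClosed
  refine ⟨Ioo (q₀.1 - 1) (q₀.1 + 1) ×ˢ univ ∩ ((fun q : ℝ × L => (q.1, f q)) '' C)ᶜ,
    (isOpen_Ioo.prod isOpen_univ).inter hCi.isOpen_compl, ⟨⟨by simp, trivial⟩, ?_⟩, ?_⟩
  · rintro ⟨q, ⟨-, hq⟩, h⟩
    obtain ⟨h1, h2⟩ := Prod.mk.inj h
    obtain ⟨t, x⟩ := q
    obtain ⟨t₀, x₀⟩ := q₀
    simp only at h1
    subst h1
    rw [hinj t h2] at hq
    exact hq hqW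
  · rintro q ⟨⟨h1, -⟩, h2⟩
    refine hWP q ?_
    by_contra hq
    exact h2 ⟨q, ⟨⟨Ioo_subset_Icc_self h1, trivial⟩, hq⟩, rfl⟩

variable {n : ℕ} {M : Type*} [TopologicalSpace M] [T2Space M] [SecondCountableTopology M]
  [ChartedSpace (Model n) M] [IsManifold (𝓡 (2 * n + 1)) ∞ M]
  {L : Type*} [TopologicalSpace L] [CompactSpace L]
  [ChartedSpace (EuclideanSpace ℝ (Fin n)) L] [IsManifold (𝓡 n) ∞ L]

/-- A path of Legendrian embeddings is generated, near each of its points, by a Hamiltonian. -/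
theorem IsContactForm.exists_hamiltonian_near {α : OneForm n M} (hα : IsContactForm α)
    {f : ℝ × L → M} (hf : ContMDiff (𝓘(ℝ, ℝ).prod (𝓡 n)) (𝓡 (2 * n + 1)) ∞ f)
    (hleg : ∀ t, IsLegendrianEmbedding α fun x => f (t, x)) (q₀ : ℝ × L) :
    ∃ (U : Set (ℝ × M)) (K : ℝ × M → ℝ), IsOpen U ∧ (q₀.1, f q₀) ∈ U ∧
      ContMDiff (𝓘(ℝ, ℝ).prod (𝓡 (2 * n + 1))) 𝓘(ℝ, ℝ) ∞ K ∧
      ∀ q, (q.1, f q) ∈ U → IsHamiltonianJet α f K q := by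
  have : LocallyCompactSpace M := ChartedSpace.locallyCompactSpace (Model n) M
  obtain ⟨t₀, x₀⟩ := q₀
  set y₀ := f (t₀, x₀)
  set e := extChartAt (𝓡 (2 * n + 1)) y₀
  set c := extChartAt (𝓡 n) x₀
  set β := localForm α y₀
  set q₀ : ℝ × EuclideanSpace ℝ (Fin n) := (t₀, c x₀)
  have hcx : c.symm (c x₀) = x₀ := c.left_inv (mem_extChartAt_source x₀)
  have hq₀ : q₀.2 ∈ c.target := c.map_source (mem_extChartAt_source x₀)
  have hfq₀ : f (q₀.1, c.symm q₀.2) ∈ e.source := by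
    simp only [q₀, hcx]
    exact mem_extChartAt_source y₀
  have hfe : chartPath f y₀ x₀ q₀ = e y₀ := by
    simp only [chartPath, q₀, c, (extChartAt (𝓡 n) x₀).left_inv (mem_extChartAt_source x₀)]
    rfl
  have hdom := eventually_chartPath_domain hf.continuous hq₀ hfq₀
  have hβ : ∀ᶠ y in 𝓝 (chartPath f y₀ x₀ q₀), ContDiffAt ℝ ∞ β y := by
    rw [hfe]
    filter_upwards [(isOpen_extChartAt_target y₀).mem_nhds (mem_extChartAt_target y₀)] with y hy
      using hα.contDiffAt_localForm hy
  have htan : ∀ᶠ q in 𝓝 q₀, ∀ ζ, β (chartPath f y₀ x₀ q)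
      (fderiv ℝ (chartPath f y₀ x₀) q ((0 : ℝ), ζ)) = 0 := by
    filter_upwards [hdom] with q hq ζ
    rw [fderiv_chartPath_space hf hq.1 hq.2]
    exact (formAt_eq_localForm α hq.2 _).symm.trans ((hleg q.1).tangent _ _)
  have himm : ∀ ζ, fderiv ℝ (chartPath f y₀ x₀) q₀ ((0 : ℝ), ζ) = 0 → ζ = 0 := by
    intro ζ h
    rw [fderiv_chartPath_space hf hq₀ hfq₀, ← map_zero (chartDeriv y₀ _)] at h
    have h1 := chartDeriv_injective hfq₀ h
    have h2 : sourceSymmDeriv x₀ q₀.2 ζ = ζ := sourceSymmDeriv_self x₀ ζ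
    rw [h2] at h1
    have h3 : Function.Injective (sourceDeriv (fun x => f (q₀.1, x)) (c.symm q₀.2)) :=
      (hleg q₀.1).immersion _
    exact h3 (h1.trans (map_zero _).symm)
  obtain ⟨k, hk, hkj⟩ := exists_local_hamiltonian
    (hdom.mono fun q hq => contDiffAt_chartPath hf hq.1 hq.2) hβ htan himm
  rw [hfe] at hk
  -- the Hamiltonian on the manifold
  obtain ⟨W₀, hW₀k, hW₀, hpW₀⟩ := eventually_nhds_iff.mp hk
  have hec : ContinuousOn (fun p : ℝ × M => (p.1, e p.2)) (univ ×ˢ e.source) :=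
    continuousOn_fst.prodMk ((continuousOn_extChartAt y₀).comp continuousOn_snd fun p hp => hp.2)
  set W : Set (ℝ × M) := (univ ×ˢ e.source) ∩ (fun p : ℝ × M => (p.1, e p.2)) ⁻¹' W₀
  have hW : IsOpen W :=
    hec.isOpen_inter_preimage (isOpen_univ.prod (isOpen_extChartAt_source y₀)) hW₀
  have hpW : (t₀, y₀) ∈ W := ⟨⟨trivial, mem_extChartAt_source y₀⟩, hpW₀⟩
  obtain ⟨K, hK, hKk⟩ := exists_contMDiff_eventuallyEq (I := 𝓘(ℝ, ℝ).prod (𝓡 (2 * n + 1)))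
    (g := fun p : ℝ × M => k (p.1, e p.2)) hW hpW fun p hp => by
      have h1 : ContMDiffAt (𝓘(ℝ, ℝ).prod (𝓡 (2 * n + 1))) 𝓘(ℝ, ℝ × Model n) ∞
          (fun p : ℝ × M => (p.1, e p.2)) p :=
        contMDiffAt_fst.prodMk_space (ContMDiffAt.comp p (contMDiffAt_extChartAt'
          (by rw [← extChartAt_source (𝓡 (2 * n + 1)) y₀]; exact hp.1.2)) contMDiffAt_snd)
      exact ContMDiffAt.comp p (hW₀k _ hp.2).contMDiffAt h1
  have hgc : ContinuousAt (fun q : ℝ × L => (q.1, f q)) (t₀, x₀) :=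
    (continuous_fst.prodMk hf.continuous).continuousAt
  have hcc : ContinuousAt (fun q : ℝ × L => (q.1, c q.2)) (t₀, x₀) :=
    continuousAt_fst.prodMk
      (ContinuousAt.comp (f := Prod.snd) (x := (t₀, x₀)) (continuousAt_extChartAt x₀)
        continuousAt_snd)
  have hx₀ : ∀ᶠ q : ℝ × L in 𝓝 (t₀, x₀), q.2 ∈ c.source :=
    continuousAt_snd.eventually ((isOpen_extChartAt_source x₀).mem_nhds (mem_extChartAt_source x₀))
  have hgood : ∀ᶠ q : ℝ × L in 𝓝 (t₀, x₀), IsHamiltonianJet α f K q := by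
    filter_upwards [hgc.eventually hKk.eventually_nhds, hcc.eventually hdom, hcc.eventually hkj,
      hx₀, hgc.eventually (hW.mem_nhds hpW)] with q hq1 hq2 hq3 hq4 hq5
    have hqc : c.symm (c q.2) = q.2 := c.left_inv hq4
    have hfq : f q ∈ e.source := hq5.1.2
    have hcp : chartPath f y₀ x₀ (q.1, c q.2) = e (f q) := by
      change e (f (q.1, c.symm (c q.2))) = _
      rw [hqc]
    have hvt := fderiv_chartPath_time (q := (q.1, c q.2)) hf hq2.1 hq2.2
    change _ = chartDeriv y₀ (f (q.1, c.symm (c q.2))) (curveVel f (q.1, c.symm (c q.2))) at hvt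
    rw [hqc] at hvt
    change _ = chartDeriv y₀ (f q) (curveVel f q) at hvt
    rw [hcp, hvt] at hq3
    refine IsHamiltonianJet.congr ⟨?_, fun w => ?_⟩ hq1
    · exact hq3.1.trans (formAt_eq_localForm α hfq _).symm
    · have h1 : HasMFDerivAt (𝓡 (2 * n + 1)) 𝓘(ℝ, Model n) e (f q) (chartDeriv y₀ (f q)) :=
        (mdifferentiableAt_extChartAt' hfq).hasMFDerivAt
      have h2 : HasFDerivAt (fun y => k (q.1, y)) ((fderiv ℝ k (q.1, e (f q))).comp
          (ContinuousLinearMap.inr ℝ ℝ (Model n))) (e (f q)) :=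
        HasFDerivAt.comp (f := fun z => (q.1, z)) (e (f q))
          ((hW₀k _ hq5.2).differentiableAt (by simp)).hasFDerivAt
          (hasFDerivAt_prodMk_right q.1 (e (f q)))
      have h3 : diffAt (fun y => k (q.1, e y)) (f q) = ((fderiv ℝ k (q.1, e (f q))).comp
          (ContinuousLinearMap.inr ℝ ℝ (Model n))).comp (chartDeriv y₀ (f q)) :=
        (HasMFDerivAt.comp (g := fun y => k (q.1, y)) (f q) h2.hasMFDerivAt h1).mfderiv
      rw [h3, hα.extDAt_eq hfq]
      exact hq3.2 _
  -- The jet condition, known for parameters near `(t₀, x₀)`, is transferred to all parameters whose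
  -- graph point lies in a neighbourhood. Patching happens on `ℝ × M`, so it needs this form.
  obtain ⟨U, hU, hqU, hUj⟩ := eventually_of_graph hf.continuous
    (fun t => (hleg t).isEmbedding.injective) hgood
  exact ⟨U, K, hU, hqU, hK, hUj⟩

end HamiltonianOfPath

/-! ### Stationary parts of a path. -/

section ZeroVelocity

variable {n : ℕ} {M : Type*} [TopologicalSpace M] [ChartedSpace (Model n) M] {L : Type*}

theorem isHamiltonianJet_zero {α : OneForm n M} {f : ℝ × L → M} {q : ℝ × L}
    (h : curveVel (n := n) f q = 0) : IsHamiltonianJet α f (fun _ => 0) q := by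
  have h1 : diffAt (n := n) (fun _ : M => (0 : ℝ)) (f q) = 0 := mfderiv_const
  exact ⟨by simp [h], fun w => by rw [h1, h]; simp⟩

theorem curveVel_eq_zero {f : ℝ × L → M} {q : ℝ × L} {y : M}
    (h : ∀ᶠ s in 𝓝 q.1, f (s, q.2) = y) : curveVel (n := n) f q = 0 := by
  have h1 : mfderiv 𝓘(ℝ, ℝ) (𝓡 (2 * n + 1)) (fun s => f (s, q.2)) q.1 =
      (0 : ℝ →L[ℝ] Model n) := by
    have h2 : HasMFDerivAt 𝓘(ℝ, ℝ) (𝓡 (2 * n + 1)) (fun s => f (s, q.2)) q.1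
      (0 : ℝ →L[ℝ] Model n) := (hasMFDerivAt_const y q.1).congr_of_eventuallyEq h
    exact h2.mfderiv
  exact congrArg (fun l : ℝ →L[ℝ] Model n => l 1) h1

end ZeroVelocity

/-! ### The Legendrian isotopy extension theorem. -/

section IsotopyExtension

variable {n : ℕ} {M : Type*} [TopologicalSpace M] [T2Space M] [SecondCountableTopology M]
  [ChartedSpace (Model n) M] [IsManifold (𝓡 (2 * n + 1)) ∞ M]
  {L : Type*} [TopologicalSpace L] [CompactSpace L]
  [ChartedSpace (EuclideanSpace ℝ (Fin n)) L] [IsManifold (𝓡 n) ∞ L]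

/-- A path of Legendrian embeddings is generated by a Hamiltonian, over compact sets. -/
theorem IsContactForm.exists_hamiltonian {α : OneForm n M} (hα : IsContactForm α)
    {f : ℝ × L → M} (hf : ContMDiff (𝓘(ℝ, ℝ).prod (𝓡 n)) (𝓡 (2 * n + 1)) ∞ f)
    (hleg : ∀ t, IsLegendrianEmbedding α fun x => f (t, x)) {S : Set (ℝ × M)} (hS : IsCompact S)
    (hSf : S ⊆ range fun q : ℝ × L => (q.1, f q)) :
    ∃ K : ℝ × M → ℝ, ContMDiff (𝓘(ℝ, ℝ).prod (𝓡 (2 * n + 1))) 𝓘(ℝ, ℝ) ∞ K ∧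
      ∀ q, (q.1, f q) ∈ S → IsHamiltonianJet α f K q := by
  have : LocallyCompactSpace M := ChartedSpace.locallyCompactSpace (Model n) M
  have key : ∃ (U : Set (ℝ × M)) (K : ℝ × M → ℝ), IsOpen U ∧ closure S ⊆ U ∧
      ContMDiff (𝓘(ℝ, ℝ).prod (𝓡 (2 * n + 1))) 𝓘(ℝ, ℝ) ∞ K ∧
      ∀ q, (q.1, f q) ∈ U → IsHamiltonianJet α f K q := by
    -- Compact induction with a cutoff at each union. Closures are carried along because the cutoff
    -- must separate two closed sets, `Uᶜ` and `closure T`.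
    refine hS.induction_on (p := fun T => ∃ (U : Set (ℝ × M)) (K : ℝ × M → ℝ), IsOpen U ∧
      closure T ⊆ U ∧ ContMDiff (𝓘(ℝ, ℝ).prod (𝓡 (2 * n + 1))) 𝓘(ℝ, ℝ) ∞ K ∧
      ∀ q, (q.1, f q) ∈ U → IsHamiltonianJet α f K q) ?_ ?_ ?_ ?_
    · exact ⟨∅, fun _ => 0, isOpen_empty, by simp, contMDiff_const, fun q hq => hq.elim⟩
    · rintro T T' hT ⟨U, K, hU, hTU, hK⟩
      exact ⟨U, K, hU, (closure_mono hT).trans hTU, hK⟩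
    · rintro T T' ⟨U, K, hU, hTU, hK, hj⟩ ⟨U', K', hU', hTU', hK', hj'⟩
      obtain ⟨χ, hχ0, hχ1, -⟩ := exists_contMDiffMap_zero_one_nhds_of_isClosed (n := ⊤)
        (𝓘(ℝ, ℝ).prod (𝓡 (2 * n + 1))) hU.isClosed_compl (isClosed_closure (s := T))
        (disjoint_compl_left_iff_subset.mpr hTU)
      obtain ⟨V₀, hV₀, hUV₀, hχV₀⟩ := mem_nhdsSet_iff_exists.mp hχ0
      obtain ⟨V₁, hV₁, hTV₁, hχV₁⟩ := mem_nhdsSet_iff_exists.mp hχ1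
      -- The patched function is `K` where the cutoff is 1, `K'` where it is 0, and on `U ∩ U'` both
      -- functions have the right jet, so any interpolation does.
      refine ⟨(V₁ ∩ U) ∪ (U ∩ U') ∪ (V₀ ∩ U'), fun p => K' p + χ p * (K p - K' p),
        ((hV₁.inter hU).union (hU.inter hU')).union (hV₀.inter hU'), ?_,
        hK'.add (χ.contMDiff.mul (hK.sub hK')), ?_⟩
      · rw [closure_union]
        rintro p (hp | hp)
        · exact Or.inl (Or.inl ⟨hTV₁ hp, hTU hp⟩)
        · by_cases hpU : p ∈ U
          · exact Or.inl (Or.inr ⟨hpU, hTU' hp⟩)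
          · exact Or.inr ⟨hUV₀ hpU, hTU' hp⟩
      · rintro q ((⟨h1, h2⟩ | ⟨h1, h2⟩) | ⟨h1, h2⟩)
        · refine (hj q h2).congr ?_
          filter_upwards [hV₁.mem_nhds h1] with p hp
          have : χ p = 1 := hχV₁ hp
          rw [this]
          ring
        · exact IsHamiltonianJet.interpolate hK hK' χ.contMDiff (hj q h1) (hj' q h2)
        · refine (hj' q h2).congr ?_
          filter_upwards [hV₀.mem_nhds h1] with p hp
          have : χ p = 0 := hχV₀ hp
          rw [this]
          ring
    · intro p hp
      obtain ⟨q, rfl⟩ := hSf hp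
      obtain ⟨U, K, hU, hqU, hK, hj⟩ := hα.exists_hamiltonian_near hf hleg q
      obtain ⟨V, ⟨hV, hVc⟩, hVU⟩ := (closed_nhds_basis (q.1, f q)).mem_iff.mp (hU.mem_nhds hqU)
      exact ⟨V, mem_nhdsWithin_of_mem_nhds hV, U, K, hU, by rwa [hVc.closure_eq], hK, hj⟩
  obtain ⟨U, K, -, hSU, hK, hj⟩ := key
  exact ⟨K, hK, fun q hq => hj q (hSU (subset_closure hq))⟩

/-- The Legendrian isotopy extension theorem, relative to a closed set which is disjoint from the
isotopy. -/
theorem IsContactForm.exists_isotopy_extension {α : OneForm n M} (hα : IsContactForm α)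
    {f : ℝ × L → M} (hf : ContMDiff (𝓘(ℝ, ℝ).prod (𝓡 n)) (𝓡 (2 * n + 1)) ∞ f)
    (hleg : ∀ t, IsLegendrianEmbedding α fun x => f (t, x))
    (hf0 : ∀ t ≤ 0, ∀ x, f (t, x) = f (0, x)) (hf1 : ∀ t, 1 ≤ t → ∀ x, f (t, x) = f (1, x))
    {A : Set M} (hA : IsClosed A) (hfA : ∀ q, f q ∉ A) :
    ∃ Φ : ℝ × M → M, ContMDiff (𝓘(ℝ, ℝ).prod (𝓡 (2 * n + 1))) (𝓡 (2 * n + 1)) ∞ Φ ∧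
      (∀ t, IsContactomorphism α fun x => Φ (t, x)) ∧ (∀ x, Φ (0, x) = x) ∧
      (∀ q : ℝ × L, Φ (q.1, f (0, q.2)) = f q) ∧ ∀ t, ∀ y ∈ A, Φ (t, y) = y := by
  have : LocallyCompactSpace M := ChartedSpace.locallyCompactSpace (Model n) M
  have hG : Continuous fun q : ℝ × L => (q.1, f q) := continuous_fst.prodMk hf.continuous
  have hQ : IsCompact (Icc (-1 : ℝ) 2 ×ˢ (univ : Set L)) := isCompact_Icc.prod isCompact_univ
  obtain ⟨K, hK, hKj⟩ := hα.exists_hamiltonian hf hleg (hQ.image hG) (image_subset_range _ _)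
  have hI : IsCompact (f '' (Icc (-1 : ℝ) 2 ×ˢ (univ : Set L))) := hQ.image hf.continuous
  -- The support of the cut-off Hamiltonian stays in a compact neighbourhood of the trace of the
  -- path that avoids `A`, so the flow fixes `A`.
  obtain ⟨D, hD, hID, hDA⟩ := exists_compact_between hI hA.isOpen_compl
    (by rintro _ ⟨q, -, rfl⟩; exact hfA q)
  obtain ⟨χ, hχ1, hχ0, -⟩ := exists_contMDiffMap_one_nhds_of_subset_interior (n := ⊤)
    (𝓡 (2 * n + 1)) hI.isClosed hID
  obtain ⟨τ, hτ1, hτ0, -⟩ := exists_contMDiffMap_one_nhds_of_subset_interior (n := ⊤)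
    𝓘(ℝ, ℝ) (s := Icc (0 : ℝ) 1) (t := Icc (-1 : ℝ) 2) isClosed_Icc
    (by rw [interior_Icc]; exact fun t ht => ⟨by linarith [ht.1], by linarith [ht.2]⟩)
  set c : ℝ × M → ℝ := fun p => τ p.1 * χ p.2
  have hc : ContMDiff (𝓘(ℝ, ℝ).prod (𝓡 (2 * n + 1))) 𝓘(ℝ, ℝ) ∞ c :=
    (τ.contMDiff.comp contMDiff_fst).mul (χ.contMDiff.comp contMDiff_snd)
  -- Written as an interpolation between `K` and the zero function: at times outside `[0, 1]` the
  -- path is stationary, so both have the prescribed jet and the time cutoff does no harm.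
  set K' : ℝ × M → ℝ := fun p => 0 + c p * (K p - 0)
  have hK' : ContMDiff (𝓘(ℝ, ℝ).prod (𝓡 (2 * n + 1))) 𝓘(ℝ, ℝ) ∞ K' :=
    contMDiff_const.add (hc.mul (hK.sub contMDiff_const))
  have hK'0 : ∀ p, p ∉ Icc (-1 : ℝ) 2 ×ˢ D → K' p = 0 := by
    intro p hp
    have : c p = 0 := by
      by_cases h : p.1 ∈ Icc (-1 : ℝ) 2
      · have h2 : χ p.2 = 0 := hχ0 _ fun h2 => hp ⟨h, h2⟩
        simp [c, h2]
      · simp [c, hτ0 _ h]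
    simp [K', this]
  obtain ⟨Φ, hΦ, hΦ0, hΦd, hΦv⟩ := hα.exists_hamiltonian_flow hK' hD hK'0
  have hjet : ∀ q, IsHamiltonianJet α f K' q := by
    rintro ⟨t, x⟩
    have hst : t ∉ Icc (0 : ℝ) 1 → curveVel (n := n) f (t, x) = 0 := by
      intro ht
      rcases lt_or_ge t 0 with h | h
      · refine curveVel_eq_zero (y := f (0, x)) ?_
        filter_upwards [isOpen_Iio.mem_nhds h] with s hs using hf0 s hs.le x
      · have h1 : 1 < t := by
          by_contra h1
          exact ht ⟨h, not_lt.mp h1⟩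
        refine curveVel_eq_zero (y := f (1, x)) ?_
        filter_upwards [isOpen_Ioi.mem_nhds h1] with s hs using hf1 s hs.le x
    by_cases ht : t ∈ Icc (-1 : ℝ) 2
    · have hfI : f (t, x) ∈ f '' (Icc (-1 : ℝ) 2 ×ˢ (univ : Set L)) :=
        mem_image_of_mem f ⟨ht, trivial⟩
      have h1 : IsHamiltonianJet α f K (t, x) := hKj _ ⟨(t, x), ⟨ht, trivial⟩, rfl⟩
      by_cases ht' : t ∈ Icc (0 : ℝ) 1
      · refine h1.congr ?_
        have h2 : ∀ᶠ p : ℝ × M in 𝓝 (t, f (t, x)), τ p.1 = 1 :=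
          (continuousAt_fst (p := (t, f (t, x)))).eventually
            (Filter.Eventually.filter_mono (nhds_le_nhdsSet ht') hτ1)
        have h3 : ∀ᶠ p : ℝ × M in 𝓝 (t, f (t, x)), χ p.2 = 1 :=
          (continuousAt_snd (p := (t, f (t, x)))).eventually
            (Filter.Eventually.filter_mono (nhds_le_nhdsSet hfI) hχ1)
        filter_upwards [h2, h3] with p hp2 hp3
        simp [K', c, hp2, hp3]
      · exact IsHamiltonianJet.interpolate hK contMDiff_const hc h1
          (isHamiltonianJet_zero (hst ht'))
    · refine (isHamiltonianJet_zero (hst fun h => ht ⟨by linarith [h.1], by linarith [h.2]⟩)).congr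
        ?_
      have h2 : ∀ᶠ p : ℝ × M in 𝓝 (t, f (t, x)), p.1 ∈ (Icc (-1 : ℝ) 2)ᶜ :=
        continuousAt_fst.eventually (isClosed_Icc.isOpen_compl.mem_nhds ht)
      filter_upwards [h2] with p hp
      exact hK'0 p fun h => hp h.1
  refine ⟨Φ, hΦ, fun t => hα.isContactomorphism_flow hK' hΦ hΦ0 hΦd hΦv t, hΦ0, ?_, ?_⟩
  · rintro ⟨t, x⟩
    -- The given path is itself a trajectory, its velocity being the Hamiltonian one, so it
    -- coincides with the flow line through its initial point.
    refine congrFun (hα.trajectory_unique hK' (γ := fun s => Φ (s, f (0, x)))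
      (γ' := fun s => f (s, x)) (fun s => hΦv s _) (fun s => ?_) (hΦ0 _) (t₀ := 0)) t
    rw [(hjet (s, x)).hamVel_eq hα]
    exact hasVelocity_curveVel hf (s, x)
  · intro t y hy
    refine congrFun (hα.trajectory_unique hK' (γ := fun s => Φ (s, y))
      (γ' := fun _ => y) (fun s => hΦv s _) (fun s => ?_) (hΦ0 _) (t₀ := 0)) t
    have h0 : hamVel α K' (s, y) = 0 := by
      refine hα.hamVel_eq_zero ?_
      filter_upwards [hD.isClosed.isOpen_compl.mem_nhds fun h : y ∈ D => hDA h hy] with z hz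
      exact hK'0 _ fun h => hz h.2
    rw [h0]
    exact hasVelocity_const _ _

end IsotopyExtension

/-! ### Composition and inversion of contactomorphisms, and their action on velocities and
Legendrian embeddings. -/

section Contactomorphisms

variable {n : ℕ} {M : Type*} [TopologicalSpace M] [ChartedSpace (Model n) M]

theorem IsContactomorphism.contMDiff {α : OneForm n M} {φ : M → M} (h : IsContactomorphism α φ) :
    ContMDiff (𝓡 (2 * n + 1)) (𝓡 (2 * n + 1)) ∞ φ := by
  obtain ⟨⟨e, rfl⟩, -⟩ := h
  exact e.contMDiff

theorem IsContactomorphism.hasMFDerivAt {α : OneForm n M} {φ : M → M}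
    (h : IsContactomorphism α φ) (x : M) :
    HasMFDerivAt (𝓡 (2 * n + 1)) (𝓡 (2 * n + 1)) φ x (tangentAt φ x) :=
  (h.contMDiff.mdifferentiableAt (by simp)).hasMFDerivAt

theorem IsContactomorphism.exists_pos {α : OneForm n M} {φ : M → M}
    (h : IsContactomorphism α φ) (x : M) :
    ∃ c : ℝ, 0 < c ∧ ∀ v, formAt α (φ x) (tangentAt φ x v) = c * formAt α x v := by
  obtain ⟨-, g, hg⟩ := h
  exact ⟨Real.exp (g x), Real.exp_pos _, hg x⟩

theorem IsContactomorphism.injective {α : OneForm n M} {φ : M → M}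
    (h : IsContactomorphism α φ) : Function.Injective φ := by
  obtain ⟨⟨e, rfl⟩, -⟩ := h
  exact e.injective

theorem IsContactomorphism.isEmbedding {α : OneForm n M} {φ : M → M}
    (h : IsContactomorphism α φ) : Topology.IsEmbedding φ := by
  obtain ⟨⟨e, rfl⟩, -⟩ := h
  exact e.toHomeomorph.isEmbedding

theorem IsContactomorphism.comp {α : OneForm n M} {φ ψ : M → M} (hψ : IsContactomorphism α ψ)
    (hφ : IsContactomorphism α φ) : IsContactomorphism α (fun x => ψ (φ x)) := by
  have hd : ∀ x, tangentAt (fun x => ψ (φ x)) x = (tangentAt ψ (φ x)).comp (tangentAt φ x) :=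
    fun x => (HasMFDerivAt.comp x (hψ.hasMFDerivAt (φ x)) (hφ.hasMFDerivAt x)).mfderiv
  obtain ⟨⟨e, rfl⟩, g, hg⟩ := hφ
  obtain ⟨⟨e', rfl⟩, g', hg'⟩ := hψ
  have key : ∀ (x : M) (v : Model n), formAt α (e' (e x)) (tangentAt (fun x => e' (e x)) x v) =
      Real.exp (g' (e x) + g x) * formAt α x v := fun x v => by
    have h1 : formAt α (e x) (tangentAt e x v) = Real.exp (g x) * formAt α x v := hg x v
    have h2 : formAt α (e' (e x)) (tangentAt e' (e x) (tangentAt e x v)) =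
      Real.exp (g' (e x)) * formAt α (e x) (tangentAt e x v) := hg' (e x) (tangentAt e x v)
    rw [hd x, ContinuousLinearMap.comp_apply, h2, h1, Real.exp_add, mul_assoc]
  exact ⟨⟨e.trans e', rfl⟩, fun x => g' (e x) + g x, key⟩

theorem IsContactomorphism.exists_inverse {α : OneForm n M} {φ : M → M}
    (hφ : IsContactomorphism α φ) :
    ∃ ψ, IsContactomorphism α ψ ∧ (∀ x, ψ (φ x) = x) ∧ ∀ x, φ (ψ x) = x := by
  have hdφ := hφ.hasMFDerivAt
  obtain ⟨⟨e, rfl⟩, g, hg⟩ := hφ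
  refine ⟨e.symm, ⟨⟨e.symm, rfl⟩, fun y => - g (e.symm y), fun y v => ?_⟩,
    e.symm_apply_apply, e.apply_symm_apply⟩
  have h1 : HasMFDerivAt (𝓡 (2 * n + 1)) (𝓡 (2 * n + 1)) e.symm y (tangentAt e.symm y) :=
    (e.symm.contMDiff.mdifferentiableAt (by simp)).hasMFDerivAt
  have h2 : HasMFDerivAt (𝓡 (2 * n + 1)) (𝓡 (2 * n + 1)) (fun y => y) y
      ((tangentAt e (e.symm y)).comp (tangentAt e.symm y)) := by
    refine (HasMFDerivAt.comp y (hdφ (e.symm y)) h1).congr_of_eventuallyEq ?_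
    exact Filter.Eventually.of_forall fun z => (e.apply_symm_apply z).symm
  have h3 : (tangentAt e (e.symm y)).comp (tangentAt e.symm y) =
      ContinuousLinearMap.id ℝ (Model n) := h2.mfderiv.symm.trans mfderiv_id
  have h4 : formAt α (e (e.symm y)) (tangentAt e (e.symm y) (tangentAt e.symm y v)) =
    Real.exp (g (e.symm y)) * formAt α (e.symm y) (tangentAt e.symm y v) := hg _ _
  have h5 : tangentAt e (e.symm y) (tangentAt e.symm y v) = v :=
    congrArg (fun l : Model n →L[ℝ] Model n => l v) h3
  rw [h5, e.apply_symm_apply] at h4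
  change formAt α (e.symm y) (tangentAt e.symm y v) = _ * formAt α y v
  rw [Real.exp_neg, h4, ← mul_assoc, inv_mul_cancel₀ (Real.exp_ne_zero _), one_mul]

theorem HasVelocity.comp_contactomorphism {α : OneForm n M} {φ : M → M}
    (hφ : IsContactomorphism α φ) {γ : ℝ → M} {v : Model n} {t : ℝ} (h : HasVelocity γ v t) :
    HasVelocity (fun s => φ (γ s)) (tangentAt φ (γ t) v) t := by
  refine (HasMFDerivAt.comp t (hφ.hasMFDerivAt (γ t)) h).congr_mfderiv ?_
  have : (tangentAt φ (γ t)).comp ((1 : ℝ →L[ℝ] ℝ).smulRight v) =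
      (1 : ℝ →L[ℝ] ℝ).smulRight (tangentAt φ (γ t) v) :=
    ContinuousLinearMap.ext_ring (by simp)
  exact this

theorem HasVelocity.reparam {γ : ℝ → M} {v : Model n} {t : ℝ} {s : ℝ → ℝ} {s' : ℝ}
    (h : HasVelocity γ v (s t)) (hs : HasDerivAt s s' t) :
    HasVelocity (fun r => γ (s r)) (s' • v) t := by
  have h1 : HasMFDerivAt 𝓘(ℝ, ℝ) 𝓘(ℝ, ℝ) s t ((1 : ℝ →L[ℝ] ℝ).smulRight s') :=
    hasMFDerivAt_iff_hasFDerivAt.mpr hs.hasFDerivAt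
  refine (HasMFDerivAt.comp t h h1).congr_mfderiv ?_
  have : ((1 : ℝ →L[ℝ] ℝ).smulRight v).comp ((1 : ℝ →L[ℝ] ℝ).smulRight s') =
      (1 : ℝ →L[ℝ] ℝ).smulRight (s' • v) :=
    ContinuousLinearMap.ext_ring (by simp)
  exact this

theorem HasVelocity.curveVel_eq {L : Type*} {f : ℝ × L → M} {q : ℝ × L} {v : Model n}
    (h : HasVelocity (fun s => f (s, q.2)) v q.1) : curveVel f q = v := by
  have h1 : mfderiv 𝓘(ℝ, ℝ) (𝓡 (2 * n + 1)) (fun s => f (s, q.2)) q.1 =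
    ((1 : ℝ →L[ℝ] ℝ).smulRight v : ℝ →L[ℝ] Model n) := h.mfderiv
  have h2 := congrArg (fun l : ℝ →L[ℝ] Model n => l 1) h1
  exact h2.trans (by simp)

variable {L : Type*} [TopologicalSpace L] [ChartedSpace (EuclideanSpace ℝ (Fin n)) L]

theorem IsLegendrianEmbedding.comp {α : OneForm n M} {φ : M → M} (hφ : IsContactomorphism α φ)
    {f : L → M} (hf : IsLegendrianEmbedding α f) :
    IsLegendrianEmbedding α (fun x => φ (f x)) := by
  have hd : ∀ x, HasMFDerivAt (𝓡 n) (𝓡 (2 * n + 1)) f x (sourceDeriv f x) := fun x =>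
    (hf.smooth.mdifferentiableAt (by simp)).hasMFDerivAt
  have hc : ∀ x, sourceDeriv (fun x => φ (f x)) x = (tangentAt φ (f x)).comp (sourceDeriv f x) :=
    fun x => (HasMFDerivAt.comp x (hφ.hasMFDerivAt (f x)) (hd x)).mfderiv
  obtain ⟨ψ, hψ, hψφ, -⟩ := hφ.exists_inverse
  have hinj : ∀ y, Function.Injective (tangentAt φ y) := fun y => by
    have h2 : HasMFDerivAt (𝓡 (2 * n + 1)) (𝓡 (2 * n + 1)) (fun y => y) y
        ((tangentAt ψ (φ y)).comp (tangentAt φ y)) := by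
      refine (HasMFDerivAt.comp y (hψ.hasMFDerivAt (φ y)) (hφ.hasMFDerivAt y)).congr_of_eventuallyEq
        ?_
      exact Filter.Eventually.of_forall fun z => (hψφ z).symm
    have h3 : (tangentAt ψ (φ y)).comp (tangentAt φ y) =
      ContinuousLinearMap.id ℝ (Model n) := h2.mfderiv.symm.trans mfderiv_id
    exact Function.LeftInverse.injective (g := tangentAt ψ (φ y)) fun v =>
      congrArg (fun l : Model n →L[ℝ] Model n => l v) h3
  refine ⟨hφ.contMDiff.comp hf.smooth, hφ.isEmbedding.comp hf.isEmbedding, fun x => ?_,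
    fun x v => ?_⟩
  · change Function.Injective (sourceDeriv (fun x => φ (f x)) x)
    rw [hc x]
    exact (hinj _).comp (hf.immersion x)
  · obtain ⟨c, -, h⟩ := hφ.exists_pos (f x)
    have key : ∀ v, formAt α (φ (f x)) (sourceDeriv (fun x => φ (f x)) x v) = 0 := fun v => by
      have h1 : formAt α (f x) (sourceDeriv f x v) = 0 := hf.tangent x v
      rw [hc x, ContinuousLinearMap.comp_apply, h, h1, mul_zero]
    exact key v

end Contactomorphisms

/-! ### Criteria for embedded, positive and negative pieces. -/

section Pieces

variable {n : ℕ} {M : Type*} [TopologicalSpace M] [ChartedSpace (Model n) M]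

/-- The derivative of a path of Legendrian embeddings transverse to the contact structure is
injective. -/
theorem mfderiv_injective_of_transverse {L : Type*} [TopologicalSpace L]
    [ChartedSpace (EuclideanSpace ℝ (Fin n)) L] {α : OneForm n M} {f : ℝ × L → M}
    (hf : ContMDiff (𝓘(ℝ, ℝ).prod (𝓡 n)) (𝓡 (2 * n + 1)) ∞ f) {q : ℝ × L}
    (hleg : IsLegendrianEmbedding α fun x => f (q.1, x))
    (hv : formAt α (f q) (curveVel f q) ≠ 0) :
    Function.Injective (mfderiv (𝓘(ℝ, ℝ).prod (𝓡 n)) (𝓡 (2 * n + 1)) f q) := by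
  set D : ℝ × EuclideanSpace ℝ (Fin n) →L[ℝ] Model n :=
    mfderiv (𝓘(ℝ, ℝ).prod (𝓡 n)) (𝓡 (2 * n + 1)) f q
  have hD : ∀ (r : ℝ) (ζ : EuclideanSpace ℝ (Fin n)), D (r, ζ) =
      r • curveVel f q + sourceDeriv (fun x => f (q.1, x)) q.2 ζ := by
    intro r ζ
    set l₀ : ℝ →L[ℝ] Model n := mfderiv 𝓘(ℝ, ℝ) (𝓡 (2 * n + 1)) (fun s => f (s, q.2)) q.1
    have h : D (r, ζ) = l₀ r +
          sourceDeriv (fun x => f (q.1, x)) q.2 ζ :=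
      mfderiv_prod_eq_add_apply (v := (r, ζ)) (hf.mdifferentiableAt (by simp))
    have h1 : ∀ l : ℝ →L[ℝ] Model n, l r = r • l 1 := fun l => by
      rw [← map_smul, smul_eq_mul, mul_one]
    rw [h, h1]
    rfl
  change Function.Injective D
  rw [injective_iff_map_eq_zero]
  rintro ⟨r, ζ⟩ h
  rw [hD] at h
  have h1 : formAt α (f q) (sourceDeriv (fun x => f (q.1, x)) q.2 ζ) = 0 := hleg.tangent q.2 ζ
  -- `α` kills the directions tangent to the Legendrian but not the velocity, so the time component
  -- vanishes and immersivity of the embedding does the rest.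
  have h2 := congrArg (formAt α (f q)) h
  rw [map_add, map_smul, h1, add_zero, map_zero, smul_eq_mul] at h2
  have hr : r = 0 := (mul_eq_zero.mp h2).resolve_right hv
  subst hr
  rw [zero_smul, zero_add] at h
  have h3 : Function.Injective (sourceDeriv (fun x => f (q.1, x)) q.2) := hleg.immersion q.2
  rw [h3 (h.trans (map_zero _).symm)]
  rfl

theorem uniqueMDiffOn_Icc_prod {L : Type*} [TopologicalSpace L]
    [ChartedSpace (EuclideanSpace ℝ (Fin n)) L] {a b : ℝ} (hab : a < b) :
    UniqueMDiffOn (𝓘(ℝ, ℝ).prod (𝓡 n)) (Icc a b ×ˢ (univ : Set L)) :=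
  (uniqueDiffOn_Icc hab).uniqueMDiffOn.prod uniqueMDiffOn_univ

/-- A continuous injection of the compact space `[a, b] × L` into a Hausdorff space is an embedding,
and transversality to the contact structure gives the immersion condition. -/
theorem isEmbeddedPiece_of_transverse [T2Space M] {L : Type*} [TopologicalSpace L] [CompactSpace L]
    [ChartedSpace (EuclideanSpace ℝ (Fin n)) L] {α : OneForm n M} {f : ℝ × L → M}
    (hf : ContMDiff (𝓘(ℝ, ℝ).prod (𝓡 n)) (𝓡 (2 * n + 1)) ∞ f) {E : ℝ → L → M} {a b : ℝ}
    (hab : a < b) (hE : ∀ t ∈ Icc a b, ∀ x, E t x = f (t, x))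
    (hleg : ∀ t ∈ Icc a b, IsLegendrianEmbedding α fun x => f (t, x))
    (hv : ∀ t ∈ Icc a b, ∀ x, formAt α (f (t, x)) (curveVel f (t, x)) ≠ 0)
    (hinj : InjOn f (Icc a b ×ˢ univ)) : IsEmbeddedPiece (n := n) E a b := by
  have hEf : ∀ p ∈ Icc a b ×ˢ (univ : Set L), E p.1 p.2 = f p := fun p hp => hE p.1 hp.1 p.2
  have hs : ContMDiffOn (𝓘(ℝ, ℝ).prod (𝓡 n)) (𝓡 (2 * n + 1)) ∞
      (fun p : ℝ × L => E p.1 p.2) (Icc a b ×ˢ univ) := hf.contMDiffOn.congr hEf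
  refine ⟨hs, ?_, fun p hp => ?_⟩
  · have : CompactSpace (Icc a b ×ˢ (univ : Set L) : Set (ℝ × L)) :=
      isCompact_iff_compactSpace.mp (isCompact_Icc.prod isCompact_univ)
    refine (Continuous.isClosedEmbedding (hs.continuousOn.domRestrict) ?_).isEmbedding
    rintro ⟨p, hp⟩ ⟨q, hq⟩ h
    have h1 : E p.1 p.2 = E q.1 q.2 := h
    rw [hEf p hp, hEf q hq] at h1
    exact Subtype.ext (hinj hp hq h1)
  · have h1 : mfderivWithin (𝓘(ℝ, ℝ).prod (𝓡 n)) (𝓡 (2 * n + 1)) (fun p : ℝ × L => E p.1 p.2)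
        (Icc a b ×ˢ univ) p = mfderiv (𝓘(ℝ, ℝ).prod (𝓡 n)) (𝓡 (2 * n + 1)) f p := by
      have h2 : HasMFDerivWithinAt (𝓘(ℝ, ℝ).prod (𝓡 n)) (𝓡 (2 * n + 1))
          (fun p : ℝ × L => E p.1 p.2) (Icc a b ×ˢ univ) p
          (mfderiv (𝓘(ℝ, ℝ).prod (𝓡 n)) (𝓡 (2 * n + 1)) f p) :=
        ((hf.mdifferentiableAt (by simp)).hasMFDerivAt.hasMFDerivWithinAt).congr_of_eventuallyEq
          (Filter.eventually_of_mem self_mem_nhdsWithin hEf) (hEf p hp)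
      exact h2.mfderivWithin (uniqueMDiffOn_Icc_prod hab p hp)
    rw [h1]
    exact mfderiv_injective_of_transverse hf (hleg p.1 hp.1) (hv p.1 hp.1 p.2)

/-- A path of the form `Ψₜ ∘ e`, for a path `Ψ` of contactomorphisms, extends to a contact isotopy
starting at the identity. -/
theorem exists_contactIsotopy_of_flow {L : Type*} {α : OneForm n M} {Ψ : ℝ × M → M}
    (hΨ : ContMDiff (𝓘(ℝ, ℝ).prod (𝓡 (2 * n + 1))) (𝓡 (2 * n + 1)) ∞ Ψ)
    (hc : ∀ t, IsContactomorphism α fun x => Ψ (t, x)) (e : L → M) {E : ℝ → L → M} {a b : ℝ}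
    (hab : a < b) (hE : ∀ t ∈ Icc a b, ∀ x, E t x = Ψ (t, e x)) :
    ∃ (Φ : ℝ → M → M) (h : ℝ → M → ℝ), IsContactIsotopy α a b Φ ∧ IsHamiltonianOf α a b Φ h ∧
      (∀ t ∈ Icc a b, Φ t '' range (E a) = range (E t)) ∧
      ∀ t ∈ Icc a b, ∀ x, h t (E t x) = formAt α (Ψ (t, e x))
        (curveVel (fun q : ℝ × L => Ψ (q.1, e q.2)) (t, x)) := by
  -- Precomposing with the inverse of the stage at time `a` makes the isotopy start at the identity
  -- without changing velocities along the path.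
  obtain ⟨Θ, hΘ, hΘΨ, hΨΘ⟩ := (hc a).exists_inverse
  have hsm : ContMDiff (𝓘(ℝ, ℝ).prod (𝓡 (2 * n + 1))) (𝓡 (2 * n + 1)) ∞
      (fun p : ℝ × M => Ψ (p.1, Θ p.2)) :=
    hΨ.comp (contMDiff_fst.prodMk (hΘ.contMDiff.comp contMDiff_snd))
  have hcΦ : ∀ t, IsContactomorphism α fun x => Ψ (t, Θ x) := fun t => (hc t).comp hΘ
  have haa : a ∈ Icc a b := left_mem_Icc.mpr hab.le
  have hΦE : ∀ t ∈ Icc a b, ∀ x, Ψ (t, Θ (E a x)) = E t x := fun t ht x => by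
    rw [hE a haa, hΘΨ, hE t ht]
  have hcurve : ∀ y, ContMDiff 𝓘(ℝ, ℝ) (𝓡 (2 * n + 1)) ∞ (fun s => Ψ (s, Θ y)) := fun y =>
    hΨ.comp (contMDiff_id.prodMk contMDiff_const)
  have hwithin : ∀ t ∈ Icc a b, ∀ y,
      mfderivWithin 𝓘(ℝ, ℝ) (𝓡 (2 * n + 1)) (fun s => Ψ (s, Θ y)) (Icc a b) t =
        mfderiv 𝓘(ℝ, ℝ) (𝓡 (2 * n + 1)) (fun s => Ψ (s, Θ y)) t := fun t ht y =>
    mfderivWithin_eq_mfderiv ((uniqueDiffOn_Icc hab).uniqueMDiffOn t ht)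
      ((hcurve y).mdifferentiableAt (by simp))
  -- The Hamiltonian is a function of the current position; the inverses `Λ t` recover the starting
  -- point of the trajectory through it.
  choose Λ hΛc hΛ1 hΛ2 using fun t => (hcΦ t).exists_inverse
  refine ⟨fun t x => Ψ (t, Θ x), fun t y => formAt α y
    (curveVel (fun q : ℝ × M => Ψ (q.1, Θ q.2)) (t, Λ t y)), ⟨hsm.contMDiffOn, funext hΨΘ,
      fun t _ => hcΦ t⟩, fun t ht x => ?_, fun t ht => ?_, fun t ht x => ?_⟩
  · rw [hwithin t ht x]
    simp only [hΛ1 t x]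
    rfl
  · ext y
    constructor
    · rintro ⟨_, ⟨x, rfl⟩, rfl⟩
      exact ⟨x, (hΦE t ht x).symm⟩
    · rintro ⟨x, rfl⟩
      exact ⟨_, ⟨x, rfl⟩, hΦE t ht x⟩
  · have hΛ : Λ t (E t x) = E a x := by rw [← hΦE t ht x, hΛ1]
    rw [hE t ht] at hΛ
    have hγ : (fun s => Ψ (s, Θ (E a x))) = fun s => Ψ (s, e x) := by rw [hE a haa, hΘΨ]
    have hv : curveVel (fun q : ℝ × M => Ψ (q.1, Θ q.2)) (t, E a x) =
        curveVel (fun q : ℝ × L => Ψ (q.1, e q.2)) (t, x) :=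
      congrArg (fun γ : ℝ → M =>
        (mfderiv 𝓘(ℝ, ℝ) (𝓡 (2 * n + 1)) γ t : ℝ →L[ℝ] Model n) 1) hγ
    simp only [hE t ht, hΛ, hv]

theorem isPositivePiece_of_flow {L : Type*} [TopologicalSpace L]
    [ChartedSpace (EuclideanSpace ℝ (Fin n)) L] {α : OneForm n M} {Ψ : ℝ × M → M}
    (hΨ : ContMDiff (𝓘(ℝ, ℝ).prod (𝓡 (2 * n + 1))) (𝓡 (2 * n + 1)) ∞ Ψ)
    (hc : ∀ t, IsContactomorphism α fun x => Ψ (t, x)) (e : L → M) {E : ℝ → L → M} {a b : ℝ}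
    (hab : a < b) (hE : ∀ t ∈ Icc a b, ∀ x, E t x = Ψ (t, e x))
    (hpos : ∀ t ∈ Icc a b, ∀ x, 0 < formAt α (Ψ (t, e x))
        (curveVel (fun q : ℝ × L => Ψ (q.1, e q.2)) (t, x))) : IsPositivePiece α E a b := by
  obtain ⟨Φ, h, h1, h2, h3, h4⟩ := exists_contactIsotopy_of_flow hΨ hc e hab hE
  refine ⟨Φ, h, h1, h2, h3, ?_⟩
  rintro t ht _ ⟨x, rfl⟩
  rw [h4 t ht x]
  exact hpos t ht x

theorem isNegativePiece_of_flow {L : Type*} [TopologicalSpace L]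
    [ChartedSpace (EuclideanSpace ℝ (Fin n)) L] {α : OneForm n M} {Ψ : ℝ × M → M}
    (hΨ : ContMDiff (𝓘(ℝ, ℝ).prod (𝓡 (2 * n + 1))) (𝓡 (2 * n + 1)) ∞ Ψ)
    (hc : ∀ t, IsContactomorphism α fun x => Ψ (t, x)) (e : L → M) {E : ℝ → L → M} {a b : ℝ}
    (hab : a < b) (hE : ∀ t ∈ Icc a b, ∀ x, E t x = Ψ (t, e x))
    (hneg : ∀ t ∈ Icc a b, ∀ x, formAt α (Ψ (t, e x))
        (curveVel (fun q : ℝ × L => Ψ (q.1, e q.2)) (t, x)) < 0) : IsNegativePiece α E a b := by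
  obtain ⟨Φ, h, h1, h2, h3, h4⟩ := exists_contactIsotopy_of_flow hΨ hc e hab hE
  refine ⟨Φ, h, h1, h2, h3, ?_⟩
  rintro t ht _ ⟨x, rfl⟩
  rw [h4 t ht x]
  exact hneg t ht x

end Pieces

/-! ### Pushing a Legendrian off itself by a positive flow. -/

section Pushoff

variable {n : ℕ} {M : Type*} [TopologicalSpace M] [ChartedSpace (Model n) M]
  [IsManifold (𝓡 (2 * n + 1)) ∞ M]
  {L : Type*} [TopologicalSpace L] [ChartedSpace (EuclideanSpace ℝ (Fin n)) L]
  [IsManifold (𝓡 n) ∞ L]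

/-- A path of Legendrian embeddings transverse to the contact structure is locally injective in
space and time. -/
theorem exists_injOn_nhds_of_transverse {α : OneForm n M} {f : ℝ × L → M}
    (hf : ContMDiff (𝓘(ℝ, ℝ).prod (𝓡 n)) (𝓡 (2 * n + 1)) ∞ f) {q₀ : ℝ × L}
    (hleg : IsLegendrianEmbedding α fun x => f (q₀.1, x))
    (hv : formAt α (f q₀) (curveVel f q₀) ≠ 0) : ∃ u ∈ 𝓝 q₀, InjOn f u := by
  obtain ⟨t₀, x₀⟩ := q₀
  set y₀ := f (t₀, x₀)
  set e := extChartAt (𝓡 (2 * n + 1)) y₀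
  set c := extChartAt (𝓡 n) x₀
  set z₀ : ℝ × EuclideanSpace ℝ (Fin n) := (t₀, c x₀)
  have hcx : c.symm (c x₀) = x₀ := c.left_inv (mem_extChartAt_source x₀)
  have hz₀ : z₀.2 ∈ c.target := c.map_source (mem_extChartAt_source x₀)
  have hfz : f (z₀.1, c.symm z₀.2) = y₀ := by simp only [z₀, hcx, y₀]
  have hfz₀ : f (z₀.1, c.symm z₀.2) ∈ e.source := by
    rw [hfz]
    exact mem_extChartAt_source y₀
  have hdom := eventually_chartPath_domain hf.continuous hz₀ hfz₀
  have hinj : Function.Injective (fderiv ℝ (chartPath f y₀ x₀) z₀) := by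
    rw [injective_iff_map_eq_zero]
    rintro ⟨r, ζ⟩ h
    have h0 : ((r, ζ) : ℝ × EuclideanSpace ℝ (Fin n)) =
        r • ((1 : ℝ), (0 : EuclideanSpace ℝ (Fin n))) + ((0 : ℝ), ζ) := by simp
    rw [h0, map_add, map_smul, fderiv_chartPath_time hf hz₀ hfz₀,
      fderiv_chartPath_space hf hz₀ hfz₀] at h
    change r • chartDeriv y₀ (f (t₀, c.symm (c x₀))) (curveVel f (t₀, c.symm (c x₀))) +
      chartDeriv y₀ (f (t₀, c.symm (c x₀))) (sourceDeriv (fun x => f (t₀, x)) (c.symm (c x₀))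
        (sourceSymmDeriv x₀ (c x₀) ζ)) = 0 at h
    have h2 : sourceSymmDeriv x₀ (c x₀) ζ = ζ := sourceSymmDeriv_self x₀ ζ
    rw [h2, hcx, ← map_smul, ← map_add] at h
    have h3 : r • curveVel f (t₀, x₀) + sourceDeriv (fun x => f (t₀, x)) x₀ ζ = 0 :=
      chartDeriv_injective (mem_extChartAt_source y₀) (h.trans (map_zero _).symm)
    have h4 : formAt α y₀ (sourceDeriv (fun x => f (t₀, x)) x₀ ζ) = 0 := hleg.tangent x₀ ζ
    -- The same separation by `α`: the velocity is transverse and the spatial directions are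
    -- Legendrian, so the derivative in charts is injective and has a local left inverse.
    have h5 := congrArg (formAt α y₀) h3
    rw [map_add, map_smul, h4, add_zero, map_zero, smul_eq_mul] at h5
    have hr : r = 0 := (mul_eq_zero.mp h5).resolve_right hv
    subst hr
    rw [zero_smul, zero_add] at h3
    have h6 : Function.Injective (sourceDeriv (fun x => f (t₀, x)) x₀) := hleg.immersion x₀
    rw [h6 (h3.trans (map_zero _).symm)]
    rfl
  obtain ⟨g, -, hg⟩ := exists_contDiffOn_leftInverse
    (hdom.mono fun q hq => contDiffAt_chartPath hf hq.1 hq.2) hinj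
  have hcc : ContinuousAt (fun q : ℝ × L => (q.1, c q.2)) (t₀, x₀) :=
    continuousAt_fst.prodMk
      (ContinuousAt.comp (f := Prod.snd) (x := (t₀, x₀)) (continuousAt_extChartAt x₀)
        continuousAt_snd)
  have hx₀ : ∀ᶠ q : ℝ × L in 𝓝 (t₀, x₀), q.2 ∈ c.source :=
    continuousAt_snd.eventually ((isOpen_extChartAt_source x₀).mem_nhds (mem_extChartAt_source x₀))
  refine ⟨{q | g (chartPath f y₀ x₀ (q.1, c q.2)) = (q.1, c q.2) ∧ q.2 ∈ c.source},
    (hcc.eventually hg).and hx₀, ?_⟩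
  rintro ⟨t, x⟩ ⟨h1, h2⟩ ⟨t', x'⟩ ⟨h1', h2'⟩ h
  have hp : ∀ t x, x ∈ c.source → chartPath f y₀ x₀ (t, c x) = e (f (t, x)) := fun t x hx => by
    change e (f (t, c.symm (c x))) = _
    rw [c.left_inv hx]
  simp only at h1 h1' h2 h2'
  rw [hp t x h2, h] at h1
  rw [hp t' x' h2', h1] at h1'
  obtain ⟨h3, h4⟩ := Prod.mk.inj h1'
  rw [h3, c.injOn h2 h2' h4]

variable [T2Space M] [SecondCountableTopology M] [CompactSpace L]

/-- A Legendrian embedding can be pushed off itself by a contact flow which is positive along it. -/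
theorem IsContactForm.exists_pushoff {α : OneForm n M} (hα : IsContactForm α) {e : L → M}
    (he : IsLegendrianEmbedding α e) :
    ∃ (ρ : ℝ × M → M) (ε : ℝ), 0 < ε ∧
      ContMDiff (𝓘(ℝ, ℝ).prod (𝓡 (2 * n + 1))) (𝓡 (2 * n + 1)) ∞ ρ ∧
      (∀ t, IsContactomorphism α fun x => ρ (t, x)) ∧ (∀ x, ρ (0, x) = x) ∧
      InjOn (fun q : ℝ × L => ρ (q.1, e q.2)) (Icc 0 ε ×ˢ univ) ∧
      ∀ s ∈ Icc 0 ε, ∀ x, 0 < formAt α (ρ (s, e x))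
        (curveVel (fun q : ℝ × L => ρ (q.1, e q.2)) (s, x)) := by
  have : LocallyCompactSpace M := ChartedSpace.locallyCompactSpace (Model n) M
  have hI : IsCompact (range e) := isCompact_range he.smooth.continuous
  obtain ⟨D, hD, hID, -⟩ := exists_compact_between hI isOpen_univ (subset_univ _)
  obtain ⟨χ, hχ1, hχ0, -⟩ := exists_contMDiffMap_one_nhds_of_subset_interior (n := ⊤)
    (𝓡 (2 * n + 1)) hI.isClosed hID
  obtain ⟨τ, hτ1, hτ0, -⟩ := exists_contMDiffMap_one_nhds_of_subset_interior (n := ⊤)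
    𝓘(ℝ, ℝ) (s := Icc (0 : ℝ) 1) (t := Icc (-1 : ℝ) 2) isClosed_Icc
    (by rw [interior_Icc]; exact fun t ht => ⟨by linarith [ht.1], by linarith [ht.2]⟩)
  -- A cut-off of the constant Hamiltonian 1, whose contact field is the Reeb field.
  set K : ℝ × M → ℝ := fun p => τ p.1 * χ p.2
  have hK : ContMDiff (𝓘(ℝ, ℝ).prod (𝓡 (2 * n + 1))) 𝓘(ℝ, ℝ) ∞ K :=
    (τ.contMDiff.comp contMDiff_fst).mul (χ.contMDiff.comp contMDiff_snd)
  have hK0 : ∀ p, p ∉ Icc (-1 : ℝ) 2 ×ˢ D → K p = 0 := by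
    intro p hp
    by_cases h : p.1 ∈ Icc (-1 : ℝ) 2
    · have h2 : χ p.2 = 0 := hχ0 _ fun h2 => hp ⟨h, h2⟩
      simp [K, h2]
    · simp [K, hτ0 _ h]
  obtain ⟨ρ, hρ, hρ0, hρd, hρv⟩ := hα.exists_hamiltonian_flow hK hD hK0
  have hρc := fun t => hα.isContactomorphism_flow hK hρ hρ0 hρd hρv t
  set f : ℝ × L → M := fun q => ρ (q.1, e q.2)
  have hf : ContMDiff (𝓘(ℝ, ℝ).prod (𝓡 n)) (𝓡 (2 * n + 1)) ∞ f :=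
    hρ.comp (contMDiff_fst.prodMk (he.smooth.comp contMDiff_snd))
  have hvel : ∀ q, formAt α (f q) (curveVel f q) = K (q.1, f q) := fun q => by
    rw [HasVelocity.curveVel_eq (hρv q.1 (e q.2))]
    exact (hα.isContactPair (f q)).apply_hamVec _ _
  have hone : ∀ x, K ((0 : ℝ), f ((0 : ℝ), x)) = 1 := fun x => by
    have h1 : χ (e x) = 1 := hχ1.self_of_nhdsSet _ ⟨x, rfl⟩
    have h2 : τ 0 = 1 := hτ1.self_of_nhdsSet _ ⟨le_rfl, zero_le_one⟩
    simp [K, f, hρ0, h1, h2]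
  have hS : IsCompact ({0} ×ˢ (univ : Set L) : Set (ℝ × L)) :=
    isCompact_singleton.prod isCompact_univ
  have hleg : ∀ t, IsLegendrianEmbedding α fun x => f (t, x) := fun t => he.comp (hρc t)
  -- Injectivity on the compact set `{0} × L` together with local injectivity at its points gives
  -- injectivity on a neighbourhood; the tube lemma then yields a uniform time `ε` on which
  -- positivity holds too.
  obtain ⟨T, hT, hTinj⟩ := Set.InjOn.exists_mem_nhdsSet (f := f) (s := {0} ×ˢ (univ : Set L))
    (by
      rintro ⟨t, x⟩ ⟨ht, -⟩ ⟨t', x'⟩ ⟨ht', -⟩ h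
      simp only [mem_singleton_iff] at ht ht'
      subst ht ht'
      simp only [f, hρ0] at h
      rw [he.isEmbedding.injective h])
    hS (fun q _ => hf.continuous.continuousAt) (by
      rintro ⟨t, x⟩ ⟨ht, -⟩
      simp only [mem_singleton_iff] at ht
      subst ht
      refine exists_injOn_nhds_of_transverse hf (hleg _) ?_
      rw [hvel, hone]
      exact one_ne_zero)
  obtain ⟨V, hV, hSV, hVT⟩ := mem_nhdsSet_iff_exists.mp hT
  have hP : IsOpen {q : ℝ × L | 0 < K (q.1, f q)} :=
    isOpen_lt continuous_const (hK.continuous.comp (continuous_fst.prodMk hf.continuous))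
  obtain ⟨u, v, hu, -, h0u, hv, huv⟩ := generalized_tube_lemma (isCompact_singleton (x := (0 : ℝ)))
    (isCompact_univ (X := L)) (hV.inter hP) (by
      rintro ⟨t, x⟩ h
      refine ⟨hSV h, ?_⟩
      obtain ⟨ht, -⟩ := h
      simp only [mem_singleton_iff] at ht
      subst ht
      change 0 < K _
      rw [hone]
      exact one_pos)
  obtain ⟨ε, hε, hεu⟩ := Metric.isOpen_iff.mp hu 0 (h0u rfl)
  have hsub : Icc 0 (ε / 2) ×ˢ (univ : Set L) ⊆ V ∩ {q : ℝ × L | 0 < K (q.1, f q)} := by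
    rintro q ⟨hq, -⟩
    refine huv ⟨hεu ?_, hv trivial⟩
    rw [Metric.mem_ball, Real.dist_eq, sub_zero, abs_of_nonneg hq.1]
    linarith [hq.2]
  refine ⟨ρ, ε / 2, half_pos hε, hρ, hρc, hρ0, hTinj.mono fun q hq => hVT (hsub hq).1,
    fun s hs x => ?_⟩
  have h := (hsub (⟨hs, trivial⟩ : (s, x) ∈ Icc 0 (ε / 2) ×ˢ (univ : Set L))).2
  have h2 := hvel (s, x)
  exact lt_of_lt_of_eq h h2.symm

end Pushoff

/-! ### Subdivisions of `[0, 1]`, refinement and gluing. -/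

section Subdivisions

theorem IsSubdivision.monotone {N : ℕ} {t : ℕ → ℝ} (h : IsSubdivision N t) {i j : ℕ} (hij : i ≤ j)
    (hj : j ≤ N) : t i ≤ t j := by
  induction j, hij using Nat.le_induction with
  | base => exact le_rfl
  | succ k _ ih => exact (ih (by omega)).trans (h.2.2 k (by omega)).le

theorem IsSubdivision.pos {N : ℕ} {t : ℕ → ℝ} (h : IsSubdivision N t) : 0 < N := by
  rcases Nat.eq_zero_or_pos N with rfl | hN
  · have h1 := h.1.symm.trans h.2.1
    norm_num at h1
  · exact hN

theorem IsSubdivision.mem_Icc {N : ℕ} {t : ℕ → ℝ} (h : IsSubdivision N t) {i : ℕ} (hi : i ≤ N) :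
    t i ∈ Icc (0 : ℝ) 1 :=
  ⟨h.1 ▸ h.monotone (Nat.zero_le i) hi, h.2.1 ▸ h.monotone hi le_rfl⟩

theorem IsSubdivision.Icc_subset {N : ℕ} {t : ℕ → ℝ} (h : IsSubdivision N t) {i : ℕ} (hi : i < N) :
    Icc (t i) (t (i + 1)) ⊆ Icc (0 : ℝ) 1 :=
  Icc_subset_Icc (h.mem_Icc hi.le).1 (h.mem_Icc hi).2

/-- Every point before the end lies in a half-open cell. -/
theorem IsSubdivision.exists_cell {N : ℕ} {t : ℕ → ℝ} (h : IsSubdivision N t) {r : ℝ}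
    (h0 : 0 ≤ r) (h1 : r < 1) : ∃ i < N, t i ≤ r ∧ r < t (i + 1) := by
  by_contra! hcon
  have key : ∀ i ≤ N, t i ≤ r := by
    intro i
    induction i with
    | zero => intro _; rw [h.1]; exact h0
    | succ k ih => intro hk; exact hcon k (by omega) (ih (by omega))
  have := key N le_rfl
  rw [h.2.1] at this
  linarith

theorem IsSubdivision.exists_mem_cell {N : ℕ} {t : ℕ → ℝ} (h : IsSubdivision N t) {r : ℝ}
    (hr : r ∈ Icc (0 : ℝ) 1) : ∃ i < N, r ∈ Icc (t i) (t (i + 1)) := by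
  rcases hr.2.lt_or_eq with h1 | rfl
  · obtain ⟨i, hi, h2, h3⟩ := h.exists_cell hr.1 h1
    exact ⟨i, hi, h2, h3.le⟩
  · have hN := h.pos
    refine ⟨N - 1, by omega, ?_⟩
    have : N - 1 + 1 = N := by omega
    rw [this]
    exact ⟨(h.mem_Icc (by omega)).2, h.2.1.ge⟩

/-- The subdivision is the increasing enumeration of `B`, so no element of `B` falls strictly
between consecutive points. Applied to a union of two subdivisions, this gives common refinements.
-/
theorem exists_subdivision_of_finset {B : Finset ℝ} (h0 : (0 : ℝ) ∈ B) (h1 : (1 : ℝ) ∈ B)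
    (hB : ∀ b ∈ B, b ∈ Icc (0 : ℝ) 1) :
    ∃ (N : ℕ) (t : ℕ → ℝ), IsSubdivision N t ∧
      ∀ i < N, ∀ b ∈ B, b ≤ t i ∨ t (i + 1) ≤ b := by
  have hcard : 0 < B.card := Finset.card_pos.mpr ⟨0, h0⟩
  obtain ⟨N, hN⟩ : ∃ N, B.card = N + 1 := ⟨B.card - 1, by omega⟩
  let φ := B.orderIsoOfFin hN
  let t : ℕ → ℝ := fun i => if h : i < N + 1 then (φ ⟨i, h⟩ : ℝ) else 0
  have ht : ∀ (i : ℕ) (h : i < N + 1), t i = (φ ⟨i, h⟩ : ℝ) := fun i h => dif_pos h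
  have hmem : ∀ b ∈ B, ∃ (k : ℕ) (hk : k < N + 1), (φ ⟨k, hk⟩ : ℝ) = b := fun b hb => by
    refine ⟨(φ.symm ⟨b, hb⟩).1, (φ.symm ⟨b, hb⟩).2, ?_⟩
    simp
  have hmono : ∀ (i j : ℕ) (hi : i < N + 1) (hj : j < N + 1), i ≤ j →
      (φ ⟨i, hi⟩ : ℝ) ≤ φ ⟨j, hj⟩ := fun i j hi hj hij =>
    φ.monotone (a := ⟨i, hi⟩) (b := ⟨j, hj⟩) hij
  refine ⟨N, t, ⟨?_, ?_, fun i hi => ?_⟩, fun i hi b hb => ?_⟩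
  · rw [ht 0 (by omega)]
    obtain ⟨k, hk, hk0⟩ := hmem 0 h0
    refine le_antisymm ?_ (hB _ (φ _).2).1
    rw [← hk0]
    exact hmono _ _ _ _ (Nat.zero_le k)
  · rw [ht N (by omega)]
    obtain ⟨k, hk, hk1⟩ := hmem 1 h1
    refine le_antisymm (hB _ (φ _).2).2 ?_
    rw [← hk1]
    exact hmono _ _ _ _ (by omega)
  · rw [ht i (by omega), ht (i + 1) (by omega)]
    exact φ.strictMono (a := ⟨i, by omega⟩) (b := ⟨i + 1, by omega⟩) (Nat.lt_succ_self i)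
  · obtain ⟨k, hk, rfl⟩ := hmem b hb
    rw [ht i (by omega), ht (i + 1) (by omega)]
    rcases Nat.lt_or_ge i k with h | h
    · exact Or.inr (hmono _ _ _ _ h)
    · exact Or.inl (hmono _ _ _ _ h)

/-- Two subdivisions have a common refinement. -/
theorem IsSubdivision.exists_refinement {N N' : ℕ} {t t' : ℕ → ℝ} (h : IsSubdivision N t)
    (h' : IsSubdivision N' t') :
    ∃ (N'' : ℕ) (t'' : ℕ → ℝ), IsSubdivision N'' t'' ∧ ∀ k < N'',
      (∃ i < N, Icc (t'' k) (t'' (k + 1)) ⊆ Icc (t i) (t (i + 1))) ∧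
      ∃ i < N', Icc (t'' k) (t'' (k + 1)) ⊆ Icc (t' i) (t' (i + 1)) := by
  classical
  set B : Finset ℝ := (Finset.range (N + 1)).image t ∪ (Finset.range (N' + 1)).image t'
  have hBt : ∀ i ≤ N, t i ∈ B := fun i hi => Finset.mem_union_left _
    (Finset.mem_image_of_mem t (Finset.mem_range.mpr (by omega)))
  have hBt' : ∀ i ≤ N', t' i ∈ B := fun i hi => Finset.mem_union_right _
    (Finset.mem_image_of_mem t' (Finset.mem_range.mpr (by omega)))
  obtain ⟨N'', t'', hs, hc⟩ := exists_subdivision_of_finset (B := B)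
    (h.1 ▸ hBt 0 (Nat.zero_le _)) (h.2.1 ▸ hBt N le_rfl) (fun b hb => by
      rcases Finset.mem_union.mp hb with hb | hb
      · obtain ⟨i, hi, rfl⟩ := Finset.mem_image.mp hb
        exact h.mem_Icc (by have := Finset.mem_range.mp hi; omega)
      · obtain ⟨i, hi, rfl⟩ := Finset.mem_image.mp hb
        exact h'.mem_Icc (by have := Finset.mem_range.mp hi; omega))
  refine ⟨N'', t'', hs, fun k hk => ?_⟩
  have hk0 := (hs.mem_Icc hk.le).1
  have hk1 : t'' k < 1 := (hs.2.2 k hk).trans_le (hs.mem_Icc hk).2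
  constructor
  · obtain ⟨i, hi, h1, h2⟩ := h.exists_cell hk0 hk1
    exact ⟨i, hi, Icc_subset_Icc h1 ((hc k hk _ (hBt (i + 1) hi)).resolve_left (not_le.mpr h2))⟩
  · obtain ⟨i, hi, h1, h2⟩ := h'.exists_cell hk0 hk1
    exact ⟨i, hi, Icc_subset_Icc h1 ((hc k hk _ (hBt' (i + 1) hi)).resolve_left (not_le.mpr h2))⟩

/-- Inserting the midpoints of the cells of a subdivision. -/
theorem IsSubdivision.exists_midpoints {N : ℕ} {t : ℕ → ℝ} (h : IsSubdivision N t) :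
    ∃ T : ℕ → ℝ, IsSubdivision (2 * N) T ∧ ∀ P : ℝ → ℝ → Prop,
      (∀ i < N, P (t i) ((t i + t (i + 1)) / 2) ∧ P ((t i + t (i + 1)) / 2) (t (i + 1))) →
      ∀ k < 2 * N, P (T k) (T (k + 1)) := by
  -- Even indices are the old points, odd indices the midpoints. The property `P` of cells is
  -- universally quantified, so that one `T` serves for strict monotonicity, smoothness and the
  -- final decomposition.
  let T : ℕ → ℝ := fun k => if k % 2 = 0 then t (k / 2) else (t (k / 2) + t (k / 2 + 1)) / 2
  have h0 : ∀ i, T (2 * i) = t i := fun i => by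
    have h1 : 2 * i % 2 = 0 := by omega
    have h2 : 2 * i / 2 = i := by omega
    simp only [T, h1, h2, if_true]
  have h1 : ∀ i, T (2 * i + 1) = (t i + t (i + 1)) / 2 := fun i => by
    have h1 : ¬ (2 * i + 1) % 2 = 0 := by omega
    have h2 : (2 * i + 1) / 2 = i := by omega
    simp only [T, h1, h2, if_false]
  have key : ∀ P : ℝ → ℝ → Prop,
      (∀ i < N, P (t i) ((t i + t (i + 1)) / 2) ∧ P ((t i + t (i + 1)) / 2) (t (i + 1))) →
      ∀ k < 2 * N, P (T k) (T (k + 1)) := by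
    intro P hP k hk
    rcases Nat.even_or_odd' k with ⟨i, rfl | rfl⟩
    · rw [h0, h1]
      exact (hP i (by omega)).1
    · have h2 : 2 * i + 1 + 1 = 2 * (i + 1) := by ring
      rw [h1, h2, h0]
      exact (hP i (by omega)).2
  refine ⟨T, ⟨?_, ?_, ?_⟩, key⟩
  · exact (h0 0).trans h.1
  · exact (h0 N).trans h.2.1
  · refine key (fun a b => a < b) fun i hi => ?_
    have := h.2.2 i hi
    constructor <;> linarith

/-- Gluing functions on consecutive intervals. -/
theorem exists_glue {Y : Type*} (N : ℕ) {t : ℕ → ℝ} (ht : ∀ i < N, t i < t (i + 1))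
    (h : ℕ → ℝ → Y) (hm : ∀ i, i + 1 < N → h i (t (i + 1)) = h (i + 1) (t (i + 1))) :
    ∃ g : ℝ → Y, ∀ i < N, ∀ r ∈ Icc (t i) (t (i + 1)), g r = h i r := by
  induction N with
  | zero => exact ⟨h 0, fun i hi => by omega⟩
  | succ N ih =>
    rcases Nat.eq_zero_or_pos N with rfl | hN
    · refine ⟨h 0, fun i hi r _ => ?_⟩
      obtain rfl : i = 0 := by omega
      rfl
    · obtain ⟨g, hg⟩ := ih (fun i hi => ht i (by omega)) (fun i hi => hm i (by omega))
      have hmono : ∀ i ≤ N, t i ≤ t N := fun i hi => by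
        have : ∀ k, i ≤ k → k ≤ N → t i ≤ t k := fun k hk => by
          induction k, hk using Nat.le_induction with
          | base => exact fun _ => le_rfl
          | succ k _ ih => exact fun hkN => (ih (by omega)).trans (ht k (by omega)).le
        exact this N hi le_rfl
      refine ⟨fun r => if r ≤ t N then g r else h N r, fun i hi r hr => ?_⟩
      rcases Nat.lt_or_ge i N with hiN | hiN
      · have : r ≤ t N := hr.2.trans (hmono (i + 1) hiN)
        simp only [this, if_true]
        exact hg i hiN r hr
      · obtain rfl : i = N := by omega
        by_cases hri : r ≤ t i
        · obtain rfl : r = t i := le_antisymm hri hr.1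
          simp only [le_rfl, if_true]
          obtain ⟨k, rfl⟩ : ∃ k, i = k + 1 := ⟨i - 1, by omega⟩
          rw [hg k (by omega) _ ⟨(ht k (by omega)).le, le_rfl⟩]
          exact hm k hi
        · simp only [hri, if_false]

end Subdivisions

/-! ### Concatenation of homotopies. -/

section Transitivity

variable {n : ℕ} {M : Type*} [TopologicalSpace M] [ChartedSpace (Model n) M]
  {L : Type*} [TopologicalSpace L] [ChartedSpace (EuclideanSpace ℝ (Fin n)) L]

theorem contMDiff_affine_time (c d : ℝ) :
    ContMDiff (𝓘(ℝ, ℝ).prod (𝓘(ℝ, ℝ).prod (𝓡 n))) (𝓘(ℝ, ℝ).prod (𝓘(ℝ, ℝ).prod (𝓡 n))) ∞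
      (fun p : ℝ × ℝ × L => (c * p.1 + d, p.2)) := by
  refine ContMDiff.prodMk ?_ contMDiff_snd
  exact (contMDiff_const.mul contMDiff_fst).add contMDiff_const

/-- Prolonging a homotopy. -/
theorem Represents.prolong {α : OneForm n M} {F E : ℝ → L → M} (h : Represents α F E) {N : ℕ}
    {τ : ℕ → ℝ} (hτ : IsSubdivision N τ) {G : ℝ → ℝ → L → M}
    (hleg : ∀ s ∈ Icc (0 : ℝ) 1, ∀ t ∈ Icc (0 : ℝ) 1, IsLegendrianEmbedding α (G s t))
    (hsm : ∀ i < N, ContMDiffOn (𝓘(ℝ, ℝ).prod (𝓘(ℝ, ℝ).prod (𝓡 n))) (𝓡 (2 * n + 1)) ∞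
        (fun p : ℝ × ℝ × L => G p.1 p.2.1 p.2.2)
        (Icc 0 1 ×ˢ (Icc (τ i) (τ (i + 1)) ×ˢ univ)))
    (hG0 : ∀ t ∈ Icc (0 : ℝ) 1, G 0 t = E t)
    (hstart : ∀ s ∈ Icc (0 : ℝ) 1, G s 0 = E 0) (hend : ∀ s ∈ Icc (0 : ℝ) 1, G s 1 = E 1) :
    Represents α F (G 1) := by
  obtain ⟨H, hH, hHF, hHE⟩ := h
  have i0 : (0 : ℝ) ∈ Icc (0 : ℝ) 1 := ⟨le_rfl, zero_le_one⟩
  have i1 : (1 : ℝ) ∈ Icc (0 : ℝ) 1 := ⟨zero_le_one, le_rfl⟩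
  -- Each homotopy is run at double speed; `+ 0` and `+ -1` give both halves the shape `c * s + d`
  -- of `contMDiff_affine_time`.
  let H' : ℝ → ℝ → L → M := fun s t => if s ≤ 1 / 2 then H (2 * s + 0) t else G (2 * s + -1) t
  have hlow : ∀ s ≤ 1 / 2, ∀ t, H' s t = H (2 * s + 0) t := fun s hs t => if_pos hs
  have hhigh : ∀ s, 1 / 2 ≤ s → ∀ t ∈ Icc (0 : ℝ) 1, H' s t = G (2 * s + -1) t := by
    intro s hs t ht
    rcases hs.lt_or_eq with h1 | rfl
    · exact if_neg (not_le.mpr h1)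
    · rw [hlow _ le_rfl]
      norm_num
      rw [hHE t ht, hG0 t ht]
  have hmlow : ∀ s ∈ Icc (0 : ℝ) 1, s ≤ 1 / 2 → 2 * s + 0 ∈ Icc (0 : ℝ) 1 := fun s hs h1 =>
    ⟨by linarith [hs.1], by linarith⟩
  have hmhigh : ∀ s ∈ Icc (0 : ℝ) 1, 1 / 2 ≤ s → 2 * s + -1 ∈ Icc (0 : ℝ) 1 := fun s hs h1 =>
    ⟨by linarith, by linarith [hs.2]⟩
  have h00 : ∀ t, H' 0 t = H 0 t := fun t => by
    rw [hlow 0 (by norm_num)]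
    norm_num
  have hfix : ∀ t ∈ Icc (0 : ℝ) 1, (∀ s ∈ Icc (0 : ℝ) 1, range (H s t) = range (H 0 t)) →
      (∀ s ∈ Icc (0 : ℝ) 1, G s t = E t) →
      ∀ s ∈ Icc (0 : ℝ) 1, range (H' s t) = range (H' 0 t) := by
    intro t ht h1 h2 s hs
    rw [h00]
    rcases le_total s (1 / 2) with h3 | h3
    · rw [hlow s h3]
      exact h1 _ (hmlow s hs h3)
    · rw [hhigh s h3 t ht, h2 _ (hmhigh s hs h3), ← hHE t ht]
      exact h1 1 i1
  obtain ⟨K, σ, N', τ', hσ, hτ', hsmH⟩ := hH.smooth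
  refine ⟨H', ⟨fun s hs t ht => ?_, ?_, hfix 0 i0 hH.start_fixed hstart,
    hfix 1 i1 hH.end_fixed hend⟩, fun t ht => by rw [h00, hHF t ht], fun t ht => ?_⟩
  · rcases le_total s (1 / 2) with h1 | h1
    · rw [hlow s h1]
      exact hH.legendrian _ (hmlow s hs h1) t ht
    · rw [hhigh s h1 t ht]
      exact hleg _ (hmhigh s hs h1) t ht
  · obtain ⟨N'', τ'', hτ'', href⟩ := hτ'.exists_refinement hτ
    -- The cells of `H` are compressed into `[0, 1/2]`, and one more cell `[1/2, 1]` suffices for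
    -- `G`, which is smooth in the deformation parameter on all of `[0, 1]`.
    let σ' : ℕ → ℝ := fun k => if k ≤ K then σ k / 2 else 1
    have hσ'1 : ∀ k ≤ K, σ' k = σ k / 2 := fun k hk => if_pos hk
    have hσ'2 : σ' (K + 1) = 1 := if_neg (by omega)
    have hσ'K : σ' K = 1 / 2 := by rw [hσ'1 K le_rfl, hσ.2.1]
    refine ⟨K + 1, σ', N'', τ'', ⟨?_, hσ'2, fun j hj => ?_⟩, hτ'', fun j hj i hi => ?_⟩
    · rw [hσ'1 0 (Nat.zero_le _), hσ.1, zero_div]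
    · rcases Nat.lt_or_ge j K with h1 | h1
      · rw [hσ'1 j h1.le, hσ'1 (j + 1) h1]
        have := hσ.2.2 j h1
        linarith
      · obtain rfl : j = K := by omega
        rw [hσ'K, hσ'2]
        norm_num
    · obtain ⟨⟨i₁, hi₁, hsub₁⟩, i₂, hi₂, hsub₂⟩ := href i hi
      rcases Nat.lt_or_ge j K with h1 | h1
      · rw [hσ'1 j h1.le, hσ'1 (j + 1) h1]
        refine ((hsmH j h1 i₁ hi₁).comp (contMDiff_affine_time 2 0).contMDiffOn ?_).congr ?_
        · rintro p ⟨hp1, hp2, -⟩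
          exact ⟨⟨by linarith [hp1.1], by linarith [hp1.2]⟩, hsub₁ hp2, trivial⟩
        · rintro p ⟨hp1, hp2, -⟩
          have h2 := (hσ.mem_Icc (i := j + 1) h1).2
          rw [hlow p.1 (by linarith [hp1.2])]
          rfl
      · obtain rfl : j = K := by omega
        rw [hσ'K, hσ'2]
        refine ((hsm i₂ hi₂).comp (contMDiff_affine_time 2 (-1)).contMDiffOn ?_).congr ?_
        · rintro p ⟨hp1, hp2, -⟩
          exact ⟨⟨by linarith [hp1.1], by linarith [hp1.2]⟩, hsub₂ hp2, trivial⟩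
        · rintro p ⟨hp1, hp2, -⟩
          rw [hhigh p.1 hp1.1 _ (hτ''.Icc_subset hi hp2)]
          rfl
  · rw [hhigh 1 (by norm_num) t ht]
    norm_num

end Transitivity

/-! ### Sweeping out an embedded piece by contactomorphisms. -/

section Sweep

variable {n : ℕ} {M : Type*} [TopologicalSpace M] [ChartedSpace (Model n) M]
  {L : Type*} [TopologicalSpace L] [ChartedSpace (EuclideanSpace ℝ (Fin n)) L]

theorem IsEmbeddedPiece.eq_of_eq {E : ℝ → L → M} {a b : ℝ} (h : IsEmbeddedPiece (n := n) E a b)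
    {t t' : ℝ} (ht : t ∈ Icc a b) (ht' : t' ∈ Icc a b) {x x' : L} (he : E t x = E t' x') :
    t = t' := by
  have h1 := h.isEmbedding.injective (a₁ := ⟨(t, x), ⟨ht, trivial⟩⟩)
    (a₂ := ⟨(t', x'), ⟨ht', trivial⟩⟩) he
  exact congrArg Prod.fst (Subtype.mk.inj h1)

theorem add_mul_smoothTransition_mem {c d : ℝ} (hcd : c ≤ d) (s : ℝ) :
    c + (d - c) * Real.smoothTransition s ∈ Icc c d := by
  have h0 := Real.smoothTransition.nonneg s
  have h1 := Real.smoothTransition.le_one s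
  constructor <;> nlinarith

variable [IsManifold (𝓡 (2 * n + 1)) ∞ M] [IsManifold (𝓡 n) ∞ L]
  [T2Space M] [SecondCountableTopology M] [CompactSpace L]

/-- Extension of a part of an isotopy, relative to a closed set. -/
theorem IsContactForm.exists_partial_extension {α : OneForm n M} (hα : IsContactForm α)
    {E : ℝ → L → M} {c d : ℝ} (hcd : c ≤ d)
    (hE : ContMDiffOn (𝓘(ℝ, ℝ).prod (𝓡 n)) (𝓡 (2 * n + 1)) ∞
      (fun p : ℝ × L => E p.1 p.2) (Icc c d ×ˢ univ))
    (hleg : ∀ t ∈ Icc c d, IsLegendrianEmbedding α (E t)) {A : Set M} (hA : IsClosed A)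
    (hEA : ∀ t ∈ Icc c d, ∀ x, E t x ∉ A) :
    ∃ Φ : ℝ × M → M, ContMDiff (𝓘(ℝ, ℝ).prod (𝓡 (2 * n + 1))) (𝓡 (2 * n + 1)) ∞ Φ ∧
      (∀ t, IsContactomorphism α fun x => Φ (t, x)) ∧ (∀ x, Φ (0, x) = x) ∧
      (∀ t x, Φ (t, E c x) = E (c + (d - c) * Real.smoothTransition t) x) ∧
      ∀ t, ∀ y ∈ A, Φ (t, y) = y := by
  have hθ : ContMDiff 𝓘(ℝ, ℝ) 𝓘(ℝ, ℝ) ∞ fun t => c + (d - c) * Real.smoothTransition t :=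
    (contDiff_const.add (contDiff_const.mul Real.smoothTransition.contDiff)).contMDiff
  have hmem := add_mul_smoothTransition_mem hcd
  set f : ℝ × L → M := fun q => E (c + (d - c) * Real.smoothTransition q.1) q.2
  -- Reparametrization by the smooth transition makes the path smooth for all times and stationary
  -- outside `[0, 1]`, as the extension theorem requires.
  have hf : ContMDiff (𝓘(ℝ, ℝ).prod (𝓡 n)) (𝓡 (2 * n + 1)) ∞ f := by
    have h1 : ContMDiff (𝓘(ℝ, ℝ).prod (𝓡 n)) (𝓘(ℝ, ℝ).prod (𝓡 n)) ∞
        (fun q : ℝ × L => (c + (d - c) * Real.smoothTransition q.1, q.2)) :=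
      (hθ.comp contMDiff_fst).prodMk contMDiff_snd
    exact hE.comp_contMDiff h1 fun q => ⟨hmem q.1, trivial⟩
  obtain ⟨Φ, hΦ, hΦc, hΦ0, hΦf, hΦA⟩ := hα.exists_isotopy_extension hf (fun t => hleg _ (hmem t))
    (fun t ht x => by simp only [f, Real.smoothTransition.zero_of_nonpos ht,
      Real.smoothTransition.zero])
    (fun t ht x => by simp only [f, Real.smoothTransition.one_of_one_le ht,
      Real.smoothTransition.one]) hA (fun q => hEA _ (hmem q.1) q.2)
  refine ⟨Φ, hΦ, hΦc, hΦ0, fun t x => ?_, hΦA⟩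
  have h := hΦf (t, x)
  simp only [f, Real.smoothTransition.zero, mul_zero, add_zero] at h
  exact h

/-- An embedded piece is swept out by a path `Ω` of contactomorphisms which agrees, on a given
closed set disjoint from the initial Legendrian, with a path fixing the initial Legendrian. -/
theorem IsContactForm.exists_sweep {α : OneForm n M} (hα : IsContactForm α) {E : ℝ → L → M}
    {a b : ℝ} (hab : a < b) (hE : IsEmbeddedPiece (n := n) E a b)
    (hleg : ∀ t ∈ Icc a b, IsLegendrianEmbedding α (E t)) {P : Set M} (hP : IsClosed P)
    (hEP : ∀ x, E a x ∉ P) :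
    ∃ (Ω A : ℝ × M → M) (β : ℝ → ℝ),
      ContMDiff (𝓘(ℝ, ℝ).prod (𝓡 (2 * n + 1))) (𝓡 (2 * n + 1)) ∞ Ω ∧
      ContMDiff (𝓘(ℝ, ℝ).prod (𝓡 (2 * n + 1))) (𝓡 (2 * n + 1)) ∞ A ∧ ContDiff ℝ ∞ β ∧
      (∀ t, IsContactomorphism α fun x => Ω (t, x)) ∧
      (∀ t, IsContactomorphism α fun x => A (t, x)) ∧
      (∀ x, Ω (0, x) = x) ∧ (∀ x, A (0, x) = x) ∧ (∀ t, β t ∈ Icc a b) ∧ β 0 = a ∧ β 1 = b ∧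
      (∀ t x, Ω (t, E a x) = E (β t) x) ∧ (∀ t x, A (t, E a x) = E a x) ∧
      ∀ t, ∀ y ∈ P, A (t, y) = Ω (t, y) := by
  have haa : a ∈ Icc a b := left_mem_Icc.mpr hab.le
  -- a first part of the isotopy is disjoint from `P`
  obtain ⟨c, hac, hcb, hcP⟩ : ∃ c, a < c ∧ c ≤ b ∧ ∀ t ∈ Icc a c, ∀ x, E t x ∉ P := by
    have hcont : Continuous fun q : ℝ × L => E (projIcc a b hab.le q.1) q.2 := by
      have h1 : Continuous fun q : ℝ × L => (((projIcc a b hab.le q.1 : Icc a b) : ℝ), q.2) :=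
        (continuous_subtype_val.comp (continuous_projIcc.comp continuous_fst)).prodMk
          continuous_snd
      exact hE.smooth.continuousOn.comp_continuous h1 fun q => ⟨(projIcc a b hab.le q.1).2, trivial⟩
    have hev : ∀ᶠ t in 𝓝 a, ∀ x ∈ (univ : Set L), E (projIcc a b hab.le t) x ∉ P := by
      refine isCompact_univ.eventually_forall_of_forall_eventually fun x _ => ?_
      refine hcont.continuousAt.eventually_mem (hP.isOpen_compl.mem_nhds ?_)
      rw [projIcc_of_mem hab.le haa]
      exact hEP x
    obtain ⟨δ, hδ, hball⟩ := Metric.eventually_nhds_iff.mp hev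
    refine ⟨min b (a + δ / 2), lt_min hab (by linarith), min_le_left _ _, fun t ht x => ?_⟩
    have htb : t ≤ b := ht.2.trans (min_le_left _ _)
    have htδ : t ≤ a + δ / 2 := ht.2.trans (min_le_right _ _)
    have h1 := hball (y := t) (by rw [Real.dist_eq, abs_of_nonneg] <;> linarith [ht.1]) x trivial
    rwa [projIcc_of_mem hab.le ⟨ht.1, htb⟩] at h1
  have hcc : c ∈ Icc a b := ⟨hac.le, hcb⟩
  have hsub1 : Icc a c ⊆ Icc a b := Icc_subset_Icc_right hcb
  have hsub2 : Icc c b ⊆ Icc a b := Icc_subset_Icc_left hac.le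
  obtain ⟨χ, hχ, hχc, hχ0, hχE, hχP⟩ := hα.exists_partial_extension hac.le
    (hE.smooth.mono (prod_mono hsub1 Subset.rfl)) (fun t ht => hleg t (hsub1 ht)) hP hcP
  have hcl : IsClosed (range (E a)) :=
    (isCompact_range (hleg a haa).smooth.continuous).isClosed
  obtain ⟨ψ, hψ, hψc, hψ0, hψE, hψA⟩ := hα.exists_partial_extension hcb
    (hE.smooth.mono (prod_mono hsub2 Subset.rfl)) (fun t ht => hleg t (hsub2 ht)) hcl
    -- Embeddedness of the piece enters here: for `t ≥ c > a` the Legendrian `E t` cannot meet `E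
    -- a`.
    (fun t ht x hx => by
      obtain ⟨x', hx'⟩ := hx
      have := hE.eq_of_eq haa (hsub2 ht) hx'
      linarith [ht.1])
  -- Clocks for the two isotopies: `χ` runs during `[0, 1/2]` and `ψ` during `[1/2, 1]`. The extra
  -- smooth transition in `β` is the one built into `exists_partial_extension`.
  set μ : ℝ → ℝ := fun s => Real.smoothTransition (2 * s)
  set ν : ℝ → ℝ := fun s => Real.smoothTransition (2 * s - 1)
  have hμ : ContDiff ℝ ∞ μ :=
    Real.smoothTransition.contDiff.comp (contDiff_const.mul contDiff_id)
  have hν : ContDiff ℝ ∞ ν :=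
    Real.smoothTransition.contDiff.comp ((contDiff_const.mul contDiff_id).sub contDiff_const)
  have hμ0 : μ 0 = 0 := by simp [μ]
  have hν0 : ∀ s ≤ 1 / 2, ν s = 0 := fun s hs =>
    Real.smoothTransition.zero_of_nonpos (by linarith)
  have hμ1 : ∀ s, 1 / 2 ≤ s → μ s = 1 := fun s hs =>
    Real.smoothTransition.one_of_one_le (by linarith)
  have hν1 : ν 1 = 1 := Real.smoothTransition.one_of_one_le (by norm_num)
  set β : ℝ → ℝ := fun s => a + (c - a) * Real.smoothTransition (μ s) +
    (b - c) * Real.smoothTransition (ν s)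
  have hβ : ContDiff ℝ ∞ β :=
    (contDiff_const.add (contDiff_const.mul (Real.smoothTransition.contDiff.comp hμ))).add
      (contDiff_const.mul (Real.smoothTransition.contDiff.comp hν))
  -- `Ω = ψ ∘ χ` and `A = ψ`: they agree on `P`, which `χ` fixes, while `A` fixes `E a`, which `ψ`
  -- fixes.
  refine ⟨fun p => ψ (ν p.1, χ (μ p.1, p.2)), fun p => ψ (ν p.1, p.2), β, ?_, ?_, hβ,
    fun t => (hψc (ν t)).comp (hχc (μ t)), fun t => hψc (ν t), fun x => ?_, fun x => ?_, fun t => ?_,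
    ?_, ?_, fun t x => ?_, fun t x => hψA _ _ ⟨x, rfl⟩, fun t y hy => ?_⟩
  · exact hψ.comp ((hν.contMDiff.comp contMDiff_fst).prodMk
      (hχ.comp ((hμ.contMDiff.comp contMDiff_fst).prodMk contMDiff_snd)))
  · exact hψ.comp ((hν.contMDiff.comp contMDiff_fst).prodMk contMDiff_snd)
  · simp only [hν0 0 (by norm_num), hμ0, hχ0, hψ0]
  · simp only [hν0 0 (by norm_num), hψ0]
  · have h1 := Real.smoothTransition.nonneg (μ t)
    have h2 := Real.smoothTransition.le_one (μ t)
    have h3 := Real.smoothTransition.nonneg (ν t)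
    have h4 := Real.smoothTransition.le_one (ν t)
    constructor <;> simp only [β] <;> nlinarith
  · simp only [β, hμ0, hν0 0 (by norm_num), Real.smoothTransition.zero]
    ring
  · simp only [β, hμ1 1 (by norm_num), hν1, Real.smoothTransition.one]
    ring
  · simp only [hχE, β]
    rcases le_total t (1 / 2) with h | h
    · rw [hν0 t h, hψ0, Real.smoothTransition.zero, mul_zero, add_zero]
    · have h1 : a + (c - a) = c := by ring
      rw [hμ1 t h, Real.smoothTransition.one, mul_one, h1, hψE]
  · simp only [hχP _ _ hy]

end Sweep

/-! ### Deforming an embedded piece into a zigzag. -/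

section PieceHomotopies

variable {n : ℕ} {M : Type*} [TopologicalSpace M] [ChartedSpace (Model n) M]
  {L : Type*} [TopologicalSpace L] [ChartedSpace (EuclideanSpace ℝ (Fin n)) L]

/-- The pieces obtained by moving a pushoff by a fixed contactomorphism are embedded, and positive
or negative. -/
theorem pushoff_piece [T2Space M] [CompactSpace L] {α : OneForm n M} {e : L → M}
    (he : IsLegendrianEmbedding α e) {ρ : ℝ × M → M} {ε : ℝ}
    (hρ : ContMDiff (𝓘(ℝ, ℝ).prod (𝓡 (2 * n + 1))) (𝓡 (2 * n + 1)) ∞ ρ)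
    (hρc : ∀ t, IsContactomorphism α fun x => ρ (t, x))
    (hinj : InjOn (fun q : ℝ × L => ρ (q.1, e q.2)) (Icc 0 ε ×ˢ univ))
    (hpos : ∀ s ∈ Icc 0 ε, ∀ x, 0 < formAt α (ρ (s, e x))
        (curveVel (fun q : ℝ × L => ρ (q.1, e q.2)) (s, x)))
    {Θ : M → M} (hΘ : IsContactomorphism α Θ) {E : ℝ → L → M} {a b s₀ s₁ : ℝ} (hab : a < b)
    (hs : ∀ t ∈ Icc a b, s₀ + s₁ * t ∈ Icc 0 ε) (hs₁ : s₁ ≠ 0)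
    (hE : ∀ t ∈ Icc a b, ∀ x, E t x = Θ (ρ (s₀ + s₁ * t, e x))) :
    IsEmbeddedPiece (n := n) E a b ∧ (0 < s₁ → IsPositivePiece α E a b) ∧
      (s₁ < 0 → IsNegativePiece α E a b) := by
  set Ψ : ℝ × M → M := fun p => Θ (ρ (s₀ + s₁ * p.1, p.2))
  have haff : ContMDiff 𝓘(ℝ, ℝ) 𝓘(ℝ, ℝ) ∞ fun t : ℝ => s₀ + s₁ * t :=
    (contDiff_const.add (contDiff_const.mul contDiff_id)).contMDiff
  have hΨ : ContMDiff (𝓘(ℝ, ℝ).prod (𝓡 (2 * n + 1))) (𝓡 (2 * n + 1)) ∞ Ψ :=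
    hΘ.contMDiff.comp (hρ.comp ((haff.comp contMDiff_fst).prodMk contMDiff_snd))
  have hΨc : ∀ t, IsContactomorphism α fun x => Ψ (t, x) := fun t => hΘ.comp (hρc (s₀ + s₁ * t))
  set f : ℝ × L → M := fun q => Ψ (q.1, e q.2)
  have hf : ContMDiff (𝓘(ℝ, ℝ).prod (𝓡 n)) (𝓡 (2 * n + 1)) ∞ f :=
    hΨ.comp (contMDiff_fst.prodMk (he.smooth.comp contMDiff_snd))
  have hg : ContMDiff (𝓘(ℝ, ℝ).prod (𝓡 n)) (𝓡 (2 * n + 1)) ∞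
      (fun q : ℝ × L => ρ (q.1, e q.2)) :=
    hρ.comp (contMDiff_fst.prodMk (he.smooth.comp contMDiff_snd))
  have hvel : ∀ t ∈ Icc a b, ∀ x, ∃ r : ℝ, 0 < r ∧ formAt α (f (t, x)) (curveVel f (t, x)) =
      s₁ * r := by
    intro t ht x
    have h1 := hasVelocity_curveVel hg (s₀ + s₁ * t, x)
    have h2 : HasDerivAt (fun t : ℝ => s₀ + s₁ * t) s₁ t := by
      simpa using ((hasDerivAt_id t).const_mul s₁).const_add s₀
    -- Reparametrization multiplies the velocity by `s₁`, and `Θ` multiplies `α` by a positive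
    -- factor, so the sign of the piece is that of `s₁`.
    have h3 := (HasVelocity.reparam (t := t) (s := fun t => s₀ + s₁ * t) h1 h2).comp_contactomorphism hΘ
    obtain ⟨C, hC, hC2⟩ := hΘ.exists_pos (ρ (s₀ + s₁ * t, e x))
    refine ⟨C * _, mul_pos hC (hpos _ (hs t ht) x), ?_⟩
    rw [HasVelocity.curveVel_eq (f := f) (q := (t, x)) h3]
    refine (hC2 _).trans ?_
    rw [map_smul, smul_eq_mul]
    ring
  refine ⟨isEmbeddedPiece_of_transverse hf hab hE (fun t _ => he.comp (hΨc t))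
    (fun t ht x => ?_) ?_, fun h => ?_, fun h => ?_⟩
  · obtain ⟨r, hr, h⟩ := hvel t ht x
    rw [h]
    exact mul_ne_zero hs₁ hr.ne'
  · rintro ⟨t, x⟩ ⟨ht, -⟩ ⟨t', x'⟩ ⟨ht', -⟩ h
    have h1 : (s₀ + s₁ * t, x) = (s₀ + s₁ * t', x') :=
      hinj ⟨hs t ht, trivial⟩ ⟨hs t' ht', trivial⟩ (hΘ.injective h)
    obtain ⟨h2, h3⟩ := Prod.mk.inj h1
    rw [mul_left_cancel₀ hs₁ (add_left_cancel h2), h3]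
  · refine isPositivePiece_of_flow hΨ hΨc e hab hE fun t ht x => ?_
    obtain ⟨r, hr, h'⟩ := hvel t ht x
    exact lt_of_lt_of_eq (mul_pos h hr) h'.symm
  · refine isNegativePiece_of_flow hΨ hΨc e hab hE fun t ht x => ?_
    obtain ⟨r, hr, h'⟩ := hvel t ht x
    exact lt_of_eq_of_lt h' (mul_neg_of_neg_of_pos h hr)

/-- `S` is a homotopy, relative to the endpoints, of paths of Legendrian embeddings parametrized
by `[a, b]`, smooth over both halves of `[a, b]`. -/
structure IsPieceHomotopy (α : OneForm n M) (E : ℝ → L → M) (a b : ℝ) (S : ℝ → ℝ → L → M) :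
    Prop where
  legendrian : ∀ u ∈ Icc (0 : ℝ) 1, ∀ t ∈ Icc a b, IsLegendrianEmbedding α (S u t)
  smooth_left : ContMDiffOn (𝓘(ℝ, ℝ).prod (𝓘(ℝ, ℝ).prod (𝓡 n))) (𝓡 (2 * n + 1)) ∞
    (fun p : ℝ × ℝ × L => S p.1 p.2.1 p.2.2) (Icc 0 1 ×ˢ (Icc a ((a + b) / 2) ×ˢ univ))
  smooth_right : ContMDiffOn (𝓘(ℝ, ℝ).prod (𝓘(ℝ, ℝ).prod (𝓡 n))) (𝓡 (2 * n + 1)) ∞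
    (fun p : ℝ × ℝ × L => S p.1 p.2.1 p.2.2) (Icc 0 1 ×ˢ (Icc ((a + b) / 2) b ×ˢ univ))
  start : ∀ u, S u a = E a
  finish : ∀ u, S u b = E b

theorem exists_isPieceHomotopy {α : OneForm n M} {E : ℝ → L → M} {a b : ℝ} (hab : a < b)
    {p₁ p₂ : ℝ → ℝ → L → M}
    (h₁ : ContMDiffOn (𝓘(ℝ, ℝ).prod (𝓘(ℝ, ℝ).prod (𝓡 n))) (𝓡 (2 * n + 1)) ∞
      (fun p : ℝ × ℝ × L => p₁ p.1 p.2.1 p.2.2) (Icc 0 1 ×ˢ (Icc a ((a + b) / 2) ×ˢ univ)))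
    (h₂ : ContMDiffOn (𝓘(ℝ, ℝ).prod (𝓘(ℝ, ℝ).prod (𝓡 n))) (𝓡 (2 * n + 1)) ∞
      (fun p : ℝ × ℝ × L => p₂ p.1 p.2.1 p.2.2) (Icc 0 1 ×ˢ (Icc ((a + b) / 2) b ×ˢ univ)))
    (hl₁ : ∀ u ∈ Icc (0 : ℝ) 1, ∀ t ∈ Icc a ((a + b) / 2), IsLegendrianEmbedding α (p₁ u t))
    (hl₂ : ∀ u ∈ Icc (0 : ℝ) 1, ∀ t ∈ Icc ((a + b) / 2) b, IsLegendrianEmbedding α (p₂ u t))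
    (hm : ∀ u, p₁ u ((a + b) / 2) = p₂ u ((a + b) / 2))
    (hs : ∀ u, p₁ u a = E a) (hf : ∀ u, p₂ u b = E b) :
    ∃ S, IsPieceHomotopy α E a b S ∧ (∀ u, ∀ t ∈ Icc a ((a + b) / 2), S u t = p₁ u t) ∧
      ∀ u, ∀ t ∈ Icc ((a + b) / 2) b, S u t = p₂ u t := by
  let S : ℝ → ℝ → L → M := fun u t => if t ≤ (a + b) / 2 then p₁ u t else p₂ u t
  have e₁ : ∀ u, ∀ t ∈ Icc a ((a + b) / 2), S u t = p₁ u t := fun u t ht => if_pos ht.2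
  have e₂ : ∀ u, ∀ t ∈ Icc ((a + b) / 2) b, S u t = p₂ u t := fun u t ht => by
    rcases ht.1.lt_or_eq with h | rfl
    · exact if_neg (not_le.mpr h)
    · exact (if_pos le_rfl).trans (hm u)
  refine ⟨S, ⟨fun u hu t ht => ?_, h₁.congr ?_, h₂.congr ?_, fun u => ?_, fun u => ?_⟩, e₁, e₂⟩
  · rcases le_total t ((a + b) / 2) with h | h
    · rw [e₁ u t ⟨ht.1, h⟩]
      exact hl₁ u hu t ⟨ht.1, h⟩
    · rw [e₂ u t ⟨h, ht.2⟩]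
      exact hl₂ u hu t ⟨h, ht.2⟩
  · rintro p ⟨-, hp, -⟩
    rw [e₁ _ _ hp]
  · rintro p ⟨-, hp, -⟩
    rw [e₂ _ _ hp]
  · rw [e₁ u a ⟨le_rfl, by linarith⟩, hs]
  · rw [e₂ u b ⟨by linarith, le_rfl⟩, hf]

theorem contMDiff_parameters {σ : ℝ × ℝ → ℝ} (hσ : ContDiff ℝ ∞ σ) :
    ContMDiff (𝓘(ℝ, ℝ).prod (𝓘(ℝ, ℝ).prod (𝓡 n))) 𝓘(ℝ, ℝ) ∞
      (fun p : ℝ × ℝ × L => σ (p.1, p.2.1)) := by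
  have h1 : ContMDiff (𝓘(ℝ, ℝ).prod (𝓘(ℝ, ℝ).prod (𝓡 n))) 𝓘(ℝ, ℝ × ℝ) ∞
      (fun p : ℝ × ℝ × L => (p.1, p.2.1)) :=
    contMDiff_fst.prodMk_space (contMDiff_fst.comp contMDiff_snd)
  exact hσ.contMDiff.comp h1

theorem contMDiff_flow_parameters {Φ : ℝ × M → M}
    (hΦ : ContMDiff (𝓘(ℝ, ℝ).prod (𝓡 (2 * n + 1))) (𝓡 (2 * n + 1)) ∞ Φ) {σ : ℝ × ℝ → ℝ}
    (hσ : ContDiff ℝ ∞ σ) {g : ℝ × ℝ × L → M}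
    (hg : ContMDiff (𝓘(ℝ, ℝ).prod (𝓘(ℝ, ℝ).prod (𝓡 n))) (𝓡 (2 * n + 1)) ∞ g) :
    ContMDiff (𝓘(ℝ, ℝ).prod (𝓘(ℝ, ℝ).prod (𝓡 n))) (𝓡 (2 * n + 1)) ∞
      (fun p : ℝ × ℝ × L => Φ (σ (p.1, p.2.1), g p)) :=
  hΦ.comp ((contMDiff_parameters hσ).prodMk hg)

variable [IsManifold (𝓡 (2 * n + 1)) ∞ M] [IsManifold (𝓡 n) ∞ L]
  [T2Space M] [SecondCountableTopology M] [CompactSpace L]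

/-- An embedded piece is homotopic, relative to its endpoints, to the concatenation of a positive
and of a negative embedded piece. -/
theorem IsContactForm.exists_zigzag {α : OneForm n M} (hα : IsContactForm α) {E : ℝ → L → M}
    {a b : ℝ} (hab : a < b) (hE : IsEmbeddedPiece (n := n) E a b)
    (hleg : ∀ t ∈ Icc a b, IsLegendrianEmbedding α (E t)) :
    ∃ S₀ S₁ S₂ : ℝ → ℝ → L → M, IsPieceHomotopy α E a b S₀ ∧ IsPieceHomotopy α E a b S₁ ∧
      IsPieceHomotopy α E a b S₂ ∧ (∀ t ∈ Icc a b, S₀ 0 t = E t) ∧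
      (∀ t ∈ Icc a b, S₁ 0 t = S₀ 1 t) ∧ (∀ t ∈ Icc a b, S₂ 0 t = S₁ 1 t) ∧
      (IsEmbeddedPiece (n := n) (S₂ 1) a ((a + b) / 2) ∧
        IsPositivePiece α (S₂ 1) a ((a + b) / 2)) ∧
      IsEmbeddedPiece (n := n) (S₂ 1) ((a + b) / 2) b ∧
        IsNegativePiece α (S₂ 1) ((a + b) / 2) b := by
  have haa : a ∈ Icc a b := left_mem_Icc.mpr hab.le
  have he := hleg a haa
  obtain ⟨ρ, ε, hε, hρ, hρc, hρ0, hρinj, hρpos⟩ := hα.exists_pushoff he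
  have h0ε : (0 : ℝ) ∈ Icc 0 ε := ⟨le_rfl, hε.le⟩
  have hεε : ε ∈ Icc 0 ε := ⟨hε.le, le_rfl⟩
  have hP : IsClosed (range fun x => ρ (ε, E a x)) :=
    (isCompact_range (he.comp (hρc ε)).smooth.continuous).isClosed
  obtain ⟨Ω, A, β, hΩ, hA, hβ, hΩc, hAc, hΩ0, hA0, hβm, hβ0, hβ1, hΩE, hAE, hAΩ⟩ :=
    -- The pushoff at time `ε` is disjoint from `E a` because the pushoff is injective on `[0, ε] ×
    -- L`.
    hα.exists_sweep hab hE hleg hP (fun x hx => by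
      obtain ⟨x', hx'⟩ := hx
      have h1 : (ε, x') = ((0 : ℝ), x) :=
        hρinj ⟨hεε, trivial⟩ ⟨h0ε, trivial⟩ (hx'.trans (hρ0 _).symm)
      exact hε.ne' (Prod.mk.inj h1).1)
  set c := (a + b) / 2 with hc
  set l := (b - a) / 2 with hl
  have hl0 : 0 < l := by rw [hl]; linarith
  have hac : a < c := by rw [hc]; linarith
  have hcb : c < b := by rw [hc]; linarith
  let τ₁ : ℝ → ℝ := fun t => (t - a) / l
  let τ₂ : ℝ → ℝ := fun t => (t - c) / l
  have hτ₁a : τ₁ a = 0 := by simp [τ₁]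
  have hτ₁c : τ₁ c = 1 := by
    simp only [τ₁]
    rw [div_eq_one_iff_eq hl0.ne', hc, hl]
    ring
  have hτ₂c : τ₂ c = 0 := by simp [τ₂]
  have hτ₂b : τ₂ b = 1 := by
    simp only [τ₂]
    rw [div_eq_one_iff_eq hl0.ne', hc, hl]
    ring
  have hτ₁s : ContDiff ℝ ∞ fun p : ℝ × ℝ => τ₁ p.2 :=
    (contDiff_snd.sub contDiff_const).div_const l
  have hτ₂s : ContDiff ℝ ∞ fun p : ℝ × ℝ => τ₂ p.2 :=
    (contDiff_snd.sub contDiff_const).div_const l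
  have hEa : ContMDiff (𝓘(ℝ, ℝ).prod (𝓘(ℝ, ℝ).prod (𝓡 n))) (𝓡 (2 * n + 1)) ∞
      (fun p : ℝ × ℝ × L => E a p.2.2) := he.smooth.comp (contMDiff_snd.comp contMDiff_snd)
  have hcvx : ∀ u ∈ Icc (0 : ℝ) 1, ∀ t ∈ Icc a b, ∀ r ∈ Icc a b,
      (1 - u) * t + u * r ∈ Icc a b := fun u hu t ht r hr =>
    convex_Icc a b ht hr (by linarith [hu.2]) hu.1 (by ring)
  -- the first homotopy concentrates the piece on the second half
  have hE0 : ∀ (σ : ℝ × ℝ → ℝ), ContDiff ℝ ∞ σ → ∀ (D : Set ℝ), D ⊆ Icc a b →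
      (∀ u ∈ Icc (0 : ℝ) 1, ∀ t ∈ D, σ (u, t) ∈ Icc a b) →
      ContMDiffOn (𝓘(ℝ, ℝ).prod (𝓘(ℝ, ℝ).prod (𝓡 n))) (𝓡 (2 * n + 1)) ∞
        (fun p : ℝ × ℝ × L => E (σ (p.1, p.2.1)) p.2.2) (Icc 0 1 ×ˢ (D ×ˢ univ)) := by
    intro σ hσ D _ hD
    have h1 : ContMDiff (𝓘(ℝ, ℝ).prod (𝓘(ℝ, ℝ).prod (𝓡 n))) (𝓘(ℝ, ℝ).prod (𝓡 n)) ∞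
        (fun p : ℝ × ℝ × L => (σ (p.1, p.2.1), p.2.2)) :=
      (contMDiff_parameters hσ).prodMk (contMDiff_snd.comp contMDiff_snd)
    exact hE.smooth.comp h1.contMDiffOn fun p hp => ⟨hD p.1 hp.1 p.2.1 hp.2.1, trivial⟩
  have hsub₁ : Icc a c ⊆ Icc a b := Icc_subset_Icc_right hcb.le
  have hsub₂ : Icc c b ⊆ Icc a b := Icc_subset_Icc_left hac.le
  have hu : ContDiff ℝ ∞ fun p : ℝ × ℝ => 1 - p.1 := contDiff_const.sub contDiff_fst
  obtain ⟨S₀, hS₀, hS₀l, hS₀r⟩ := exists_isPieceHomotopy (α := α) (E := E) hab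
    (p₁ := fun u t x => E ((1 - u) * t + u * a) x)
    (p₂ := fun u t x => E ((1 - u) * t + u * β (τ₂ t)) x)
    (hE0 (fun p => (1 - p.1) * p.2 + p.1 * a)
      ((hu.mul contDiff_snd).add (contDiff_fst.mul contDiff_const)) _ hsub₁
      fun u hu t ht => hcvx u hu t (hsub₁ ht) a haa)
    (hE0 (fun p => (1 - p.1) * p.2 + p.1 * β (τ₂ p.2))
      ((hu.mul contDiff_snd).add (contDiff_fst.mul (hβ.comp hτ₂s))) _ hsub₂
      fun u hu t ht => hcvx u hu t (hsub₂ ht) _ (hβm _))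
    (fun u hu t ht => hleg _ (hcvx u hu t (hsub₁ ht) a haa))
    (fun u hu t ht => hleg _ (hcvx u hu t (hsub₂ ht) _ (hβm _)))
    (fun u => by simp only [← hc, hτ₂c, hβ0])
    (fun u => funext fun x => congrArg (fun r => E r x) (by ring))
    (fun u => funext fun x => congrArg (fun r => E r x) (by simp only [hτ₂b, hβ1]; ring))
  -- the second homotopy pushes it off
  have hσ₁ : ContDiff ℝ ∞ fun p : ℝ × ℝ => p.1 * (ε * τ₁ p.2) :=
    contDiff_fst.mul (contDiff_const.mul hτ₁s)
  have hσ₂ : ContDiff ℝ ∞ fun p : ℝ × ℝ => p.1 * (ε * (1 - τ₂ p.2)) :=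
    contDiff_fst.mul (contDiff_const.mul (contDiff_const.sub hτ₂s))
  obtain ⟨S₁, hS₁, hS₁l, hS₁r⟩ := exists_isPieceHomotopy (α := α) (E := E) hab
    (p₁ := fun u t x => ρ (u * (ε * τ₁ t), E a x))
    (p₂ := fun u t x => Ω (τ₂ t, ρ (u * (ε * (1 - τ₂ t)), E a x)))
    (contMDiff_flow_parameters hρ hσ₁ hEa).contMDiffOn
    (contMDiff_flow_parameters hΩ hτ₂s (contMDiff_flow_parameters hρ hσ₂ hEa)).contMDiffOn
    (fun u _ t _ => he.comp (hρc _)) (fun u _ t _ => (he.comp (hρc _)).comp (hΩc _))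
    -- Both halves meet at the pushoff at time `u * ε` since `Ω` starts at the identity; at `a` and
    -- `b` the amount of pushing is zero, so the endpoints stay fixed.
    (fun u => by simp only [← hc, hτ₁c, hτ₂c, hΩ0, sub_zero])
    (fun u => by simp only [hτ₁a, mul_zero, hρ0])
    (fun u => by simp only [hτ₂b, sub_self, mul_zero, hρ0, hΩE, hβ1])
  -- the third homotopy moves the middle point along the piece
  have hσ₃ : ContDiff ℝ ∞ fun p : ℝ × ℝ => ε * τ₁ p.2 := contDiff_const.mul hτ₁s
  have hσ₄ : ContDiff ℝ ∞ fun p : ℝ × ℝ => ε * (1 - τ₂ p.2) :=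
    contDiff_const.mul (contDiff_const.sub hτ₂s)
  have hσ₅ : ContDiff ℝ ∞ fun p : ℝ × ℝ => τ₂ p.2 + p.1 * (1 - τ₂ p.2) :=
    hτ₂s.add (contDiff_fst.mul (contDiff_const.sub hτ₂s))
  obtain ⟨S₂, hS₂, hS₂l, hS₂r⟩ := exists_isPieceHomotopy (α := α) (E := E) hab
    (p₁ := fun u t x => A (u, ρ (ε * τ₁ t, E a x)))
    (p₂ := fun u t x => Ω (τ₂ t + u * (1 - τ₂ t), ρ (ε * (1 - τ₂ t), E a x)))
    (contMDiff_flow_parameters hA contDiff_fst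
      (contMDiff_flow_parameters hρ hσ₃ hEa)).contMDiffOn
    (contMDiff_flow_parameters hΩ hσ₅ (contMDiff_flow_parameters hρ hσ₄ hEa)).contMDiffOn
    (fun u _ t _ => (he.comp (hρc _)).comp (hAc _))
    (fun u _ t _ => (he.comp (hρc _)).comp (hΩc _))
    -- The two halves match at the middle exactly because `A` and `Ω` agree on `P`, the image of the
    -- full pushoff.
    (fun u => by
      funext x
      simp only [← hc, hτ₁c, hτ₂c, mul_one, sub_zero, zero_add]
      exact hAΩ u _ ⟨x, rfl⟩)
    (fun u => by simp only [hτ₁a, mul_zero, hρ0, hAE])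
    (fun u => by simp only [hτ₂b, sub_self, mul_zero, add_zero, hρ0, hΩE, hβ1])
  have hcase : ∀ t ∈ Icc a b, t ∈ Icc a c ∨ t ∈ Icc c b := fun t ht =>
    (le_total t c).imp (fun h => ⟨ht.1, h⟩) fun h => ⟨h, ht.2⟩
  -- The affine time change is `ε * (t - a) / l`, increasing from `0` to `ε` over the first half;
  -- hence the positive sign.
  have hpush₁ := pushoff_piece (E := S₂ 1) he hρ hρc hρinj hρpos (hAc 1) hac
    (s₀ := - (ε / l) * a) (s₁ := ε / l) (fun t ht => by
      have h1 : -(ε / l) * a + ε / l * t = ε / l * (t - a) := by ring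
      have h2 : t - a ≤ l := by
        have := ht.2
        rw [hc] at this
        rw [hl]
        linarith
      have h3 : ε / l * l = ε := div_mul_cancel₀ ε hl0.ne'
      have h4 : 0 < ε / l := div_pos hε hl0
      rw [h1]
      refine ⟨mul_nonneg h4.le (by linarith [ht.1]), ?_⟩
      calc ε / l * (t - a) ≤ ε / l * l := by gcongr
        _ = ε := h3)
    (div_pos hε hl0).ne' (fun t ht x => by
      rw [hS₂l 1 t ht]
      have h1 : -(ε / l) * a + ε / l * t = ε * τ₁ t := by simp only [τ₁]; ring
      simp only [h1])
  -- Here it is `ε * (b - t) / l`, decreasing from `ε` to `0`, and the sign is negative.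
  have hpush₂ := pushoff_piece (E := S₂ 1) he hρ hρc hρinj hρpos (hΩc 1) hcb
    (s₀ := ε / l * b) (s₁ := - (ε / l)) (fun t ht => by
      have h1 : ε / l * b + -(ε / l) * t = ε / l * (b - t) := by ring
      have h2 : b - t ≤ l := by
        have := ht.1
        rw [hc] at this
        rw [hl]
        linarith
      have h3 : ε / l * l = ε := div_mul_cancel₀ ε hl0.ne'
      have h4 : 0 < ε / l := div_pos hε hl0
      rw [h1]
      refine ⟨mul_nonneg h4.le (by linarith [ht.2]), ?_⟩
      calc ε / l * (b - t) ≤ ε / l * l := by gcongr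
        _ = ε := h3)
    (neg_ne_zero.mpr (div_pos hε hl0).ne') (fun t ht x => by
      rw [hS₂r 1 t ht]
      have h1 : ε / l * b + -(ε / l) * t = ε * (1 - τ₂ t) := by
        have h2 : 1 - τ₂ t = (b - t) / l := by
          rw [← hτ₂b]
          simp only [τ₂]
          ring
        rw [h2]
        ring
      have h3 : τ₂ t + 1 * (1 - τ₂ t) = 1 := by ring
      simp only [h1, h3])
  refine ⟨S₀, S₁, S₂, hS₀, hS₁, hS₂, fun t ht => ?_, fun t ht => ?_, fun t ht => ?_,
    ⟨hpush₁.1, hpush₁.2.1 (div_pos hε hl0)⟩, hpush₂.1,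
    hpush₂.2.2 (neg_neg_of_pos (div_pos hε hl0))⟩
  · rcases hcase t ht with h | h
    · rw [hS₀l 0 t h]
      simp
    · rw [hS₀r 0 t h]
      simp
  · rcases hcase t ht with h | h
    · rw [hS₀l 1 t h, hS₁l 0 t h]
      simp [hρ0]
    · rw [hS₀r 1 t h, hS₁r 0 t h]
      simp [hρ0, hΩE]
  · rcases hcase t ht with h | h
    · rw [hS₁l 1 t h, hS₂l 0 t h]
      simp [hA0]
    · rw [hS₁r 1 t h, hS₂r 0 t h]
      simp

end PieceHomotopies

/-! ### From pieces to decompositions. -/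

section Comparison

variable {n : ℕ} {M : Type*} [TopologicalSpace M] [ChartedSpace (Model n) M]
  {L : Type*}

theorem IsPositivePiece.congr {α : OneForm n M} {E E' : ℝ → L → M} {a b : ℝ}
    (h : IsPositivePiece α E a b) (hab : a ≤ b) (hE : ∀ t ∈ Icc a b, E' t = E t) :
    IsPositivePiece α E' a b := by
  obtain ⟨Φ, k, h1, h2, h3, h4⟩ := h
  refine ⟨Φ, k, h1, h2, fun t ht => ?_, fun t ht => ?_⟩
  · rw [hE t ht, hE a (left_mem_Icc.mpr hab)]
    exact h3 t ht
  · rw [hE t ht]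
    exact h4 t ht

theorem IsNegativePiece.congr {α : OneForm n M} {E E' : ℝ → L → M} {a b : ℝ}
    (h : IsNegativePiece α E a b) (hab : a ≤ b) (hE : ∀ t ∈ Icc a b, E' t = E t) :
    IsNegativePiece α E' a b := by
  obtain ⟨Φ, k, h1, h2, h3, h4⟩ := h
  refine ⟨Φ, k, h1, h2, fun t ht => ?_, fun t ht => ?_⟩
  · rw [hE t ht, hE a (left_mem_Icc.mpr hab)]
    exact h3 t ht
  · rw [hE t ht]
    exact h4 t ht

variable [TopologicalSpace L] [ChartedSpace (EuclideanSpace ℝ (Fin n)) L]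

theorem IsEmbeddedPiece.congr {E E' : ℝ → L → M} {a b : ℝ} (h : IsEmbeddedPiece (n := n) E a b)
    (hE : ∀ t ∈ Icc a b, E' t = E t) : IsEmbeddedPiece (n := n) E' a b := by
  have key : ∀ p ∈ Icc a b ×ˢ (univ : Set L), E' p.1 p.2 = E p.1 p.2 := fun p hp =>
    congrFun (hE p.1 hp.1) p.2
  refine ⟨h.smooth.congr key, ?_, fun p hp => ?_⟩
  · have h1 : (Icc a b ×ˢ (univ : Set L)).domRestrict (fun p : ℝ × L => E' p.1 p.2) =
        (Icc a b ×ˢ (univ : Set L)).domRestrict (fun p : ℝ × L => E p.1 p.2) :=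
      funext fun p => key p.1 p.2
    rw [h1]
    exact h.isEmbedding
  · have h1 := mfderivWithin_congr (I := 𝓘(ℝ, ℝ).prod (𝓡 n)) (I' := 𝓡 (2 * n + 1)) key (key p hp)
    intro u v huv
    rw [h1] at huv
    exact h.immersion p hp huv

/-- Homotopies of the pieces of a representative give another representative. -/
theorem Represents.exists_of_pieces {α : OneForm n M} {F E E' : ℝ → L → M}
    (hE' : Represents α F E') {N : ℕ} {t : ℕ → ℝ} (ht : IsSubdivision N t)
    {S : ℕ → ℝ → ℝ → L → M} (hS : ∀ i < N, IsPieceHomotopy α E (t i) (t (i + 1)) (S i))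
    (h0 : ∀ i < N, ∀ r ∈ Icc (t i) (t (i + 1)), S i 0 r = E' r) :
    ∃ E'', Represents α F E'' ∧ ∀ i < N, ∀ r ∈ Icc (t i) (t (i + 1)), E'' r = S i 1 r := by
  -- Gluing takes place in the path time `r`, with values in functions of the deformation parameter
  -- `u`. Neighbouring homotopies match because each keeps the endpoints of its piece of `E` fixed.
  obtain ⟨g, hg⟩ := exists_glue N ht.2.2 (fun i r u => S i u r) fun i hi => funext fun u =>
    ((hS i (by omega)).finish u).trans ((hS (i + 1) hi).start u).symm
  have hG : ∀ i < N, ∀ u, ∀ r ∈ Icc (t i) (t (i + 1)), g r u = S i u r := fun i hi u r hr =>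
    congrFun (hg i hi r hr) u
  obtain ⟨T, hT, hTP⟩ := ht.exists_midpoints
  have hmid : ∀ i < N, Icc (t i) ((t i + t (i + 1)) / 2) ⊆ Icc (t i) (t (i + 1)) ∧
      Icc ((t i + t (i + 1)) / 2) (t (i + 1)) ⊆ Icc (t i) (t (i + 1)) := fun i hi => by
    have := ht.2.2 i hi
    exact ⟨Icc_subset_Icc_right (by linarith), Icc_subset_Icc_left (by linarith)⟩
  have hN := ht.pos
  have hends : ∀ u, g 0 u = E 0 ∧ g 1 u = E 1 := by
    intro u
    obtain ⟨k, rfl⟩ : ∃ k, N = k + 1 := ⟨N - 1, by omega⟩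
    constructor
    · have h1 := hG 0 hN u (t 0) (left_mem_Icc.mpr (ht.2.2 0 hN).le)
      rwa [(hS 0 hN).start, ht.1] at h1
    · have h1 := hG k (by omega) u (t (k + 1)) (right_mem_Icc.mpr (ht.2.2 k (by omega)).le)
      rwa [(hS k (by omega)).finish, ht.2.1] at h1
  have hg0 : ∀ r ∈ Icc (0 : ℝ) 1, g r 0 = E' r := fun r hr => by
    obtain ⟨i, hi, hri⟩ := ht.exists_mem_cell hr
    rw [hG i hi 0 r hri, h0 i hi r hri]
  refine ⟨fun r => g r 1, hE'.prolong hT (G := fun u r => g r u) (fun u hu r hr => ?_)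
    (hTP (fun c d => ContMDiffOn (𝓘(ℝ, ℝ).prod (𝓘(ℝ, ℝ).prod (𝓡 n))) (𝓡 (2 * n + 1)) ∞
        (fun p : ℝ × ℝ × L => g p.2.1 p.1 p.2.2) (Icc 0 1 ×ˢ (Icc c d ×ˢ univ)))
      fun i hi => ⟨(hS i hi).smooth_left.congr ?_, (hS i hi).smooth_right.congr ?_⟩)
    hg0 (fun u _ => ?_) (fun u _ => ?_), fun i hi => hG i hi 1⟩
  · obtain ⟨i, hi, hri⟩ := ht.exists_mem_cell hr
    show IsLegendrianEmbedding α (g r u)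
    rw [hG i hi u r hri]
    exact (hS i hi).legendrian u hu r hri
  · rintro p ⟨-, hp, -⟩
    rw [hG i hi _ _ ((hmid i hi).1 hp)]
  · rintro p ⟨-, hp, -⟩
    rw [hG i hi _ _ ((hmid i hi).2 hp)]
  · rw [← hg0 0 ⟨le_rfl, zero_le_one⟩]
    exact (hends u).1.trans (hends 0).1.symm
  · rw [← hg0 1 ⟨zero_le_one, le_rfl⟩]
    exact (hends u).2.trans (hends 0).2.symm

variable [IsManifold (𝓡 (2 * n + 1)) ∞ M] [IsManifold (𝓡 n) ∞ L]
  [T2Space M] [SecondCountableTopology M] [CompactSpace L]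

/-- A decomposition into embedded pieces can be refined to one into twice as many embedded pieces
that are positive or negative. -/
theorem IsContactForm.hasDecomposition_two_mul {α : OneForm n M} (hα : IsContactForm α)
    {F : ℝ → L → M} {N : ℕ}
    (h : HasDecomposition α (fun E a b => IsEmbeddedPiece (n := n) E a b) F N) :
    HasDecomposition α (fun E a b => IsEmbeddedPiece (n := n) E a b ∧
      (IsPositivePiece α E a b ∨ IsNegativePiece α E a b)) F (2 * N) := by
  obtain ⟨E, t, hE, ht, hemb⟩ := h
  have hleg : ∀ r ∈ Icc (0 : ℝ) 1, IsLegendrianEmbedding α (E r) := fun r hr => by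
    obtain ⟨H, hH, -, hHE⟩ := hE
    rw [← hHE r hr]
    exact hH.legendrian 1 ⟨zero_le_one, le_rfl⟩ r hr
  have hz := fun i : Fin N => hα.exists_zigzag (ht.2.2 i i.2) (hemb i i.2)
    fun r hr => hleg r (ht.Icc_subset i.2 hr)
  choose S₀ S₁ S₂ hS₀ hS₁ hS₂ h₀ h₁ h₂ hpos hneg using hz
  -- The choices are made only for the `N` actual pieces; the constant value `E` beyond them is
  -- arbitrary.
  let ext : (Fin N → ℝ → ℝ → L → M) → ℕ → ℝ → ℝ → L → M := fun S i =>
    if hi : i < N then S ⟨i, hi⟩ else fun _ => E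
  have hext : ∀ S i (hi : i < N), ext S i = S ⟨i, hi⟩ := fun S i hi => dif_pos hi
  obtain ⟨E₁, hE₁, hE₁'⟩ := hE.exists_of_pieces (E := E) ht (S := ext S₀)
    (fun i hi => by rw [hext _ i hi]; exact hS₀ ⟨i, hi⟩)
    (fun i hi r hr => by rw [hext _ i hi]; exact h₀ ⟨i, hi⟩ r hr)
  obtain ⟨E₂, hE₂, hE₂'⟩ := hE₁.exists_of_pieces (E := E) ht (S := ext S₁)
    (fun i hi => by rw [hext _ i hi]; exact hS₁ ⟨i, hi⟩)
    (fun i hi r hr => by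
      rw [hE₁' i hi r hr, hext _ i hi, hext _ i hi]; exact h₁ ⟨i, hi⟩ r hr)
  obtain ⟨E₃, hE₃, hE₃'⟩ := hE₂.exists_of_pieces (E := E) ht (S := ext S₂)
    (fun i hi => by rw [hext _ i hi]; exact hS₂ ⟨i, hi⟩)
    (fun i hi r hr => by
      rw [hE₂' i hi r hr, hext _ i hi, hext _ i hi]; exact h₂ ⟨i, hi⟩ r hr)
  obtain ⟨T, hT, hTP⟩ := ht.exists_midpoints
  refine ⟨E₃, T, hE₃, hT, hTP (fun c d => IsEmbeddedPiece (n := n) E₃ c d ∧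
    (IsPositivePiece α E₃ c d ∨ IsNegativePiece α E₃ c d)) fun i hi => ?_⟩
  have hlt := ht.2.2 i hi
  have hl : t i ≤ (t i + t (i + 1)) / 2 := by linarith
  have hr : (t i + t (i + 1)) / 2 ≤ t (i + 1) := by linarith
  have hc : ∀ r ∈ Icc (t i) (t (i + 1)), E₃ r = S₂ ⟨i, hi⟩ 1 r := fun r hr => by
    rw [hE₃' i hi r hr, hext _ i hi]
  have hcl : ∀ r ∈ Icc (t i) ((t i + t (i + 1)) / 2), E₃ r = S₂ ⟨i, hi⟩ 1 r := fun r h =>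
    hc r ⟨h.1, h.2.trans hr⟩
  have hcr : ∀ r ∈ Icc ((t i + t (i + 1)) / 2) (t (i + 1)), E₃ r = S₂ ⟨i, hi⟩ 1 r := fun r h =>
    hc r ⟨hl.trans h.1, h.2⟩
  obtain ⟨e₁, p⟩ := hpos ⟨i, hi⟩
  obtain ⟨e₂, q⟩ := hneg ⟨i, hi⟩
  exact ⟨⟨e₁.congr hcl, Or.inl (p.congr hl hcl)⟩, e₂.congr hcr, Or.inr (q.congr hr hcr)⟩

end Comparison

end LegendrianLength

end

/-! ### The two inequalities between the lengths. -/

theorem proposition8p3 (n : ℕ)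
    {M : Type*} [TopologicalSpace M] [T2Space M] [SecondCountableTopology M]
    [ChartedSpace (EuclideanSpace ℝ (Fin (2 * n + 1))) M] [IsManifold (𝓡 (2 * n + 1)) ∞ M]
    {L : Type*} [TopologicalSpace L] [T2Space L] [CompactSpace L]
    [ChartedSpace (EuclideanSpace ℝ (Fin n)) L] [IsManifold (𝓡 n) ∞ L]
    (α : LegendrianLength.OneForm n M) (hα : LegendrianLength.IsContactForm α)
    (F : ℝ → L → M) (hF : LegendrianLength.IsLegendrianIsotopy α F) :
    LegendrianLength.zigzagLength α F ≤ 2 * LegendrianLength.discriminantLength α F ∧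
      LegendrianLength.discriminantLength α F ≤ LegendrianLength.zigzagLength α F := by
  refine ⟨?_, sInf_le_sInf ?_⟩
  · set A := {k : ℕ∞ | ∃ N : ℕ, k = N ∧ (N = 0 ∧ LegendrianLength.IsConstantClass α F ∨
      LegendrianLength.HasDecomposition α
        (fun E a b => LegendrianLength.IsEmbeddedPiece (n := n) E a b) F N)} with hA
    have hdisc : LegendrianLength.discriminantLength α F = sInf A := rfl
    rcases A.eq_empty_or_nonempty with h | h
    · rw [hdisc, h, sInf_empty, ENat.mul_top two_ne_zero]
      exact le_top
    · obtain ⟨N, hN, hN'⟩ := csInf_mem h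
      rw [hdisc, hN]
      rcases hN' with ⟨rfl, hc⟩ | hd
      · have h0 : LegendrianLength.zigzagLength α F ≤ ((0 : ℕ) : ℕ∞) :=
          sInf_le ⟨0, rfl, Or.inl ⟨rfl, hc⟩⟩
        exact h0.trans (by simp)
      · exact sInf_le ⟨2 * N, by push_cast; rfl, Or.inr (hα.hasDecomposition_two_mul hd)⟩
  · rintro k ⟨N, hk, hc | ⟨E, t, hE, ht, hp⟩⟩
    · exact ⟨N, hk, Or.inl hc⟩
    · exact ⟨N, hk, Or.inr ⟨E, t, hE, ht, fun i hi => (hp i hi).1⟩⟩
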